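/- **Setting.** Let $D\ge 1$ and let $\Delta$ be a finite pure simplicial complex of dimension $D-1$ with vertices in a finite set $V$ (the empty set counts as a face). Facets, ridges and codimension-two faces are its faces with $D$, $D-1$ and $D-2$ vertices. Let $\mathcal V=(v_i)_{i\in V}$ be vectors in $\mathbb R^D$. Write $\mathcal V_F=\{v_i:i\in F\}$, and let $\operatorname{cone}(\mathcal V_F)$ be the set of nonnegative linear combinations of $\mathcal V_F$. * $\mathcal V$ is a *pre-embedding* of $\Delta$ if, for every face $F$, the vectors $v_i$ ($i\in F$) are linearly independent. Then $\phi_{\Delta,\mathcal V}:|\Delta|\to S^{D-1}$ is the map that sends vertex $i$ to $v_i$, is extended linearly on each face, and is then divided by the Euclidean norm. * A pre-embedding has the *ICoP property* if every ridge $\tau$ lies in exactly two facets $\tau\cup\{a\}$, $\tau\cup\{b\}$, and $v_a,v_b$ lie strictly on opposite sides of the hyperplane spanned by $\mathcal V_\tau$. * $\mathcal V$ *embeds $\Delta$ as a complete simplicial fan* if it is a pre-embedding, $\operatorname{cone}(\mathcal V_F)\cap\operatorname{cone}(\mathcal V_G)=\operatorname{cone}(\mathcal V_{F\cap G})$ for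 all faces $F,G$, and the cones $\operatorname{cone}(\mathcal V_F)$ cover $\mathbb R^D$. * $\Delta$ is *strongly connected* if the graph whose vertices are the facets, two of them adjacent when they share a ridge, is connected. * $\Delta$ *has no singularities of codimension two* if the link of every codimension-two face $\rho$ is a single cycle (of length at least $3$), called the *elementary cycle* with center $\rho$. The elementary cycle is *simple in $\mathcal V$* if its image, a closed polygon through the classes of the vectors $v_i$ in $\mathbb R^D/\operatorname{lin}(\mathcal V_\rho)\cong\mathbb R^2$, has winding number $\pm1$ around $0$. * A vector is *generic* if it lies in none of the finitely many hyperplanes $\operatorname{lin}(\mathcal V_\tau)$, $\tau$ a ridge. A *fundamental cycle* of $\Delta$ is a simplicial $(D-1)$-cycle over $\mathbb Z$ (reduced, if $D=1$) with coefficient $\pm1$ on every facet; if $\Delta$ is strongly connected and every ridge lies in exactly two facets, it is unique up to sign, if it exists. The map $\phi_{\Delta,\mathcal V}$ *has degree $d$* with respect to a fundamental cycle if every generic $y\in S^{D-1}$ has exactly $d$ preimages counted with sign, where a preimage counts $+1$ or $-1$ according to whether $\phi_{\Delta,\mathcal V}$ preserves or reverses orientation on the facet containing it, facets being oriented by the fundamental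 cycle. **Theorem.** Let $\mathcal V\subset\mathbb R^D$ be a pre-embedding of $\Delta$ with the ICoP property. Then the following conditions are equivalent: 1. $\phi_{\Delta,\mathcal V}$ is a homeomorphism; equivalently, $\mathcal V$ embeds $\Delta$ as a complete simplicial fan in $\mathbb R^D$. 2. Every generic vector $v\in\mathbb R^D$ is contained in $\operatorname{cone}(\mathcal V_\sigma)$ for exactly one facet $\sigma$ of $\Delta$. 3. Some vector $v\in\mathbb R^D$ is contained in $\operatorname{cone}(\mathcal V_\sigma)$ for exactly one facet $\sigma$ of $\Delta$. 4. $\Delta$ is strongly connected, has no singularities of codimension two, and all its elementary cycles are simple in $\mathcal V$. 5. $\Delta$ is strongly connected, and $\phi_{\Delta,\mathcal V}$ has degree $\pm1$ (with respect to a fundamental cycle of $\Delta$). -/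

import Mathlib

namespace SimplicialFan

open scoped NNReal

section Combinatorics

variable {V : Type*}

/-- Faces of a simplicial complex, the empty face included (Mathlib stores the nonempty ones). -/
def IsFace (Δ : PreAbstractSimplicialComplex V) (F : Finset V) : Prop :=
  F = ∅ ∨ F ∈ Δ

/-- Facets: the inclusion-maximal faces. -/
def IsFacet (Δ : PreAbstractSimplicialComplex V) (σ : Finset V) : Prop :=
  Maximal (IsFace Δ) σ

/-- `Δ` is pure of dimension `D - 1`: every facet has exactly `D` vertices. -/
def IsPure (Δ : PreAbstractSimplicialComplex V) (D : ℕ) : Prop :=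
  ∀ σ, IsFacet Δ σ → σ.card = D

/-- Ridges: the faces of codimension one of a pure complex of dimension `D - 1`. -/
def IsRidge (Δ : PreAbstractSimplicialComplex V) (D : ℕ) (τ : Finset V) : Prop :=
  IsFace Δ τ ∧ τ.card + 1 = D

/-- Faces of codimension two of a pure complex of dimension `D - 1`. -/
def IsCodimTwo (Δ : PreAbstractSimplicialComplex V) (D : ℕ) (ρ : Finset V) : Prop :=
  IsFace Δ ρ ∧ ρ.card + 2 = D

variable [DecidableEq V]

/-- The dual graph of a pure complex of dimension `D - 1`: its vertices are the facets, and two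
facets are adjacent if they share a ridge. -/
def dualGraph (Δ : PreAbstractSimplicialComplex V) (D : ℕ) :
    SimpleGraph {σ : Finset V // IsFacet Δ σ} where
  Adj σ σ' := σ ≠ σ' ∧ ((σ : Finset V) ∩ (σ' : Finset V)).card + 1 = D
  symm := ⟨fun σ σ' h => ⟨h.1.symm, by rw [Finset.inter_comm]; exact h.2⟩⟩
  loopless := ⟨fun _ h => h.1 rfl⟩

/-- `Δ` is strongly connected: its dual graph is connected. -/
def IsStronglyConnected (Δ : PreAbstractSimplicialComplex V) (D : ℕ) : Prop :=
  (dualGraph Δ D).Connected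

/-- The faces (the empty one included) of the link of `F` in `Δ`. -/
def link (Δ : PreAbstractSimplicialComplex V) (F : Finset V) : Set (Finset V) :=
  {G | IsFace Δ G ∧ Disjoint G F ∧ IsFace Δ (G ∪ F)}

/-- The link of `ρ` is a single cycle of length `n`, with vertices `c 0, c 1, …, c (n - 1)` in this
cyclic order. -/
def IsElementaryCycle (Δ : PreAbstractSimplicialComplex V) (ρ : Finset V) (n : ℕ)
    (c : ZMod n → V) : Prop :=
  3 ≤ n ∧ Function.Injective c ∧
    ∀ G : Finset V, G ∈ link Δ ρ ↔
      G = ∅ ∨ (∃ i, G = {c i}) ∨ (∃ i, G = {c i, c (i + 1)})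

/-- The link of every face of codimension two is a single cycle. -/
def NoCodimTwoSingularities (Δ : PreAbstractSimplicialComplex V) (D : ℕ) : Prop :=
  ∀ ρ, IsCodimTwo Δ D ρ → ∃ (n : ℕ) (c : ZMod n → V), IsElementaryCycle Δ ρ n c

/-- A fundamental cycle of `Δ`: a simplicial cycle of dimension `D - 1` with integer coefficients
that has coefficient `1` or `-1` on every facet. Chains are written as alternating functions of the
ordered simplices `(e 0, …, e (D - 1))`. The last condition says that the boundary vanishes: the
coefficient of the boundary at the ordered simplex obtained by deleting the entry number `k` from
`e` is, up to sign, the sum over all ways to fill in that entry. (For `D = 1` this is the cycle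
condition of reduced homology.) -/
structure IsFundamentalCycle [Fintype V] (Δ : PreAbstractSimplicialComplex V) (D : ℕ)
    (z : (Fin D → V) → ℤ) : Prop where
  alternating : ∀ (e : Fin D → V) (π : Equiv.Perm (Fin D)),
    z (e ∘ π) = (Equiv.Perm.sign π : ℤ) * z e
  facet : ∀ e : Fin D → V, Function.Injective e → IsFacet Δ (Finset.univ.image e) → |z e| = 1
  nonfacet : ∀ e : Fin D → V,
    ¬ (Function.Injective e ∧ IsFacet Δ (Finset.univ.image e)) → z e = 0
  boundary : ∀ (e : Fin D → V) (k : Fin D), ∑ a : V, z (Function.update e k a) = 0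

end Combinatorics

section Geometry

variable {V : Type*} {D : ℕ}

/-- `v` is a pre-embedding of `Δ`: the vectors of each face are linearly independent. -/
def IsPreEmbedding (Δ : PreAbstractSimplicialComplex V) (v : V → EuclideanSpace ℝ (Fin D)) :
    Prop :=
  ∀ F, IsFace Δ F → LinearIndependent ℝ (fun i : F => v i)

/-- The cone generated by the vectors `v i` with `i ∈ F`. -/
def cone (v : V → EuclideanSpace ℝ (Fin D)) (F : Finset V) :
    PointedCone ℝ (EuclideanSpace ℝ (Fin D)) :=
  PointedCone.hull ℝ (v '' (F : Set V))

/-- The linear span of the vectors `v i` with `i ∈ F`. -/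
def lin (v : V → EuclideanSpace ℝ (Fin D)) (F : Finset V) :
    Submodule ℝ (EuclideanSpace ℝ (Fin D)) :=
  Submodule.span ℝ (v '' (F : Set V))

/-- `y` is generic: it lies on none of the finitely many hyperplanes spanned by the ridges. -/
def IsGeneric (Δ : PreAbstractSimplicialComplex V) (v : V → EuclideanSpace ℝ (Fin D))
    (y : EuclideanSpace ℝ (Fin D)) : Prop :=
  ∀ τ, IsRidge Δ D τ → y ∉ lin v τ

/-- The facet cone of exactly one facet contains `y`. -/
def InExactlyOneFacetCone (Δ : PreAbstractSimplicialComplex V)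
    (v : V → EuclideanSpace ℝ (Fin D)) (y : EuclideanSpace ℝ (Fin D)) : Prop :=
  ∃! σ, IsFacet Δ σ ∧ y ∈ cone v σ

variable [DecidableEq V]

/-- The intersection cocircuit property: every ridge `τ` is contained in exactly two facets
`τ ∪ {a}` and `τ ∪ {b}`, and `v a`, `v b` lie strictly on opposite sides of the hyperplane spanned
by the vectors of `τ` (the kernel of `f`). -/
def HasICoP (Δ : PreAbstractSimplicialComplex V) (v : V → EuclideanSpace ℝ (Fin D)) : Prop :=
  ∀ τ, IsRidge Δ D τ → ∃ a b : V, a ≠ b ∧ a ∉ τ ∧ b ∉ τ ∧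
    (∀ σ, (IsFacet Δ σ ∧ τ ⊆ σ) ↔ (σ = insert a τ ∨ σ = insert b τ)) ∧
    ∃ f : EuclideanSpace ℝ (Fin D) →ₗ[ℝ] ℝ,
      (∀ i ∈ τ, f (v i) = 0) ∧ 0 < f (v a) ∧ f (v b) < 0

/-- The cones of the faces of `Δ` form a complete simplicial fan with face poset `Δ`: they are
simplicial, any two intersect in the cone of the common face, and they cover the space. -/
structure IsCompleteFan (Δ : PreAbstractSimplicialComplex V)
    (v : V → EuclideanSpace ℝ (Fin D)) : Prop where
  simplicial : IsPreEmbedding Δ v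
  inter : ∀ F G, IsFace Δ F → IsFace Δ G →
    (cone v F : Set (EuclideanSpace ℝ (Fin D))) ∩ cone v G = cone v (F ∩ G)
  complete : ∀ y, ∃ F, IsFace Δ F ∧ y ∈ cone v F

/-- The closed polygonal loop in `ℂ` through `w 0, w 1, …, w (n - 1), w 0`, parametrized by
`[0, n]`: the segment from `w i` to `w (i + 1)` is run through on `[i, i + 1]`. -/
noncomputable def polygon {n : ℕ} (w : ZMod n → ℂ) (t : ℝ) : ℂ :=
  (1 - Int.fract t : ℝ) * w (⌊t⌋ : ℤ) + (Int.fract t : ℝ) * w ((⌊t⌋ : ℤ) + 1)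

/-- The polygonal loop through the points `w i` avoids `0` and winds `m` times around it: a
continuous choice `θ` of its argument grows by `2 π m` along the loop. -/
def HasWindingNumber {n : ℕ} (w : ZMod n → ℂ) (m : ℤ) : Prop :=
  ∃ θ : ℝ → ℝ, Continuous θ ∧
    (∀ t ∈ Set.Icc (0 : ℝ) n, polygon w t ≠ 0 ∧
      polygon w t = (‖polygon w t‖ : ℂ) * Complex.exp ((θ t : ℂ) * Complex.I)) ∧
    θ n - θ 0 = 2 * Real.pi * m

/-- The elementary cycle `c` with center `ρ` is simple in `v`: in the contraction of `v` at `ρ`,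
whose ambient space is identified linearly with the plane, its winding number is `1` or `-1`. -/
def IsSimpleCycle (v : V → EuclideanSpace ℝ (Fin D)) (ρ : Finset V) {n : ℕ} (c : ZMod n → V) :
    Prop :=
  ∃ L : (EuclideanSpace ℝ (Fin D) ⧸ lin v ρ) ≃ₗ[ℝ] ℂ,
    HasWindingNumber (fun i => L ((lin v ρ).mkQ (v (c i)))) 1 ∨
    HasWindingNumber (fun i => L ((lin v ρ).mkQ (v (c i)))) (-1)

/-- All elementary cycles (with centers at the faces of codimension two) are simple. -/
def AllElementaryCyclesSimple (Δ : PreAbstractSimplicialComplex V)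
    (v : V → EuclideanSpace ℝ (Fin D)) : Prop :=
  ∀ ρ, IsCodimTwo Δ D ρ → ∀ (n : ℕ) (c : ZMod n → V), IsElementaryCycle Δ ρ n c →
    IsSimpleCycle v ρ c

end Geometry

section Map

variable {V : Type*} [Fintype V] {D : ℕ}

/-- The set of vertices with nonzero barycentric coordinate. -/
noncomputable def carrier (x : V → ℝ) : Finset V :=
  open Classical in Finset.univ.filter fun i => x i ≠ 0

/-- The topological realization of `Δ`, in barycentric coordinates, with the subspace topology. -/
def realization (Δ : PreAbstractSimplicialComplex V) : Set (V → ℝ) :=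
  {x | x ∈ stdSimplex ℝ V ∧ carrier x ∈ Δ}

/-- The map that sends each vertex `i` to `v i` and is linear on each face. -/
noncomputable def linearExtension (v : V → EuclideanSpace ℝ (Fin D)) (x : V → ℝ) :
    EuclideanSpace ℝ (Fin D) :=
  ∑ i, x i • v i

theorem linearExtension_ne_zero {Δ : PreAbstractSimplicialComplex V}
    {v : V → EuclideanSpace ℝ (Fin D)} (h : IsPreEmbedding Δ v) {x : V → ℝ}
    (hx : x ∈ realization Δ) : linearExtension v x ≠ 0 := by
  classical
  intro h0
  have hsum : ∑ i ∈ carrier x, x i • v i = 0 := by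
    rw [← h0, linearExtension]
    refine Finset.sum_subset (Finset.subset_univ _) fun i _ hi => ?_
    have : x i = 0 := by simpa [carrier] using hi
    simp [this]
  have hli := h _ (Or.inr hx.2)
  rw [← Finset.sum_coe_sort] at hsum
  have hz := Fintype.linearIndependent_iff.1 hli (fun i => x i) hsum
  have hx0 : ∀ i, x i = 0 := by
    intro i
    by_contra hi
    exact hi (hz ⟨i, by simp [carrier, hi]⟩)
  have h1 := hx.1.2
  simp [hx0] at h1

/-- The map from the realization of `Δ` to the unit sphere associated with a pre-embedding: the
linear extension, divided by its Euclidean norm. -/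
noncomputable def sphereMap {Δ : PreAbstractSimplicialComplex V}
    {v : V → EuclideanSpace ℝ (Fin D)} (h : IsPreEmbedding Δ v) (x : realization Δ) :
    Metric.sphere (0 : EuclideanSpace ℝ (Fin D)) 1 :=
  ⟨‖linearExtension v x‖⁻¹ • linearExtension v x, by
    have h0 : ‖linearExtension v (x : V → ℝ)‖ ≠ 0 :=
      norm_ne_zero_iff.2 (linearExtension_ne_zero h x.2)
    rw [mem_sphere_zero_iff_norm, norm_smul, norm_inv, norm_norm, inv_mul_cancel₀ h0]⟩

/-- `1` or `-1` according to whether the map preserves or reverses orientation on the facet `σ`,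
which is oriented by the fundamental cycle `z`: the product of the coefficient of `z` at an ordering
of `σ` and the orientation of the corresponding basis of `ℝ ^ D`. It does not depend on the
ordering. -/
noncomputable def facetSign (z : (Fin D → V) → ℤ) (v : V → EuclideanSpace ℝ (Fin D))
    (σ : Finset V) : ℤ :=
  if h : σ.card = D then
    z (fun k => ((σ.equivFinOfCardEq h).symm k : V)) *
      (SignType.sign
        (Matrix.of fun i k => v ((σ.equivFinOfCardEq h).symm k : V) i).det : ℤ)
  else 0

theorem facetSign_eq [DecidableEq V] {Δ : PreAbstractSimplicialComplex V} {z : (Fin D → V) → ℤ}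
    (hz : IsFundamentalCycle Δ D z) (v : V → EuclideanSpace ℝ (Fin D)) (e : Fin D → V)
    (he : Function.Injective e) :
    facetSign z v (Finset.univ.image e) =
      z e * (SignType.sign (Matrix.of fun i k => v (e k) i).det : ℤ) := by
  have h : (Finset.univ.image e).card = D := by
    rw [Finset.card_image_of_injective _ he, Finset.card_univ, Fintype.card_fin]
  rw [facetSign, dif_pos h]
  set e₀ : Fin D → V := fun k => (((Finset.univ.image e).equivFinOfCardEq h).symm k : V) with he₀
  have hinj : Function.Injective e₀ :=
    Subtype.val_injective.comp (((Finset.univ.image e).equivFinOfCardEq h).symm.injective)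
  have hex : ∀ k, ∃ j, e j = e₀ k := fun k => by
    obtain ⟨j, -, hj⟩ :=
      Finset.mem_image.1 (((Finset.univ.image e).equivFinOfCardEq h).symm k).2
    exact ⟨j, hj⟩
  choose p hp using hex
  have hpinj : Function.Injective p := fun a b hab => hinj (by rw [← hp, ← hp, hab])
  let π : Equiv.Perm (Fin D) := Equiv.ofBijective p (Finite.injective_iff_bijective.1 hpinj)
  have hπ : e₀ = e ∘ π := funext fun k => (hp k).symm
  have hdet : (Matrix.of fun i k => v (e₀ k) i).det =
      ((Equiv.Perm.sign π : ℤ) : ℝ) * (Matrix.of fun i k => v (e k) i).det := by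
    rw [← Matrix.det_permute']
    congr 1
    ext i k
    simp [hπ]
  rw [hdet, hπ, hz.alternating]
  rcases Int.units_eq_one_or (Equiv.Perm.sign π) with h1 | h1 <;>
    simp [h1, Left.sign_neg]

/-- The map associated with `v` has degree `d` with respect to the fundamental cycle `z`: every
generic point of the sphere has `d` preimages, counted with sign. (A preimage of a generic point is
an interior point of the facet `carrier x`.) -/
def HasDegree {Δ : PreAbstractSimplicialComplex V} {v : V → EuclideanSpace ℝ (Fin D)}
    (h : IsPreEmbedding Δ v) (z : (Fin D → V) → ℤ) (d : ℤ) : Prop :=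
  ∀ y : Metric.sphere (0 : EuclideanSpace ℝ (Fin D)) 1, IsGeneric Δ v y →
    ∑ᶠ x : {x : realization Δ // sphereMap h x = y}, facetSign z v (carrier (x : V → ℝ)) = d

/-- The map associated with `v` has degree `1` or `-1` with respect to a fundamental cycle of `Δ`
(which is unique up to sign if `Δ` is a strongly connected pseudo-manifold). -/
def HasDegreeOneOrNegOne [DecidableEq V] {Δ : PreAbstractSimplicialComplex V}
    {v : V → EuclideanSpace ℝ (Fin D)} (h : IsPreEmbedding Δ v) : Prop :=
  ∃ z, IsFundamentalCycle Δ D z ∧ (HasDegree h z 1 ∨ HasDegree h z (-1))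

end Map

end SimplicialFan

/-! The central quantity is the number of facet cones over a generic point. By the ICoP property, a
point that crosses a ridge leaves one of the two facets at the ridge and enters the other, so the
number does not change. Spans of faces of codimension two are too thin to separate an open convex
set, hence the number is constant. The same holds for any family of facets closed under crossing
those ridges that are met inside a given open convex set (`HasICoP.coverCount_eq`).

Several facts follow from this one. One vector covered once forces all generic vectors to be covered
once. The facets around a face `K` cover a neighbourhood of each point in the relative interior of
its cone, so the linear extension on the cone over the realization is open. Under unique covering, a
component of the dual graph already covers everything, so there is only one; the same argument near
a face of codimension two shows that its link is a single cycle. Openness also upgrades uniqueness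
at generic points to injectivity everywhere (`StarInjective.eq_of_comb_eq`), which gives the fan
property and, by compactness, the homeomorphism.

For the degree, ICoP says that the determinants of adjacent facets, ordered alike, have opposite
signs. Their signs therefore form a fundamental cycle, and for any fundamental cycle the facet signs
agree across each ridge. With strong connectivity no cancellation is possible: up to sign, the
degree is the number of facet cones over a generic point.

For elementary cycles, ICoP makes all turning angles of the contracted polygon have the same sense.
Winding number `1` or `-1` then means that consecutive half-open sectors are disjoint, that is, the
star of the codimension-two face is mapped injectively at generic points. If this holds at all such
faces, the linear extension is proper and a local homeomorphism away from the spans of the faces of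
codimension three, hence a covering there. Simple connectivity of that complement is not needed: the
covering is restricted to the points visible from a base point, an open star-shaped set that carries
a section. The section can be followed across ridges, so by strong connectivity it runs through
every facet, and there is only one sheet (`exists_inExactlyOneFacetCone_of_starInjective`). -/

namespace SimplicialFan

open Filter Topology

/-! ### Complements of finitely many subspaces -/

section Subspaces

variable {E : Type*} [NormedAddCommGroup E] [NormedSpace ℝ E]

/-- A point of the segment other than `y` gives `z` a nonzero weight, so if it lay in `Q`, one could
solve for `z` in terms of `Q` and `y`. -/
theorem notMem_of_mem_segment {Q : Submodule ℝ E} {y z q : E} (hy : y ∉ Q)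
    (hz : z ∉ Q ⊔ Submodule.span ℝ {y}) (hq : q ∈ segment ℝ y z) : q ∉ Q := by
  obtain ⟨a, b, -, -, hab, rfl⟩ := hq
  intro h
  rcases eq_or_ne b 0 with rfl | hb
  · obtain rfl : a = 1 := by linarith
    exact hy (by simpa using h)
  · refine hz ?_
    have : z = b⁻¹ • (a • y + b • z) + (-(b⁻¹ * a)) • y := by
      rw [smul_add, smul_smul, smul_smul, inv_mul_cancel₀ hb]
      module
    rw [this]
    exact Submodule.add_mem_sup (Q.smul_mem _ h)
      (Submodule.smul_mem _ _ (Submodule.mem_span_singleton_self y))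

variable [FiniteDimensional ℝ E]

/-- The complement of finitely many proper subspaces is dense. -/
theorem dense_compl_iUnion_submodule {𝒬 : Set (Submodule ℝ E)} (h𝒬 : 𝒬.Finite)
    (hne : ∀ Q ∈ 𝒬, Q ≠ ⊤) : Dense {y : E | ∀ Q ∈ 𝒬, y ∉ Q} := by
  have : {y : E | ∀ Q ∈ 𝒬, y ∉ Q} = ⋂ Q ∈ 𝒬, ((Q : Set E)ᶜ) := by ext; simp
  rw [this]
  have : CompleteSpace E := FiniteDimensional.complete ℝ E
  refine dense_biInter_of_isOpen (fun Q _ => ?_) h𝒬.countable fun Q hQ => ?_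
  · exact (Submodule.closed_of_finiteDimensional Q).isOpen_compl
  · rw [← interior_eq_empty_iff_dense_compl, ← Set.not_nonempty_iff_eq_empty]
    intro h
    have : (𝓝[{x : ℝ | IsUnit x}] (0 : ℝ)).NeBot := by
      have : {x : ℝ | IsUnit x} = {0}ᶜ := by ext; simp
      rw [this]
      infer_instance
    exact hne Q hQ (Submodule.eq_top_of_nonempty_interior' Q h)

theorem isOpen_compl_iUnion_submodule {𝒬 : Set (Submodule ℝ E)} (h𝒬 : 𝒬.Finite) :
    IsOpen {y : E | ∀ Q ∈ 𝒬, y ∉ Q} := by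
  have : {y : E | ∀ Q ∈ 𝒬, y ∉ Q} = ⋂ Q ∈ 𝒬, ((Q : Set E)ᶜ) := by ext; simp
  rw [this]
  exact h𝒬.isOpen_biInter fun Q _ => (Submodule.closed_of_finiteDimensional Q).isOpen_compl

theorem sup_span_singleton_ne_top {Q : Submodule ℝ E}
    (hQ : Module.finrank ℝ Q + 2 ≤ Module.finrank ℝ E) (y : E) :
    Q ⊔ Submodule.span ℝ {y} ≠ ⊤ := by
  intro h
  have h1 := Submodule.finrank_add_le_finrank_add_finrank Q (Submodule.span ℝ {y})
  have h2 : Module.finrank ℝ (Submodule.span ℝ {y}) ≤ 1 := by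
    simpa using finrank_span_le_card (R := ℝ) ({y} : Set E)
  rw [h, finrank_top] at h1
  omega

/-- An open convex set remains connected when finitely many subspaces of codimension at least two
are removed. -/
theorem isPreconnected_inter_compl_iUnion_submodule {𝒬 : Set (Submodule ℝ E)} (h𝒬 : 𝒬.Finite)
    (hdim : ∀ Q ∈ 𝒬, Module.finrank ℝ Q + 2 ≤ Module.finrank ℝ E) {U : Set E} (hU : IsOpen U)
    (hconv : Convex ℝ U) : IsPreconnected (U ∩ {y : E | ∀ Q ∈ 𝒬, y ∉ Q}) := by
  refine isPreconnected_of_forall_pair fun y hy y' hy' => ?_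
  -- Codimension at least two leaves room for a common `z` outside all the spans of a `Q` with `y`
  -- or with `y'`. The two segments to `z` then join `y` and `y'`.
  have hdense : Dense {z : E | ∀ Q ∈ (fun Q => Q ⊔ Submodule.span ℝ {y}) '' 𝒬 ∪
      (fun Q => Q ⊔ Submodule.span ℝ {y'}) '' 𝒬, z ∉ Q} := by
    refine dense_compl_iUnion_submodule ((h𝒬.image _).union (h𝒬.image _)) ?_
    rintro _ (⟨Q, hQ, rfl⟩ | ⟨Q, hQ, rfl⟩) <;> exact sup_span_singleton_ne_top (hdim Q hQ) _
  obtain ⟨z, hzU, hz⟩ := hdense.inter_open_nonempty U hU ⟨y, hy.1⟩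
  have key : ∀ x ∈ U ∩ {y : E | ∀ Q ∈ 𝒬, y ∉ Q}, (∀ Q ∈ 𝒬, z ∉ Q ⊔ Submodule.span ℝ {x}) →
      segment ℝ x z ⊆ U ∩ {y : E | ∀ Q ∈ 𝒬, y ∉ Q} := fun x hx hzx q hq =>
    ⟨hconv.segment_subset hx.1 hzU hq, fun Q hQ => notMem_of_mem_segment (hx.2 Q hQ) (hzx Q hQ) hq⟩
  refine ⟨segment ℝ y z ∪ segment ℝ y' z, Set.union_subset ?_ ?_, Or.inl (left_mem_segment _ _ _),
    Or.inr (left_mem_segment _ _ _), IsPreconnected.union z (right_mem_segment _ _ _)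
      (right_mem_segment _ _ _) (convex_segment _ _).isPreconnected
      (convex_segment _ _).isPreconnected⟩
  · exact key y hy fun Q hQ => hz _ (Or.inl ⟨Q, hQ, rfl⟩)
  · exact key y' hy' fun Q hQ => hz _ (Or.inr ⟨Q, hQ, rfl⟩)

end Subspaces

/-! ### Faces, ridges and facets of a pure complex -/

section Faces

variable {V : Type*} {Δ : PreAbstractSimplicialComplex V} {F G σ : Finset V} {D : ℕ}

theorem IsFace.subset (hF : IsFace Δ F) (h : G ⊆ F) : IsFace Δ G := by
  rcases G.eq_empty_or_nonempty with rfl | hG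
  · exact Or.inl rfl
  · rcases hF with rfl | hF
    · exact absurd (Finset.subset_empty.1 h) hG.ne_empty
    · exact Or.inr ((Δ.isRelLowerSet_faces hF).2 h hG)

theorem IsFace.exists_isFacet [Finite V] (hF : IsFace Δ F) : ∃ σ, IsFacet Δ σ ∧ F ⊆ σ := by
  obtain ⟨σ, h1, h2⟩ := Finite.exists_le_maximal (p := IsFace Δ) hF
  exact ⟨σ, h2, h1⟩

theorem IsFacet.isFace (hσ : IsFacet Δ σ) : IsFace Δ σ := hσ.prop

theorem IsFacet.eq_of_subset (hσ : IsFacet Δ σ) (hF : IsFace Δ F) (h : σ ⊆ F) : σ = F :=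
  Finset.Subset.antisymm h (hσ.2 hF h)

theorem IsFacet.isRidge_erase [DecidableEq V] (hσ : IsFacet Δ σ) (hpure : IsPure Δ D) {i : V}
    (hi : i ∈ σ) : IsRidge Δ D (σ.erase i) :=
  ⟨hσ.isFace.subset (Finset.erase_subset _ _), by
    rw [Finset.card_erase_add_one hi, hpure σ hσ]⟩

theorem IsFace.isFacet_of_card [Finite V] (hpure : IsPure Δ D) (hF : IsFace Δ F)
    (h : F.card = D) : IsFacet Δ F := by
  obtain ⟨σ, hσ, hFσ⟩ := hF.exists_isFacet
  rwa [Finset.eq_of_subset_of_card_le hFσ (by rw [h, hpure σ hσ])]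

theorem IsFace.card_le [Finite V] (hpure : IsPure Δ D) (hF : IsFace Δ F) : F.card ≤ D := by
  obtain ⟨σ, hσ, hFσ⟩ := hF.exists_isFacet
  exact hpure σ hσ ▸ Finset.card_le_card hFσ

end Faces

/-! ### Coordinates with respect to the basis of a facet -/

section Coordinates

variable {V : Type*} {D : ℕ} {v : V → EuclideanSpace ℝ (Fin D)} {F G σ : Finset V}
  {Δ : PreAbstractSimplicialComplex V} {x x' : V → ℝ} {y : EuclideanSpace ℝ (Fin D)} {i : V}

section Fintype

variable [Fintype V]

/-- The linear map that sends a vector of coefficients to the linear combination of the `v i`. -/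
noncomputable def comb (v : V → EuclideanSpace ℝ (Fin D)) :
    (V → ℝ) →ₗ[ℝ] EuclideanSpace ℝ (Fin D) :=
  Fintype.linearCombination ℝ v

theorem comb_eq_sum (hx : ∀ i ∉ F, x i = 0) : comb v x = ∑ i ∈ F, x i • v i := by
  rw [comb, Fintype.linearCombination_apply]
  refine (Finset.sum_subset (Finset.subset_univ _) fun i _ hi => ?_).symm
  rw [hx i hi, zero_smul]

theorem comb_single [DecidableEq V] (i : V) (c : ℝ) : comb v (Pi.single i c) = c • v i := by
  rw [comb, Fintype.linearCombination_apply_single]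

theorem continuous_comb : Continuous (comb v) :=
  LinearMap.continuous_of_finiteDimensional _

theorem IsPreEmbedding.eq_of_comb_eq (hv : IsPreEmbedding Δ v) (hF : IsFace Δ F)
    (hx : ∀ i ∉ F, x i = 0) (hx' : ∀ i ∉ F, x' i = 0) (h : comb v x = comb v x') : x = x' := by
  have h0 : ∑ i : F, (x i - x' i) • v i = 0 := by
    rw [Finset.sum_coe_sort F fun i => (x i - x' i) • v i]
    simp only [sub_smul, Finset.sum_sub_distrib]
    rw [← comb_eq_sum hx, ← comb_eq_sum hx', h, sub_self]
  have h1 := Fintype.linearIndependent_iff.1 (hv F hF) (fun i => x i - x' i) h0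
  funext i
  by_cases hi : i ∈ F
  · exact sub_eq_zero.1 (h1 ⟨i, hi⟩)
  · rw [hx i hi, hx' i hi]

/-- Coefficients are functions on all of `V` that vanish off `F`, so that coefficient vectors of
different faces can be compared in one space. -/
theorem mem_cone_iff :
    y ∈ cone v F ↔ ∃ x : V → ℝ, (∀ i, 0 ≤ x i) ∧ (∀ i ∉ F, x i = 0) ∧ comb v x = y := by
  classical
  rw [cone, PointedCone.hull, Submodule.mem_span_image_finset_iff_exists_fun']
  constructor
  · rintro ⟨c, rfl⟩
    have h0 : ∀ i ∉ F, (if i ∈ F then (c i : ℝ) else 0) = 0 := fun i hi => if_neg hi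
    refine ⟨fun i => if i ∈ F then (c i : ℝ) else 0, fun i => ?_, h0, ?_⟩
    · dsimp only
      split_ifs
      · exact (c i).2
      · exact le_rfl
    · rw [comb_eq_sum h0]
      refine Finset.sum_congr rfl fun i hi => ?_
      rw [if_pos hi]
      rfl
  · rintro ⟨x, h0, h1, rfl⟩
    exact ⟨fun i => ⟨x i, h0 i⟩, (comb_eq_sum h1).symm⟩

theorem mem_lin_iff : y ∈ lin v F ↔ ∃ x : V → ℝ, (∀ i ∉ F, x i = 0) ∧ comb v x = y := by
  classical
  rw [lin, Submodule.mem_span_image_finset_iff_exists_fun']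
  constructor
  · rintro ⟨c, rfl⟩
    have h0 : ∀ i ∉ F, (if i ∈ F then c i else 0) = 0 := fun i hi => if_neg hi
    refine ⟨fun i => if i ∈ F then c i else 0, h0, ?_⟩
    rw [comb_eq_sum h0]
    exact Finset.sum_congr rfl fun i hi => by rw [if_pos hi]
  · rintro ⟨x, h1, rfl⟩
    exact ⟨x, (comb_eq_sum h1).symm⟩

open Classical in
/-- The coordinates of a vector with respect to the basis of the `v i` with `i ∈ σ`. -/
noncomputable def coords (v : V → EuclideanSpace ℝ (Fin D)) (σ : Finset V) :
    EuclideanSpace ℝ (Fin D) →ₗ[ℝ] (V → ℝ) :=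
  -- The default `0` only makes the definition total; for a facet the map exists, because its `D`
  -- independent vectors form a basis.
  if h : ∃ κ : EuclideanSpace ℝ (Fin D) →ₗ[ℝ] (V → ℝ),
    (∀ y, comb v (κ y) = y) ∧ ∀ y, ∀ i ∉ σ, κ y i = 0 then h.choose else 0

theorem IsFacet.coords_spec (hpure : IsPure Δ D) (hv : IsPreEmbedding Δ v) (hσ : IsFacet Δ σ) :
    (∀ y, comb v (coords v σ y) = y) ∧ ∀ y, ∀ i ∉ σ, coords v σ y i = 0 := by
  classical
  have h : ∃ κ : EuclideanSpace ℝ (Fin D) →ₗ[ℝ] (V → ℝ),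
      (∀ y, comb v (κ y) = y) ∧ ∀ y, ∀ i ∉ σ, κ y i = 0 := by
    have hli := hv σ hσ.isFace
    have hcard : Fintype.card σ = Module.finrank ℝ (EuclideanSpace ℝ (Fin D)) := by
      rw [Fintype.card_coe, hpure σ hσ, finrank_euclideanSpace_fin]
    let b := Module.Basis.mk hli (hli.span_eq_top_of_card_eq_finrank' hcard).ge
    let κ : EuclideanSpace ℝ (Fin D) →ₗ[ℝ] (V → ℝ) :=
      LinearMap.pi fun i => if h : i ∈ σ then b.coord ⟨i, h⟩ else 0
    have hκ : ∀ y, ∀ i ∉ σ, κ y i = 0 := fun y i hi => by simp [κ, hi]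
    refine ⟨κ, fun y => ?_, hκ⟩
    rw [comb_eq_sum (hκ y), ← Finset.sum_coe_sort]
    conv_rhs => rw [← b.sum_repr y]
    refine Finset.sum_congr rfl fun i _ => ?_
    simp [κ, b]
  rw [coords, dif_pos h]
  exact h.choose_spec

theorem continuous_coords : Continuous (coords v σ) :=
  LinearMap.continuous_of_finiteDimensional _

theorem continuous_coords_apply (i : V) : Continuous fun y => coords v σ y i :=
  (continuous_apply i).comp continuous_coords

variable (hpure : IsPure Δ D) (hv : IsPreEmbedding Δ v)
include hpure hv

theorem IsFacet.comb_coords (hσ : IsFacet Δ σ) (y : EuclideanSpace ℝ (Fin D)) :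
    comb v (coords v σ y) = y :=
  (hσ.coords_spec hpure hv).1 y

theorem IsFacet.coords_eq_zero (hσ : IsFacet Δ σ) (y : EuclideanSpace ℝ (Fin D)) (hi : i ∉ σ) :
    coords v σ y i = 0 :=
  (hσ.coords_spec hpure hv).2 y i hi

theorem IsFacet.coords_comb (hσ : IsFacet Δ σ) (hx : ∀ i ∉ σ, x i = 0) :
    coords v σ (comb v x) = x :=
  hv.eq_of_comb_eq hσ.isFace (fun _ => hσ.coords_eq_zero hpure hv _) hx
    (hσ.comb_coords hpure hv _)

theorem IsFacet.mem_cone_iff_coords (hσ : IsFacet Δ σ) (hF : F ⊆ σ) :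
    y ∈ cone v F ↔ (∀ i, 0 ≤ coords v σ y i) ∧ ∀ i ∉ F, coords v σ y i = 0 := by
  rw [mem_cone_iff]
  constructor
  · rintro ⟨x, h0, h1, rfl⟩
    rw [hσ.coords_comb hpure hv fun i hi => h1 i fun h => hi (hF h)]
    exact ⟨h0, h1⟩
  · rintro ⟨h0, h1⟩
    exact ⟨_, h0, h1, hσ.comb_coords hpure hv y⟩

theorem IsFacet.mem_cone_iff_nonneg (hσ : IsFacet Δ σ) :
    y ∈ cone v σ ↔ ∀ i ∈ σ, 0 ≤ coords v σ y i := by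
  rw [hσ.mem_cone_iff_coords hpure hv subset_rfl]
  refine ⟨fun h i _ => h.1 i, fun h => ⟨fun i => ?_, fun i => hσ.coords_eq_zero hpure hv y⟩⟩
  by_cases hi : i ∈ σ
  · exact h i hi
  · exact (hσ.coords_eq_zero hpure hv y hi).ge

theorem IsFacet.mem_lin_iff_coords (hσ : IsFacet Δ σ) (hF : F ⊆ σ) :
    y ∈ lin v F ↔ ∀ i ∉ F, coords v σ y i = 0 := by
  rw [mem_lin_iff]
  constructor
  · rintro ⟨x, h1, rfl⟩
    rwa [hσ.coords_comb hpure hv fun i hi => h1 i fun h => hi (hF h)]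
  · exact fun h1 => ⟨_, h1, hσ.comb_coords hpure hv y⟩

theorem isClosed_cone (hF : IsFace Δ F) : IsClosed (cone v F : Set (EuclideanSpace ℝ (Fin D))) := by
  obtain ⟨σ, hσ, hFσ⟩ := hF.exists_isFacet
  have : (cone v F : Set (EuclideanSpace ℝ (Fin D))) =
      {y | (∀ i, 0 ≤ coords v σ y i) ∧ ∀ i, i ∉ F → coords v σ y i = 0} := by
    ext y
    exact hσ.mem_cone_iff_coords hpure hv hFσ
  rw [this]
  simp only [Set.ofPred_and, Set.ofPred_forall]
  refine (isClosed_iInter fun i => isClosed_le continuous_const (continuous_coords_apply i)).inter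
    (isClosed_iInter fun i => isClosed_iInter fun _ =>
      isClosed_eq (continuous_coords_apply i) continuous_const)

/-- A vanishing coordinate at `i` would put `y` in the hyperplane of the ridge `σ.erase i`. -/
theorem IsGeneric.coords_ne_zero [DecidableEq V] (hy : IsGeneric Δ v y) (hσ : IsFacet Δ σ)
    (hi : i ∈ σ) : coords v σ y i ≠ 0 := by
  intro h
  refine hy _ (hσ.isRidge_erase hpure hi) ?_
  rw [hσ.mem_lin_iff_coords hpure hv (Finset.erase_subset _ _)]
  intro j hj
  by_cases hji : j = i
  · rwa [hji]
  · exact hσ.coords_eq_zero hpure hv y fun hjσ => hj (Finset.mem_erase.2 ⟨hji, hjσ⟩)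

theorem IsGeneric.coords_pos [DecidableEq V] (hy : IsGeneric Δ v y) (hσ : IsFacet Δ σ)
    (hyσ : y ∈ cone v σ) (hi : i ∈ σ) : 0 < coords v σ y i :=
  lt_of_le_of_ne ((hσ.mem_cone_iff_nonneg hpure hv).1 hyσ i hi)
    (hy.coords_ne_zero hpure hv hσ hi).symm

end Fintype

theorem cone_mono (h : F ⊆ G) : cone v F ≤ cone v G :=
  Submodule.span_mono (Set.image_mono h)

theorem lin_mono (h : F ⊆ G) : lin v F ≤ lin v G :=
  Submodule.span_mono (Set.image_mono h)

theorem finrank_lin (hv : IsPreEmbedding Δ v) (hF : IsFace Δ F) :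
    Module.finrank ℝ (lin v F) = F.card := by
  have := finrank_span_eq_card (hv F hF)
  rw [Fintype.card_coe] at this
  rw [← this, lin, Set.image_eq_range]
  rfl

theorem lin_ne_top (hv : IsPreEmbedding Δ v) (hF : IsFace Δ F) (hcard : F.card < D) :
    lin v F ≠ ⊤ := by
  intro h
  have := finrank_lin hv hF
  rw [h, finrank_top, finrank_euclideanSpace_fin] at this
  omega

theorem dense_isGeneric [Finite V] (hv : IsPreEmbedding Δ v) : Dense {y | IsGeneric Δ v y} := by
  have h := dense_compl_iUnion_submodule (𝒬 := lin v '' {τ | IsRidge Δ D τ})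
    ((Set.toFinite _).image _) (by
      rintro _ ⟨τ, hτ, rfl⟩
      exact lin_ne_top hv hτ.1 (by have := hτ.2; omega))
  simpa [IsGeneric] using h

end Coordinates

end SimplicialFan

namespace SimplicialFan

open Filter Topology

/-! ### Crossing ridges: the number of cones over a generic point -/

section Crossing

variable {V : Type*} [Fintype V] {D : ℕ} {v : V → EuclideanSpace ℝ (Fin D)}
  {F G K σ τ : Finset V} {Δ : PreAbstractSimplicialComplex V} {x x' : V → ℝ}
  {p q y : EuclideanSpace ℝ (Fin D)} {i : V}

theorem mem_carrier : i ∈ carrier x ↔ x i ≠ 0 := by simp [carrier]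

theorem carrier_subset_iff : carrier x ⊆ F ↔ ∀ i ∉ F, x i = 0 := by
  refine forall_congr' fun i => ?_
  rw [mem_carrier, not_imp_comm]

/-- The relative interior of the cone of `F`: the combinations with positive coefficients. -/
def openCone (v : V → EuclideanSpace ℝ (Fin D)) (F : Finset V) :
    Set (EuclideanSpace ℝ (Fin D)) :=
  {p | ∃ x : V → ℝ, (∀ i ∈ F, 0 < x i) ∧ (∀ i ∉ F, x i = 0) ∧ comb v x = p}

theorem openCone_subset_cone : openCone v F ⊆ cone v F := by
  rintro p ⟨x, h0, h1, rfl⟩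
  refine mem_cone_iff.2 ⟨x, fun i => ?_, h1, rfl⟩
  by_cases hi : i ∈ F
  · exact (h0 i hi).le
  · exact (h1 i hi).ge

theorem comb_mem_openCone_carrier (hx : ∀ i, 0 ≤ x i) : comb v x ∈ openCone v (carrier x) :=
  ⟨x, fun i hi => lt_of_le_of_ne (hx i) (mem_carrier.1 hi).symm,
    fun i hi => by simpa [mem_carrier] using hi, rfl⟩

theorem sum_mem_openCone : ∑ i ∈ F, v i ∈ openCone v F := by
  classical
  have h : ∀ i ∉ F, (if i ∈ F then (1 : ℝ) else 0) = 0 := fun i hi => if_neg hi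
  refine ⟨fun i => if i ∈ F then 1 else 0, fun i hi => by simp [hi], h, ?_⟩
  rw [comb_eq_sum h]
  exact Finset.sum_congr rfl fun i hi => by rw [if_pos hi, one_smul]

/-- The number of facets in `S` whose cone contains `y`. -/
noncomputable def coverCount (v : V → EuclideanSpace ℝ (Fin D)) (S : Set (Finset V))
    (y : EuclideanSpace ℝ (Fin D)) : ℕ :=
  {σ | σ ∈ S ∧ y ∈ cone v σ}.ncard

theorem coverCount_pos {S : Set (Finset V)} (hσ : σ ∈ S) (hy : y ∈ cone v σ) :
    0 < coverCount v S y :=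
  (Set.ncard_pos (Set.toFinite _)).2 ⟨σ, hσ, hy⟩

theorem exists_of_coverCount_pos {S : Set (Finset V)} (h : 0 < coverCount v S y) :
    ∃ σ ∈ S, y ∈ cone v σ :=
  (Set.ncard_pos (Set.toFinite _)).1 h

/-- A functional that vanishes on the ridge sees only the coordinate at the remaining vertex. This
translates sides of the hyperplane into signs of coordinates. -/
theorem IsFacet.apply_eq [DecidableEq V] (hpure : IsPure Δ D) (hv : IsPreEmbedding Δ v)
    {a : V} (hσ : IsFacet Δ (insert a τ)) (ha : a ∉ τ)
    {f : EuclideanSpace ℝ (Fin D) →ₗ[ℝ] ℝ} (hf : ∀ i ∈ τ, f (v i) = 0)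
    (q : EuclideanSpace ℝ (Fin D)) : f q = coords v (insert a τ) q a * f (v a) := by
  conv_lhs => rw [← hσ.comb_coords hpure hv q,
    comb_eq_sum (fun i hi => hσ.coords_eq_zero hpure hv q hi)]
  rw [map_sum, Finset.sum_insert ha, map_smul, smul_eq_mul, Finset.sum_eq_zero, add_zero]
  intro i hi
  rw [map_smul, hf i hi, smul_zero]

section

variable (hpure : IsPure Δ D) (hv : IsPreEmbedding Δ v)
include hpure hv

theorem IsFacet.mem_openCone_iff (hσ : IsFacet Δ σ) (hF : F ⊆ σ) :
    y ∈ openCone v F ↔ (∀ i ∈ F, 0 < coords v σ y i) ∧ ∀ i ∉ F, coords v σ y i = 0 := by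
  constructor
  · rintro ⟨x, h0, h1, rfl⟩
    rw [hσ.coords_comb hpure hv fun i hi => h1 i fun h => hi (hF h)]
    exact ⟨h0, h1⟩
  · rintro ⟨h0, h1⟩
    exact ⟨_, h0, h1, hσ.comb_coords hpure hv y⟩

theorem IsFacet.mem_openCone_self_iff (hσ : IsFacet Δ σ) :
    y ∈ openCone v σ ↔ ∀ i ∈ σ, 0 < coords v σ y i := by
  rw [hσ.mem_openCone_iff hpure hv subset_rfl]
  exact ⟨fun h => h.1, fun h => ⟨h, fun i => hσ.coords_eq_zero hpure hv y⟩⟩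

theorem IsFacet.isOpen_openCone (hσ : IsFacet Δ σ) : IsOpen (openCone v σ) := by
  have : openCone v σ = ⋂ i ∈ σ, {y | 0 < coords v σ y i} := by
    ext y
    simpa using hσ.mem_openCone_self_iff hpure hv
  rw [this]
  exact isOpen_biInter_finset fun i _ => isOpen_lt continuous_const (continuous_coords_apply i)

theorem IsFacet.convex_openCone (hσ : IsFacet Δ σ) : Convex ℝ (openCone v σ) := by
  intro y hy z hz a b ha hb hab
  rw [hσ.mem_openCone_self_iff hpure hv] at *
  intro i hi
  have h1 := hy i hi
  have h2 := hz i hi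
  simp only [map_add, map_smul, Pi.add_apply, Pi.smul_apply, smul_eq_mul]
  rcases ha.eq_or_lt with rfl | ha
  · obtain rfl : b = 1 := by linarith
    simpa using h2
  · have := mul_pos ha h1
    have := mul_nonneg hb h2.le
    linarith

theorem IsFacet.openCone_carrier (hσ : IsFacet Δ σ) (hy : y ∈ cone v σ) :
    y ∈ openCone v (carrier (coords v σ y)) := by
  have h := comb_mem_openCone_carrier (v := v)
    ((hσ.mem_cone_iff_coords hpure hv subset_rfl).1 hy).1
  rwa [hσ.comb_coords hpure hv] at h

theorem IsFacet.carrier_coords_subset (hσ : IsFacet Δ σ) (y : EuclideanSpace ℝ (Fin D)) :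
    carrier (coords v σ y) ⊆ σ :=
  carrier_subset_iff.2 fun _ => hσ.coords_eq_zero hpure hv y

theorem IsFacet.carrier_coords_eq (hσ : IsFacet Δ σ) (hF : F ⊆ σ) (hy : y ∈ openCone v F) :
    carrier (coords v σ y) = F := by
  have h := (hσ.mem_openCone_iff hpure hv hF).1 hy
  ext i
  rw [mem_carrier]
  refine ⟨fun hi => ?_, fun hi => (h.1 i hi).ne'⟩
  by_contra hiF
  exact hi (h.2 i hiF)

theorem IsGeneric.mem_openCone (hy : IsGeneric Δ v y) (hσ : IsFacet Δ σ) (hyσ : y ∈ cone v σ) :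
    y ∈ openCone v σ := by
  classical
  exact (hσ.mem_openCone_self_iff hpure hv).2 fun i hi => hy.coords_pos hpure hv hσ hyσ hi

/-- Arbitrarily close to any point of the cone of a facet there are points of its interior outside
of a given nowhere dense set. -/
theorem IsFacet.exists_mem_openCone (hσ : IsFacet Δ σ) (hp : p ∈ cone v σ)
    {U A : Set (EuclideanSpace ℝ (Fin D))} (hU : U ∈ 𝓝 p) (hA : Dense A) :
    ∃ y ∈ U, y ∈ openCone v σ ∧ y ∈ A := by
  -- A small step towards the sum of the vectors of `σ` makes all coordinates positive; the open set
  -- reached in this way meets the dense set.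
  have h1 : Tendsto (fun t : ℝ => p + t • ∑ i ∈ σ, v i) (𝓝[>] 0) (𝓝 p) := by
    have : Continuous fun t : ℝ => p + t • ∑ i ∈ σ, v i := by fun_prop
    simpa using (this.tendsto 0).mono_left nhdsWithin_le_nhds
  obtain ⟨t, ht, ht0⟩ := ((h1.eventually (eventually_mem_nhds_iff.2 hU)).and
    self_mem_nhdsWithin).exists
  have hmem : p + t • ∑ i ∈ σ, v i ∈ openCone v σ := by
    rw [hσ.mem_openCone_self_iff hpure hv]
    intro i hi
    have h2 := ((hσ.mem_cone_iff_nonneg hpure hv).1 hp) i hi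
    have h3 := (hσ.mem_openCone_self_iff hpure hv).1 sum_mem_openCone i hi
    simp only [map_add, map_smul, Pi.add_apply, Pi.smul_apply, smul_eq_mul]
    have := mul_pos (Set.mem_Ioi.1 ht0) h3
    linarith
  obtain ⟨y, hy, hyA⟩ := hA.inter_open_nonempty (interior U ∩ openCone v σ)
    (isOpen_interior.inter (hσ.isOpen_openCone hpure hv)) ⟨_, mem_interior_iff_mem_nhds.2 ht, hmem⟩
  exact ⟨y, interior_subset hy.1, hy.2, hyA⟩

variable [DecidableEq V] (hI : HasICoP Δ v)
include hI

/-- Near `p` the coordinates along `τ` stay positive in both facets, so membership in either cone is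
decided by the sign of `f`. The two facets require opposite signs, and genericity excludes `0`. -/
theorem HasICoP.eventually_existsUnique_of_isRidge (hτ : IsRidge Δ D τ) (hp : p ∈ openCone v τ) :
    ∀ᶠ q in 𝓝 p, IsGeneric Δ v q → ∃! σ, IsFacet Δ σ ∧ τ ⊆ σ ∧ q ∈ cone v σ := by
  obtain ⟨a, b, hab, ha, hb, hfac, f, hf, hfa, hfb⟩ := hI τ hτ
  have hσa := ((hfac _).2 (Or.inl rfl)).1
  have hσb := ((hfac _).2 (Or.inr rfl)).1
  have hev : ∀ c, IsFacet Δ (insert c τ) →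
      ∀ᶠ q in 𝓝 p, ∀ i ∈ τ, 0 < coords v (insert c τ) q i := by
    intro c hc
    have h := ((hc.mem_openCone_iff hpure hv (Finset.subset_insert _ _)).1 hp).1
    exact (Finset.eventually_all _).2 fun i hi =>
      (continuous_coords_apply i).continuousAt.eventually (lt_mem_nhds (h i hi))
  filter_upwards [hev a hσa, hev b hσb] with q hqa hqb hq
  have hga := hσa.apply_eq hpure hv ha hf q
  have hgb := hσb.apply_eq hpure hv hb hf q
  have hne := hq.coords_ne_zero hpure hv hσa (Finset.mem_insert_self a τ)
  have hnb := hq.coords_ne_zero hpure hv hσb (Finset.mem_insert_self b τ)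
  have hiffa : q ∈ cone v (insert a τ) ↔ 0 < coords v (insert a τ) q a := by
    rw [hσa.mem_cone_iff_nonneg hpure hv, Finset.forall_mem_insert]
    exact ⟨fun h => lt_of_le_of_ne h.1 hne.symm, fun h => ⟨h.le, fun i hi => (hqa i hi).le⟩⟩
  have hiffb : q ∈ cone v (insert b τ) ↔ 0 < coords v (insert b τ) q b := by
    rw [hσb.mem_cone_iff_nonneg hpure hv, Finset.forall_mem_insert]
    exact ⟨fun h => lt_of_le_of_ne h.1 hnb.symm, fun h => ⟨h.le, fun i hi => (hqb i hi).le⟩⟩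
  rcases lt_trichotomy (f q) 0 with h | h | h
  · refine ⟨insert b τ, ⟨hσb, Finset.subset_insert _ _, hiffb.2 ?_⟩, ?_⟩
    · nlinarith
    · rintro σ ⟨h1, h2, h3⟩
      rcases (hfac σ).1 ⟨h1, h2⟩ with rfl | rfl
      · have := hiffa.1 h3
        nlinarith
      · rfl
  · rw [h] at hga
    exact absurd (mul_eq_zero.1 hga.symm) (by simp [hne, hfa.ne'])
  · refine ⟨insert a τ, ⟨hσa, Finset.subset_insert _ _, hiffa.2 ?_⟩, ?_⟩
    · nlinarith
    · rintro σ ⟨h1, h2, h3⟩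
      rcases (hfac σ).1 ⟨h1, h2⟩ with rfl | rfl
      · rfl
      · have := hiffb.1 h3
        nlinarith

theorem HasICoP.eventually_existsUnique (hF : IsFace Δ F) (hcard : D ≤ F.card + 1)
    (hp : p ∈ openCone v F) :
    ∀ᶠ q in 𝓝 p, IsGeneric Δ v q → ∃! σ, IsFacet Δ σ ∧ F ⊆ σ ∧ q ∈ cone v σ := by
  rcases hcard.eq_or_lt with h | h
  · exact hI.eventually_existsUnique_of_isRidge hpure hv ⟨hF, h.symm⟩ hp
  · have hFf : IsFacet Δ F := hF.isFacet_of_card hpure (by have := hF.card_le hpure; omega)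
    filter_upwards [(hFf.isOpen_openCone hpure hv).mem_nhds hp] with q hq _
    exact ⟨F, ⟨hFf, subset_rfl, openCone_subset_cone hq⟩,
      fun σ hσ => (hFf.eq_of_subset hσ.1.isFace hσ.2.1).symm⟩

/-- A facet cone that contains a point `q` near `p` also contains `p`, and `p` is in the relative
interior of exactly one face of that facet. As `p` avoids the codimension-two spans, this face is a
ridge or a facet, and over a generic `q` it accounts for exactly one facet. Several faces can occur,
since cones may still overlap. The resulting count depends on `p` alone. -/
theorem HasICoP.eventually_coverCount_eq {S : Set (Finset V)} (hS : ∀ σ ∈ S, IsFacet Δ σ)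
    (hp : ∀ ρ, IsCodimTwo Δ D ρ → p ∉ lin v ρ)
    (hcl : ∀ σ ∈ S, ∀ τ ⊆ σ, IsRidge Δ D τ → p ∈ openCone v τ →
      ∀ σ', IsFacet Δ σ' → τ ⊆ σ' → σ' ∈ S) :
    ∀ᶠ q in 𝓝 p, IsGeneric Δ v q →
      coverCount v S q = {F | p ∈ openCone v F ∧ ∃ σ ∈ S, F ⊆ σ}.ncard := by
  have hout : ∀ᶠ q in 𝓝 p, ∀ σ, IsFacet Δ σ → p ∉ cone v σ → q ∉ cone v σ := by
    refine eventually_all.2 fun σ => ?_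
    by_cases hσ : IsFacet Δ σ ∧ p ∉ cone v σ
    · filter_upwards [(isClosed_cone hpure hv hσ.1.isFace).isOpen_compl.mem_nhds hσ.2]
        with q hq _ _ using hq
    · exact Eventually.of_forall fun q h1 h2 => absurd ⟨h1, h2⟩ hσ
  -- A smaller face could be enlarged within `σ` to one of codimension two, whose span would contain
  -- `p`. The negated bound forces `D ≥ 2`, so the subtraction `D - 2` is not truncated.
  have hdim : ∀ σ F, IsFacet Δ σ → F ⊆ σ → p ∈ openCone v F → D ≤ F.card + 1 := by
    intro σ F hσ hF hpF
    by_contra hlt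
    obtain ⟨ρ, hFρ, hρσ, hρ⟩ := Finset.exists_subsuperset_card_eq hF
      (show F.card ≤ D - 2 by omega) (by rw [hpure σ hσ]; omega)
    refine hp ρ ⟨hσ.isFace.subset hρσ, by omega⟩ ?_
    obtain ⟨x, -, h1, rfl⟩ := hpF
    exact mem_lin_iff.2 ⟨x, fun i hi => h1 i fun h => hi (hFρ h), rfl⟩
  have huniq : ∀ᶠ q in 𝓝 p, ∀ F, (p ∈ openCone v F ∧ ∃ σ ∈ S, F ⊆ σ) → IsGeneric Δ v q →
      ∃! σ, IsFacet Δ σ ∧ F ⊆ σ ∧ q ∈ cone v σ := by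
    refine eventually_all.2 fun F => ?_
    by_cases h : p ∈ openCone v F ∧ ∃ σ ∈ S, F ⊆ σ
    · obtain ⟨σ, hσ, hF⟩ := h.2
      filter_upwards [hI.eventually_existsUnique hpure hv ((hS σ hσ).isFace.subset hF)
        (hdim σ F (hS σ hσ) hF h.1) h.1] with q hq _ hg using hq hg
    · exact Eventually.of_forall fun q h1 => absurd h1 h
  filter_upwards [hout, huniq] with q hq1 hq2 hq
  have hcar : ∀ σ ∈ S, q ∈ cone v σ → p ∈ openCone v (carrier (coords v σ p)) := by
    intro σ hσ hqσ
    refine (hS σ hσ).openCone_carrier hpure hv ?_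
    by_contra h
    exact hq1 σ (hS σ hσ) h hqσ
  -- The bijection sends a facet over `q` to the face of it whose relative interior contains `p`.
  refine Set.ncard_congr (fun σ _ => carrier (coords v σ p)) ?_ ?_ ?_
  · rintro σ ⟨hσ, hqσ⟩
    exact ⟨hcar σ hσ hqσ, σ, hσ, (hS σ hσ).carrier_coords_subset hpure hv p⟩
  · rintro σ σ' ⟨hσ, hqσ⟩ ⟨hσ', hqσ'⟩ heq
    have hs := (hS σ hσ).carrier_coords_subset hpure hv p
    have hs' := (hS σ' hσ').carrier_coords_subset hpure hv p
    refine (hq2 _ ⟨hcar σ hσ hqσ, σ, hσ, hs⟩ hq).unique ⟨hS σ hσ, hs, hqσ⟩ ⟨hS σ' hσ', ?_, hqσ'⟩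
    exact heq ▸ hs'
  · rintro F ⟨hpF, σ, hσ, hF⟩
    obtain ⟨σ', ⟨h1, h2, h3⟩, -⟩ := hq2 F ⟨hpF, σ, hσ, hF⟩ hq
    refine ⟨σ', ⟨?_, h3⟩, h1.carrier_coords_eq hpure hv h2 hpF⟩
    rcases (hdim σ F (hS σ hσ) hF hpF).eq_or_lt with h | h
    · exact hcl σ hσ F hF ⟨(hS σ hσ).isFace.subset hF, h.symm⟩ hpF σ' h1 h2
    · have hFf : IsFacet Δ F := ((hS σ hσ).isFace.subset hF).isFacet_of_card hpure (by
        have := ((hS σ hσ).isFace.subset hF).card_le hpure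
        omega)
      rwa [← hFf.eq_of_subset h1.isFace h2, hFf.eq_of_subset (hS σ hσ).isFace hF]

omit hpure hI [DecidableEq V] in
theorem isPreconnected_inter_compl_codimTwo {U : Set (EuclideanSpace ℝ (Fin D))} (hU : IsOpen U)
    (hconv : Convex ℝ U) :
    IsPreconnected (U ∩ {y | ∀ ρ, IsCodimTwo Δ D ρ → y ∉ lin v ρ}) := by
  have := isPreconnected_inter_compl_iUnion_submodule (𝒬 := lin v '' {ρ | IsCodimTwo Δ D ρ})
    ((Set.toFinite _).image _) (by
      rintro _ ⟨ρ, hρ, rfl⟩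
      rw [finrank_lin hv hρ.1, finrank_euclideanSpace_fin]
      exact hρ.2.le) hU hconv
  simpa using this

omit hI hv [DecidableEq V] in
theorem IsGeneric.notMem_lin (hy : IsGeneric Δ v y) (hF : IsFace Δ F) (hcard : F.card < D) :
    y ∉ lin v F := by
  obtain ⟨σ, hσ, hFσ⟩ := hF.exists_isFacet
  obtain ⟨τ, h1, h2, h3⟩ := Finset.exists_subsuperset_card_eq hFσ
    (show F.card ≤ D - 1 by omega) (by rw [hpure σ hσ]; omega)
  exact fun h => hy τ ⟨hσ.isFace.subset h2, by omega⟩ (lin_mono h1 h)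

/-- In an open convex set, the number of facets in `S` over a generic point does not depend on the
point if `S` is closed under crossing those ridges that are met. -/
theorem HasICoP.coverCount_eq {S : Set (Finset V)} (hS : ∀ σ ∈ S, IsFacet Δ σ)
    {U : Set (EuclideanSpace ℝ (Fin D))} (hU : IsOpen U) (hconv : Convex ℝ U)
    (hcl : ∀ σ ∈ S, ∀ τ ⊆ σ, IsRidge Δ D τ → (∃ p ∈ U, p ∈ openCone v τ) →
      ∀ σ', IsFacet Δ σ' → τ ⊆ σ' → σ' ∈ S)
    {y y' : EuclideanSpace ℝ (Fin D)} (hyU : y ∈ U) (hy : IsGeneric Δ v y) (hyU' : y' ∈ U)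
    (hy' : IsGeneric Δ v y') : coverCount v S y = coverCount v S y' := by
  set W := U ∩ {y | ∀ ρ, IsCodimTwo Δ D ρ → y ∉ lin v ρ} with hW
  have hWc : IsPreconnected W := isPreconnected_inter_compl_codimTwo hv hU hconv
  have hyW : y ∈ W := ⟨hyU, fun ρ hρ => hy.notMem_lin hpure hρ.1 (by have := hρ.2; omega)⟩
  have hyW' : y' ∈ W := ⟨hyU', fun ρ hρ => hy'.notMem_lin hpure hρ.1 (by have := hρ.2; omega)⟩
  have hloc : ∀ p ∈ W, ∃ m, ∀ᶠ q in 𝓝 p, IsGeneric Δ v q → coverCount v S q = m := fun p hp =>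
    ⟨_, hI.eventually_coverCount_eq hpure hv hS hp.2 fun σ hσ τ hτσ hτ hpτ =>
      hcl σ hσ τ hτσ hτ ⟨p, hp.1, hpτ⟩⟩
  -- The count is defined by generic points only, so "locally equal to the count at `y`" and
  -- "locally different from it" are used as the two open sets. They are disjoint because generic
  -- points are dense.
  set O₁ := {p | ∀ᶠ q in 𝓝 p, IsGeneric Δ v q → coverCount v S q = coverCount v S y}
  set O₂ := {p | ∀ᶠ q in 𝓝 p, IsGeneric Δ v q → coverCount v S q ≠ coverCount v S y}
  have h1 : IsOpen O₁ := isOpen_setOfPred_eventually_nhds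
  have h2 : IsOpen O₂ := isOpen_setOfPred_eventually_nhds
  have hsub : W ⊆ O₁ ∪ O₂ := by
    intro p hp
    obtain ⟨m, hm⟩ := hloc p hp
    by_cases h : m = coverCount v S y
    · exact Or.inl (hm.mono fun q hq hg => (hq hg).trans h)
    · exact Or.inr (hm.mono fun q hq hg => by rw [hq hg]; exact h)
  have hdisj : W ∩ (O₁ ∩ O₂) = ∅ := by
    refine Set.eq_empty_of_forall_notMem fun p hp => ?_
    obtain ⟨q, hg, hq⟩ := (dense_isGeneric hv).inter_nhds_nonempty (inter_mem hp.2.1 hp.2.2)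
    exact hq.2 hg (hq.1 hg)
  have hy1 : y ∈ O₁ := by
    rcases hsub hyW with h | h
    · exact h
    · exact absurd rfl (h.self_of_nhds hy)
  rcases isPreconnected_iff_subset_of_disjoint.1 hWc O₁ O₂ h1 h2 hsub hdisj with h | h
  · exact ((h hyW').self_of_nhds hy').symm
  · exact absurd rfl ((h hyW).self_of_nhds hy)

omit hI [DecidableEq V] in
/-- A small ball around a point in the relative interior of the cone of `K` meets only those faces
of the cones of the facets containing `K` that contain `K`. -/
theorem exists_ball_notMem_cone (hp : p ∈ openCone v K) :
    ∃ ε > 0, ∀ q ∈ Metric.ball p ε, ∀ F, (∃ σ, IsFacet Δ σ ∧ K ⊆ σ ∧ F ⊆ σ ∧ ¬ K ⊆ F) →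
      q ∉ cone v F := by
  refine Metric.eventually_nhds_iff_ball.1 (eventually_all.2 fun F => ?_)
  by_cases hF : ∃ σ, IsFacet Δ σ ∧ K ⊆ σ ∧ F ⊆ σ ∧ ¬ K ⊆ F
  · obtain ⟨σ, hσ, hKσ, hFσ, hKF⟩ := hF
    have hpF : p ∉ cone v F := by
      intro h
      refine hKF fun i hi => ?_
      by_contra hiF
      exact (((hσ.mem_openCone_iff hpure hv hKσ).1 hp).1 i hi).ne'
        (((hσ.mem_cone_iff_coords hpure hv hFσ).1 h).2 i hiF)
    filter_upwards [(isClosed_cone hpure hv (hσ.isFace.subset hFσ)).isOpen_compl.mem_nhds hpF]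
      with q hq _ using hq
  · exact Eventually.of_forall fun q h1 => absurd h1 hF

/-- The cones of the facets containing a face `K` cover a neighbourhood of each point in the
relative interior of the cone of `K`. -/
theorem HasICoP.eventually_exists_mem_cone (hK : IsFace Δ K)
    (hp : p ∈ openCone v K) : ∀ᶠ q in 𝓝 p, ∃ σ, IsFacet Δ σ ∧ K ⊆ σ ∧ q ∈ cone v σ := by
  obtain ⟨ε, hε, hball⟩ := exists_ball_notMem_cone hpure hv hp
  obtain ⟨σ₀, hσ₀, hKσ₀⟩ := hK.exists_isFacet
  have hpσ₀ : p ∈ cone v σ₀ := cone_mono hKσ₀ (openCone_subset_cone hp)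
  obtain ⟨y, hyU, hyσ, hy⟩ := hσ₀.exists_mem_openCone hpure hv hpσ₀ (Metric.ball_mem_nhds p hε)
    (dense_isGeneric hv)
  set S : Set (Finset V) := {σ | IsFacet Δ σ ∧ K ⊆ σ} with hS
  have hpos : 0 < coverCount v S y := coverCount_pos ⟨hσ₀, hKσ₀⟩ (openCone_subset_cone hyσ)
  have hcl : IsClosed (⋃ σ ∈ S, (cone v σ : Set (EuclideanSpace ℝ (Fin D)))) :=
    (Set.toFinite S).isClosed_biUnion fun σ hσ => isClosed_cone hpure hv hσ.1.isFace
  have hsub : Metric.ball p ε ⊆ ⋃ σ ∈ S, (cone v σ : Set (EuclideanSpace ℝ (Fin D))) := by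
    intro q hq
    by_contra hqn
    -- The uncovered part of the ball is open, so it would contain a generic point, where the count
    -- must nevertheless be positive.
    obtain ⟨z, ⟨hz1, hz2⟩, hz⟩ := (dense_isGeneric hv).inter_open_nonempty _
      (Metric.isOpen_ball.inter hcl.isOpen_compl) ⟨q, hq, hqn⟩
    have hz3 : 0 < coverCount v S z := by
      rwa [hI.coverCount_eq hpure hv (fun σ hσ => hσ.1) Metric.isOpen_ball (convex_ball p ε)
        ?_ hz1 hz hyU hy]
      -- A ridge met inside the ball contains `K`, hence so does the facet on its other side.
      rintro σ hσ τ hτσ hτ ⟨r, hr, hrτ⟩ σ' hσ' hτσ'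
      refine ⟨hσ', ?_⟩
      by_contra hKσ'
      refine hball r hr τ ⟨σ, hσ.1, hσ.2, hτσ, fun h => hKσ' (h.trans hτσ')⟩
        (openCone_subset_cone hrτ)
    obtain ⟨σ, hσ, hzσ⟩ := exists_of_coverCount_pos hz3
    exact hz2 (Set.mem_biUnion hσ hzσ)
  filter_upwards [Metric.ball_mem_nhds p hε] with q hq
  obtain ⟨σ, hσ, hqσ⟩ := Set.mem_iUnion₂.1 (hsub hq)
  exact ⟨σ, hσ.1, hσ.2, hqσ⟩

end

/-- The points of the cone over the realization of `Δ`, in barycentric coordinates. -/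
def coneComplex (Δ : PreAbstractSimplicialComplex V) : Set (V → ℝ) :=
  {x | (∀ i, 0 ≤ x i) ∧ IsFace Δ (carrier x)}

theorem mem_coneComplex_of_subset (hF : IsFace Δ F) (h0 : ∀ i, 0 ≤ x i)
    (h1 : ∀ i ∉ F, x i = 0) : x ∈ coneComplex Δ :=
  ⟨h0, hF.subset (carrier_subset_iff.2 h1)⟩

theorem isClosed_coneComplex : IsClosed (coneComplex Δ) := by
  have : coneComplex Δ =
      ⋃ F ∈ {F | IsFace Δ F}, {x | (∀ i, 0 ≤ x i) ∧ ∀ i, i ∉ F → x i = 0} := by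
    ext x
    simp only [Set.mem_iUnion]
    constructor
    · rintro ⟨h0, h1⟩
      exact ⟨carrier x, h1, h0, carrier_subset_iff.1 subset_rfl⟩
    · rintro ⟨F, hF, h0, h1⟩
      exact mem_coneComplex_of_subset hF h0 h1
  rw [this]
  refine (Set.toFinite _).isClosed_biUnion fun F _ => ?_
  simp only [Set.ofPred_and, Set.ofPred_forall]
  exact (isClosed_iInter fun i => isClosed_le continuous_const (continuous_apply i)).inter
    (isClosed_iInter fun i => isClosed_iInter fun _ =>
      isClosed_eq (continuous_apply i) continuous_const)

/-- Different facets containing `F` have cones without common generic vectors. -/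
def StarInjective (Δ : PreAbstractSimplicialComplex V) (v : V → EuclideanSpace ℝ (Fin D))
    (F : Finset V) : Prop :=
  ∀ σ σ', IsFacet Δ σ → IsFacet Δ σ' → F ⊆ σ → F ⊆ σ' → ∀ y, IsGeneric Δ v y →
    y ∈ cone v σ → y ∈ cone v σ' → σ = σ'

section

variable (hpure : IsPure Δ D) (hv : IsPreEmbedding Δ v)
include hpure hv

theorem IsFacet.coords_mem_coneComplex (hσ : IsFacet Δ σ) (hy : y ∈ cone v σ) :
    coords v σ y ∈ coneComplex Δ :=
  mem_coneComplex_of_subset hσ.isFace ((hσ.mem_cone_iff_coords hpure hv subset_rfl).1 hy).1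
    fun _ => hσ.coords_eq_zero hpure hv y

variable [DecidableEq V] (hI : HasICoP Δ v)
include hI

/-- This passes from generic points to all points. The facets around the carrier of `x` cover a
neighbourhood of the common image, so one of them shares a generic point with a facet through the
carrier of `x'`. By hypothesis the two facets coincide, and linear independence within it gives the
claim. -/
theorem StarInjective.eq_of_comb_eq (hF : StarInjective Δ v F)
    (hx : x ∈ coneComplex Δ) (hx' : x' ∈ coneComplex Δ) (hFx : F ⊆ carrier x)
    (hFx' : F ⊆ carrier x') (h : comb v x = comb v x') : x = x' := by
  have hcov := hI.eventually_exists_mem_cone hpure hv hx.2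
    (comb_mem_openCone_carrier (v := v) hx.1)
  obtain ⟨σ', hσ', hxσ'⟩ := hx'.2.exists_isFacet
  have hp : comb v x ∈ cone v σ' := by
    rw [h]
    exact cone_mono hxσ' (openCone_subset_cone (comb_mem_openCone_carrier hx'.1))
  obtain ⟨y, ⟨σ, hσ, hKσ, hyσ⟩, hyσ', hy⟩ :=
    hσ'.exists_mem_openCone hpure hv hp hcov (dense_isGeneric hv)
  obtain rfl := hF σ σ' hσ hσ' (hFx.trans hKσ) (hFx'.trans hxσ') y hy hyσ
    (openCone_subset_cone hyσ')
  exact hv.eq_of_comb_eq hσ.isFace (carrier_subset_iff.1 hKσ) (carrier_subset_iff.1 hxσ') h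

/-- The linear extension is an open map on the cone over the realization. -/
theorem HasICoP.eventually_exists_comb_eq (hx : x ∈ coneComplex Δ) {N : Set (V → ℝ)}
    (hN : N ∈ 𝓝 x) : ∀ᶠ q in 𝓝 (comb v x), ∃ x' ∈ coneComplex Δ, x' ∈ N ∧ comb v x' = q := by
  have hco : ∀ᶠ q in 𝓝 (comb v x), ∀ σ, IsFacet Δ σ ∧ carrier x ⊆ σ → coords v σ q ∈ N := by
    refine eventually_all.2 fun σ => ?_
    by_cases hσ : IsFacet Δ σ ∧ carrier x ⊆ σ
    · have h := (continuous_coords (v := v) (σ := σ)).tendsto (comb v x)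
      rw [hσ.1.coords_comb hpure hv (carrier_subset_iff.1 hσ.2)] at h
      exact (h.eventually_mem hN).mono fun q hq _ => hq
    · exact Eventually.of_forall fun q h => absurd h hσ
  filter_upwards [hco, hI.eventually_exists_mem_cone hpure hv hx.2
    (comb_mem_openCone_carrier (v := v) hx.1)] with q hq ⟨σ, hσ, hKσ, hqσ⟩
  exact ⟨coords v σ q, hσ.coords_mem_coneComplex hpure hv hqσ, hq σ ⟨hσ, hKσ⟩,
    hσ.comb_coords hpure hv q⟩

end

end Crossing

end SimplicialFan

namespace SimplicialFan

open Filter Topology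

/-! ### Unique covering, complete fans and homeomorphisms -/

section Equivalences

variable {V : Type*} [Fintype V] {D : ℕ} {v : V → EuclideanSpace ℝ (Fin D)}
  {F G K σ τ : Finset V} {Δ : PreAbstractSimplicialComplex V} {x x' : V → ℝ}
  {p q y : EuclideanSpace ℝ (Fin D)} {i : V}

theorem realization_eq_inter :
    realization Δ = stdSimplex ℝ V ∩ coneComplex Δ := by
  ext x
  refine ⟨fun h => ⟨h.1, h.1.1, Or.inr h.2⟩, fun h => ⟨h.1, h.2.2.resolve_left fun h0 => ?_⟩⟩
  have hx : ∀ i, x i = 0 := fun i => by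
    by_contra hi
    exact Finset.notMem_empty i (h0 ▸ mem_carrier.2 hi)
  have := h.1.2
  simp [hx] at this

theorem isCompact_realization : IsCompact (realization Δ) := by
  rw [realization_eq_inter]
  exact (isCompact_stdSimplex ℝ V).inter_right isClosed_coneComplex

theorem realization_subset_coneComplex : realization Δ ⊆ coneComplex Δ := by
  rw [realization_eq_inter]
  exact Set.inter_subset_right

theorem carrier_smul {s : ℝ} (hs : s ≠ 0) : carrier (s • x) = carrier x := by
  ext i
  simp [mem_carrier, hs]

theorem smul_mem_coneComplex {s : ℝ} (hs : 0 < s) (hx : x ∈ coneComplex Δ) :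
    s • x ∈ coneComplex Δ :=
  ⟨fun i => mul_nonneg hs.le (hx.1 i), by rw [carrier_smul hs.ne']; exact hx.2⟩

/-- Every nonzero point of the cone over the realization is a multiple of a point of the
realization. -/
theorem exists_eq_smul_of_mem_coneComplex (hx : x ∈ coneComplex Δ) (hx0 : x ≠ 0) :
    ∃ z ∈ realization Δ, ∃ s : ℝ, 0 < s ∧ x = s • z := by
  have hs : 0 < ∑ i, x i := by
    obtain ⟨i, hi⟩ := Function.ne_iff.1 hx0
    exact Finset.sum_pos' (fun i _ => hx.1 i)
      ⟨i, Finset.mem_univ _, lt_of_le_of_ne (hx.1 i) (Ne.symm hi)⟩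
  refine ⟨(∑ i, x i)⁻¹ • x, ?_, _, hs, by rw [smul_inv_smul₀ hs.ne']⟩
  rw [realization_eq_inter]
  have h := smul_mem_coneComplex (inv_pos.2 hs) hx
  refine ⟨⟨h.1, ?_⟩, h⟩
  simp only [Pi.smul_apply, smul_eq_mul]
  rw [← Finset.mul_sum, inv_mul_cancel₀ hs.ne']

theorem coe_sphereMap (hv : IsPreEmbedding Δ v) (z : realization Δ) :
    (sphereMap hv z : EuclideanSpace ℝ (Fin D)) = ‖comb v z‖⁻¹ • comb v z := rfl

theorem norm_inv_smul_smul {E : Type*} [NormedAddCommGroup E] [NormedSpace ℝ E] {s : ℝ}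
    (hs : 0 < s) (w : E) : ‖s • w‖⁻¹ • s • w = ‖w‖⁻¹ • w := by
  rw [norm_smul, Real.norm_of_nonneg hs.le, smul_smul, mul_inv]
  congr 1
  field_simp

/-- Replaces normalization by an unspecified positive scaling, so that sphere questions become
questions about `comb` on `coneComplex`. -/
theorem sphereMap_eq_iff (hv : IsPreEmbedding Δ v) (z : realization Δ)
    (y : Metric.sphere (0 : EuclideanSpace ℝ (Fin D)) 1) :
    sphereMap hv z = y ↔ ∃ s : ℝ, 0 < s ∧ comb v (s • (z : V → ℝ)) = y := by
  have h0 : comb v (z : V → ℝ) ≠ 0 := linearExtension_ne_zero hv z.2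
  rw [Subtype.ext_iff, coe_sphereMap]
  constructor
  · intro h
    exact ⟨_, inv_pos.2 (norm_pos_iff.2 h0), by rw [map_smul, h]⟩
  · rintro ⟨s, hs, h⟩
    rw [← norm_inv_smul_smul hs, ← map_smul, h, norm_eq_of_mem_sphere, inv_one, one_smul]

theorem continuous_sphereMap (hv : IsPreEmbedding Δ v) : Continuous (sphereMap hv) := by
  have h : Continuous fun z : realization Δ => comb v (z : V → ℝ) :=
    continuous_comb.comp continuous_subtype_val
  refine Continuous.subtype_mk ?_ _
  exact (h.norm.inv₀ fun z => norm_ne_zero_iff.2 (linearExtension_ne_zero hv z.2)).smul h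

section

variable (hpure : IsPure Δ D) (hv : IsPreEmbedding Δ v)

theorem IsCompleteFan.eq_of_comb_eq [DecidableEq V] (h : IsCompleteFan Δ v)
    (hx : x ∈ coneComplex Δ)
    (hx' : x' ∈ coneComplex Δ) (hxx' : comb v x = comb v x') : x = x' := by
  have hmem : comb v x ∈ (cone v (carrier x ∩ carrier x') : Set (EuclideanSpace ℝ (Fin D))) := by
    rw [← h.inter _ _ hx.2 hx'.2]
    exact ⟨openCone_subset_cone (comb_mem_openCone_carrier hx.1),
      hxx' ▸ openCone_subset_cone (comb_mem_openCone_carrier hx'.1)⟩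
  obtain ⟨w, -, h1, h2⟩ := mem_cone_iff.1 hmem
  have e1 : w = x := h.simplicial.eq_of_comb_eq hx.2
    (carrier_subset_iff.1 ((carrier_subset_iff.2 h1).trans Finset.inter_subset_left))
    (carrier_subset_iff.1 subset_rfl) h2
  have e2 : w = x' := h.simplicial.eq_of_comb_eq hx'.2
    (carrier_subset_iff.1 ((carrier_subset_iff.2 h1).trans Finset.inter_subset_right))
    (carrier_subset_iff.1 subset_rfl) (h2.trans hxx')
  rw [← e1, e2]

theorem IsCompleteFan.isHomeomorph_sphereMap [DecidableEq V] (h : IsCompleteFan Δ v) :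
    IsHomeomorph (sphereMap hv) := by
  have : CompactSpace (realization Δ) := isCompact_iff_compactSpace.1 isCompact_realization
  refine isHomeomorph_iff_continuous_bijective.2 ⟨continuous_sphereMap hv, ?_, ?_⟩
  · intro z z' hzz'
    obtain ⟨s, hs, h1⟩ := (sphereMap_eq_iff hv z _).1 rfl
    obtain ⟨s', hs', h2⟩ := (sphereMap_eq_iff hv z' _).1 rfl
    have h3 := h.eq_of_comb_eq
      (smul_mem_coneComplex hs (realization_subset_coneComplex z.2))
      (smul_mem_coneComplex hs' (realization_subset_coneComplex z'.2))
      (by rw [h1, h2, hzz'])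
    -- Barycentric coordinates sum to `1`, so each scaling factor is recovered as a coordinate sum.
    have h4 : s = s' := by
      have := congrArg (fun w : V → ℝ => ∑ i, w i) h3
      simp only [Pi.smul_apply, smul_eq_mul] at this
      rw [← Finset.mul_sum, ← Finset.mul_sum, z.2.1.2, z'.2.1.2] at this
      simpa using this
    subst h4
    exact Subtype.ext (smul_right_injective _ hs.ne' h3)
  · intro y
    obtain ⟨F, hF, hy⟩ := h.complete y
    obtain ⟨x, h0, h1, h2⟩ := mem_cone_iff.1 hy
    have hx0 : x ≠ 0 := by
      rintro rfl
      rw [map_zero] at h2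
      exact ne_zero_of_mem_unit_sphere y h2.symm
    obtain ⟨z, hz, s, hs, rfl⟩ :=
      exists_eq_smul_of_mem_coneComplex (mem_coneComplex_of_subset hF h0 h1) hx0
    exact ⟨⟨z, hz⟩, (sphereMap_eq_iff hv _ _).2 ⟨s, hs, h2⟩⟩

include hpure

/-- A generic vector in the cones of two facets would have, after normalization, preimages with two
different carriers. -/
theorem exists_inExactlyOneFacetCone_of_injective (h : Function.Injective (sphereMap hv)) :
    ∃ y, InExactlyOneFacetCone Δ v y := by
  obtain ⟨σ, hσ, -⟩ := IsFace.exists_isFacet (Δ := Δ) (F := ∅) (Or.inl rfl)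
  obtain ⟨y₀, -, hy₀σ, hy₀⟩ := hσ.exists_mem_openCone hpure hv (zero_mem _) univ_mem
    (dense_isGeneric hv)
  -- An empty facet is the only facet; it is treated apart, because afterwards the vector has to be
  -- nonzero.
  obtain rfl | hσe := σ.eq_empty_or_nonempty
  · refine ⟨y₀, ∅, ⟨hσ, openCone_subset_cone hy₀σ⟩, fun σ' hσ' => ?_⟩
    exact (hσ.eq_of_subset hσ'.1.isFace (Finset.empty_subset _)).symm
  have key : ∀ σ', IsFacet Δ σ' → y₀ ∈ openCone v σ' → ∃ z : realization Δ,
      carrier (z : V → ℝ) = σ' ∧ (sphereMap hv z : EuclideanSpace ℝ (Fin D)) = ‖y₀‖⁻¹ • y₀ := by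
    intro σ' hσ' hy
    have hx0 : coords v σ' y₀ ≠ 0 := by
      intro h0
      have h1 := hσ'.comb_coords hpure hv y₀
      have h2 := hσ.carrier_coords_eq hpure hv subset_rfl hy₀σ
      rw [h0, map_zero] at h1
      obtain ⟨i, hi⟩ := hσe
      rw [← h2, mem_carrier, ← h1, map_zero] at hi
      exact hi rfl
    obtain ⟨z, hz, s, hs, hzs⟩ := exists_eq_smul_of_mem_coneComplex
      (hσ'.coords_mem_coneComplex hpure hv (openCone_subset_cone hy)) hx0
    refine ⟨⟨z, hz⟩, ?_, ?_⟩
    · rw [← hσ'.carrier_coords_eq hpure hv subset_rfl hy, hzs, carrier_smul hs.ne']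
    · rw [coe_sphereMap, ← norm_inv_smul_smul hs, ← map_smul, ← hzs, hσ'.comb_coords hpure hv]
  refine ⟨y₀, σ, ⟨hσ, openCone_subset_cone hy₀σ⟩, fun σ' hσ' => ?_⟩
  obtain ⟨z, hz, h1⟩ := key σ hσ hy₀σ
  obtain ⟨z', hz', h2⟩ := key σ' hσ'.1 (IsGeneric.mem_openCone hpure hv hy₀ hσ'.1 hσ'.2)
  obtain rfl : z = z' := h (Subtype.ext (h1.trans h2.symm))
  rw [← hz', hz]

variable [DecidableEq V] (hI : HasICoP Δ v)
include hv

omit [Fintype V] hpure hv [DecidableEq V] in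
theorem inExactlyOneFacetCone_iff :
    InExactlyOneFacetCone Δ v y ↔ coverCount v {σ | IsFacet Δ σ} y = 1 := by
  rw [coverCount, Set.ncard_eq_one]
  constructor
  · rintro ⟨σ, h, h'⟩
    exact ⟨σ, Set.eq_singleton_iff_unique_mem.2 ⟨h, h'⟩⟩
  · rintro ⟨σ, h⟩
    obtain ⟨h1, h2⟩ := Set.eq_singleton_iff_unique_mem.1 h
    exact ⟨σ, h1, h2⟩

include hI

/-- The given vector need not be generic. The other facet cones are closed and miss it, so it can be
moved to a generic point inside `σ` that they still miss; from there the count is constant on the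
whole space. -/
theorem HasICoP.inExactlyOneFacetCone_of_exists
    (h : ∃ y, InExactlyOneFacetCone Δ v y) (hy : IsGeneric Δ v y) :
    InExactlyOneFacetCone Δ v y := by
  obtain ⟨y₀, σ, ⟨hσ, hyσ⟩, hu⟩ := h
  have hev : ∀ᶠ q in 𝓝 y₀, ∀ σ', IsFacet Δ σ' ∧ σ' ≠ σ → q ∉ cone v σ' := by
    refine eventually_all.2 fun σ' => ?_
    by_cases hσ' : IsFacet Δ σ' ∧ σ' ≠ σ
    · filter_upwards [(isClosed_cone hpure hv hσ'.1.isFace).isOpen_compl.mem_nhds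
        fun h => hσ'.2 (hu σ' ⟨hσ'.1, h⟩)] with q hq _ using hq
    · exact Eventually.of_forall fun q h1 => absurd h1 hσ'
  obtain ⟨y₁, h1, hy₁σ, hy₁⟩ := hσ.exists_mem_openCone hpure hv hyσ hev (dense_isGeneric hv)
  rw [inExactlyOneFacetCone_iff, hI.coverCount_eq hpure hv (S := {σ | IsFacet Δ σ}) (fun σ hσ => hσ) isOpen_univ
    convex_univ (fun _ _ _ _ _ _ σ' h _ => h) (Set.mem_univ _) hy (Set.mem_univ y₁) hy₁,
    ← inExactlyOneFacetCone_iff]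
  refine ⟨σ, ⟨hσ, openCone_subset_cone hy₁σ⟩, fun σ' hσ' => ?_⟩
  by_contra hne
  exact h1 σ' ⟨hσ'.1, hne⟩ hσ'.2

omit [Fintype V] hpure hv [DecidableEq V] hI in
theorem starInjective_of_unique (h : ∀ y, IsGeneric Δ v y → InExactlyOneFacetCone Δ v y)
    (F : Finset V) : StarInjective Δ v F := fun _ _ hσ hσ' _ _ y hy h1 h2 =>
  (h y hy).unique ⟨hσ, h1⟩ ⟨hσ', h2⟩

/-- Intersections follow from injectivity on the cone over the realization: both coefficient vectors
of a common point are equal, hence supported on `F ∩ G`. The cones cover because their finite union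
is closed and contains the dense set of generic points. -/
theorem HasICoP.isCompleteFan_of_unique
    (h : ∀ y, IsGeneric Δ v y → InExactlyOneFacetCone Δ v y) : IsCompleteFan Δ v := by
  refine ⟨hv, fun F G hF hG => ?_, fun y => ?_⟩
  · refine Set.Subset.antisymm ?_ fun y hy =>
      ⟨cone_mono Finset.inter_subset_left hy, cone_mono Finset.inter_subset_right hy⟩
    rintro y ⟨hyF, hyG⟩
    obtain ⟨x, h0, h1, rfl⟩ := mem_cone_iff.1 hyF
    obtain ⟨x', h0', h1', h2'⟩ := mem_cone_iff.1 hyG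
    obtain rfl := (starInjective_of_unique h ∅).eq_of_comb_eq hpure hv hI
      (mem_coneComplex_of_subset hG h0' h1') (mem_coneComplex_of_subset hF h0 h1)
      (Finset.empty_subset _) (Finset.empty_subset _) h2'
    refine mem_cone_iff.2 ⟨x', h0, fun i hi => ?_, rfl⟩
    by_cases hiF : i ∈ F
    · exact h1' i fun hiG => hi (Finset.mem_inter.2 ⟨hiF, hiG⟩)
    · exact h1 i hiF
  · have hcl : IsClosed (⋃ σ ∈ {σ | IsFacet Δ σ},
        (cone v σ : Set (EuclideanSpace ℝ (Fin D)))) :=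
      (Set.toFinite _).isClosed_biUnion fun σ hσ => isClosed_cone hpure hv (IsFacet.isFace hσ)
    have hy : y ∈ closure {y | IsGeneric Δ v y} := dense_isGeneric hv y
    have hsub : {y | IsGeneric Δ v y} ⊆ ⋃ σ ∈ {σ | IsFacet Δ σ},
        (cone v σ : Set (EuclideanSpace ℝ (Fin D))) := by
      intro z hz
      obtain ⟨σ, hσ, -⟩ := h z hz
      exact Set.mem_biUnion hσ.1 hσ.2
    obtain ⟨σ, hσ, hyσ⟩ := Set.mem_iUnion₂.1 (closure_minimal hsub hcl hy)
    exact ⟨σ, IsFacet.isFace hσ, hyσ⟩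

end

/-! ### Strong connectivity -/

section StrongConnectivity

variable [DecidableEq V]

-- Strong connectivity is used in this form: a property of facets that passes across ridges and
-- holds for one facet holds for all.
omit [Fintype V] in
theorem IsStronglyConnected.mem_of_mem (h : IsStronglyConnected Δ D)
    {S : Set (Finset V)} (hcl : ∀ σ ∈ S, ∀ τ ⊆ σ, IsRidge Δ D τ →
      ∀ σ', IsFacet Δ σ' → τ ⊆ σ' → σ' ∈ S) {σ σ' : Finset V} (hσ : IsFacet Δ σ) (hσS : σ ∈ S)
    (hσ' : IsFacet Δ σ') : σ' ∈ S := by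
  obtain ⟨w⟩ := h.preconnected ⟨σ, hσ⟩ ⟨σ', hσ'⟩
  suffices ∀ (s t : {σ : Finset V // IsFacet Δ σ}), (dualGraph Δ D).Walk s t →
      (s : Finset V) ∈ S → (t : Finset V) ∈ S from this _ _ w hσS
  intro s t w
  induction w with
  | nil => exact id
  | @cons s t _ hadj _ ih =>
    intro hs
    exact ih (hcl _ hs _ Finset.inter_subset_left
      ⟨s.2.isFace.subset Finset.inter_subset_left, hadj.2⟩ _ t.2 Finset.inter_subset_right)

/-- A component of the dual graph is closed under crossing ridges, so by itself it covers every
generic point. Over a point interior to the cone of `t` there is only `t`, which therefore belongs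
to the component. -/
theorem HasICoP.isStronglyConnected_of_unique (hpure : IsPure Δ D) (hv : IsPreEmbedding Δ v)
    (hI : HasICoP Δ v) (h : ∀ y, IsGeneric Δ v y → InExactlyOneFacetCone Δ v y) :
    IsStronglyConnected Δ D := by
  obtain ⟨σ₀, hσ₀, -⟩ := IsFace.exists_isFacet (Δ := Δ) (F := ∅) (Or.inl rfl)
  have : Nonempty {σ : Finset V // IsFacet Δ σ} := ⟨⟨σ₀, hσ₀⟩⟩
  refine SimpleGraph.Connected.mk fun s t => ?_
  set S : Set (Finset V) := {σ | ∃ hσ : IsFacet Δ σ, (dualGraph Δ D).Reachable s ⟨σ, hσ⟩}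
  suffices (t : Finset V) ∈ S from this.2
  have hsS : (s : Finset V) ∈ S := ⟨s.2, SimpleGraph.Reachable.refl _⟩
  obtain ⟨y, -, hyt, hy⟩ := t.2.exists_mem_openCone hpure hv (zero_mem _) univ_mem
    (dense_isGeneric hv)
  obtain ⟨y', -, hys, hy'⟩ := s.2.exists_mem_openCone hpure hv (zero_mem _) univ_mem
    (dense_isGeneric hv)
  have hpos : 0 < coverCount v S y := by
    rw [hI.coverCount_eq hpure hv (S := S) (fun σ hσ => hσ.1) isOpen_univ convex_univ ?_
      (Set.mem_univ _) hy (Set.mem_univ y') hy']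
    · exact coverCount_pos hsS (openCone_subset_cone hys)
    · rintro σ ⟨hσ, hr⟩ τ hτσ hτ - σ' hσ' hτσ'
      refine ⟨hσ', ?_⟩
      by_cases hne : σ = σ'
      · subst hne
        exact hr
      · refine hr.trans (SimpleGraph.Adj.reachable ⟨fun h => hne (congrArg Subtype.val h), ?_⟩)
        have h1 : τ.card ≤ (σ ∩ σ').card := Finset.card_le_card (Finset.subset_inter hτσ hτσ')
        have h2 : (σ ∩ σ').card < σ.card := Finset.card_lt_card
          ⟨Finset.inter_subset_left, fun hsub => hne
            (hσ.eq_of_subset hσ'.isFace (hsub.trans Finset.inter_subset_right))⟩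
        have h3 := hτ.2
        rw [hpure σ hσ] at h2
        change (σ ∩ σ').card + 1 = D
        omega
  obtain ⟨σ, hσ, hyσ⟩ := exists_of_coverCount_pos hpos
  rwa [(h y hy).unique ⟨t.2, openCone_subset_cone hyt⟩ ⟨hσ.1, hyσ⟩]

end StrongConnectivity

end Equivalences

end SimplicialFan

namespace SimplicialFan

open Filter Topology

/-! ### Orientations and the degree -/

section Degree

variable {V : Type*} [Fintype V] {D : ℕ} {v : V → EuclideanSpace ℝ (Fin D)}
  {F G K σ τ : Finset V} {Δ : PreAbstractSimplicialComplex V} {x x' : V → ℝ}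
  {p q y : EuclideanSpace ℝ (Fin D)} {i : V}

/-- Preimages of a generic `y` correspond to the facets whose cones contain `y`: the carrier of a
preimage is such a facet, and the preimage is the rescaled coordinate vector of `y` in it. -/
theorem finsum_facetSign_eq (hpure : IsPure Δ D) (hv : IsPreEmbedding Δ v) (z : (Fin D → V) → ℤ)
    (y : Metric.sphere (0 : EuclideanSpace ℝ (Fin D)) 1) (hy : IsGeneric Δ v y) :
    ∑ᶠ x : {x : realization Δ // sphereMap hv x = y}, facetSign z v (carrier (x : V → ℝ)) =
      ∑ᶠ σ : {σ : Finset V // IsFacet Δ σ ∧ (y : EuclideanSpace ℝ (Fin D)) ∈ cone v σ},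
        facetSign z v σ := by
  have hmem : ∀ x : {x : realization Δ // sphereMap hv x = y}, ∃ s : ℝ, 0 < s ∧
      IsFacet Δ (carrier (x : V → ℝ)) ∧
      (y : EuclideanSpace ℝ (Fin D)) ∈ cone v (carrier (x : V → ℝ)) ∧
      coords v (carrier (x : V → ℝ)) y = s • (x : V → ℝ) := by
    rintro ⟨x, hx⟩
    obtain ⟨s, hs, h⟩ := (sphereMap_eq_iff hv x y).1 hx
    have hxc := realization_subset_coneComplex x.2
    obtain ⟨σ, hσ, hxσ⟩ := hxc.2.exists_isFacet
    have hyx : (y : EuclideanSpace ℝ (Fin D)) ∈ openCone v (carrier (x : V → ℝ)) := by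
      rw [← h, ← carrier_smul (x := (x : V → ℝ)) hs.ne']
      exact comb_mem_openCone_carrier (smul_mem_coneComplex hs hxc).1
    have hyσ := hy.mem_openCone hpure hv hσ (cone_mono hxσ (openCone_subset_cone hyx))
    have hσx : σ = carrier (x : V → ℝ) := by
      rw [← hσ.carrier_coords_eq hpure hv subset_rfl hyσ, hσ.carrier_coords_eq hpure hv hxσ hyx]
    rw [hσx] at hσ
    refine ⟨s, hs, hσ, openCone_subset_cone hyx, ?_⟩
    rw [← h]
    exact hσ.coords_comb hpure hv fun i hi => by
      have : (x : V → ℝ) i = 0 := by simpa [mem_carrier] using hi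
      simp [this]
  let f : {x : realization Δ // sphereMap hv x = y} →
      {σ : Finset V // IsFacet Δ σ ∧ (y : EuclideanSpace ℝ (Fin D)) ∈ cone v σ} := fun x =>
    ⟨carrier (x : V → ℝ), (hmem x).choose_spec.2.1, (hmem x).choose_spec.2.2.1⟩
  have hf : Function.Bijective f := by
    constructor
    · intro x x' hxx'
      have hc : carrier (x : V → ℝ) = carrier (x' : V → ℝ) := congrArg Subtype.val hxx'
      obtain ⟨s, hs, -, -, h1⟩ := hmem x
      obtain ⟨s', hs', -, -, h2⟩ := hmem x'
      rw [hc, h2] at h1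
      have h4 : s' = s := by
        have := congrArg (fun w : V → ℝ => ∑ i, w i) h1
        simp only [Pi.smul_apply, smul_eq_mul] at this
        rw [← Finset.mul_sum, ← Finset.mul_sum, x.1.2.1.2, x'.1.2.1.2] at this
        simpa using this
      subst h4
      exact Subtype.ext (Subtype.ext (smul_right_injective _ hs.ne' h1.symm))
    · rintro ⟨σ, hσ, hyσ⟩
      have h0 : coords v σ y ≠ 0 := by
        intro h
        have := hσ.comb_coords hpure hv y
        rw [h, map_zero] at this
        exact ne_zero_of_mem_unit_sphere y this.symm
      obtain ⟨z, hz, s, hs, hzs⟩ :=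
        exists_eq_smul_of_mem_coneComplex (hσ.coords_mem_coneComplex hpure hv hyσ) h0
      refine ⟨⟨⟨z, hz⟩, (sphereMap_eq_iff hv _ _).2 ⟨s, hs, ?_⟩⟩, Subtype.ext ?_⟩
      · rw [← hσ.comb_coords hpure hv y, hzs]
      · change carrier z = σ
        rw [← hσ.carrier_coords_eq hpure hv subset_rfl (hy.mem_openCone hpure hv hσ hyσ), hzs,
          carrier_smul hs.ne']
  exact finsum_comp_equiv (Equiv.ofBijective f hf) (f := fun σ => facetSign z v σ.1)

variable [DecidableEq V]

omit [Fintype V] in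
theorem image_update (e : Fin D → V) (k : Fin D) (c : V) :
    Finset.univ.image (Function.update e k c) = insert c ((Finset.univ.erase k).image e) := by
  rw [← Finset.insert_erase (Finset.mem_univ k), Finset.image_insert, Function.update_self]
  congr 1
  rw [Finset.erase_insert_eq_erase, Finset.erase_idem]
  exact Finset.image_congr fun j hj =>
    Function.update_of_ne (Finset.ne_of_mem_erase (Finset.mem_coe.1 hj)) _ _

omit [Fintype V] in
theorem IsFacet.injective_of_image (hpure : IsPure Δ D) {e : Fin D → V}
    (h : IsFacet Δ (Finset.univ.image e)) : Function.Injective e := by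
  have h1 : (Finset.univ.image e).card = (Finset.univ : Finset (Fin D)).card := by
    rw [hpure _ h, Finset.card_univ, Fintype.card_fin]
  exact fun a b hab => Finset.card_image_iff.1 h1 (Finset.mem_coe.2 (Finset.mem_univ _))
    (Finset.mem_coe.2 (Finset.mem_univ _)) hab

/-- The determinant of the vectors of an ordered simplex. -/
noncomputable def simplexDet (v : V → EuclideanSpace ℝ (Fin D)) (e : Fin D → V) : ℝ :=
  (Matrix.of fun i k => v (e k) i).det

omit [Fintype V] [DecidableEq V] in
theorem simplexDet_comp_perm (e : Fin D → V) (π : Equiv.Perm (Fin D)) :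
    simplexDet v (e ∘ π) = ((Equiv.Perm.sign π : ℤ) : ℝ) * simplexDet v e := by
  rw [simplexDet, simplexDet, ← Matrix.det_permute']
  rfl

omit [Fintype V] [DecidableEq V] in
/-- The determinant as a linear function of one of the vectors. -/
theorem exists_linearMap_simplexDet_update (v : V → EuclideanSpace ℝ (Fin D)) (e : Fin D → V)
    (k : Fin D) : ∃ g : EuclideanSpace ℝ (Fin D) →ₗ[ℝ] ℝ,
      ∀ c, g (v c) = simplexDet v (Function.update e k c) := by
  let M : Matrix (Fin D) (Fin D) ℝ := Matrix.of fun i k => v (e k) i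
  refine ⟨(Matrix.detRowAlternating.toMultilinearMap.toLinearMap M.transpose k).comp
    (WithLp.linearEquiv 2 ℝ (Fin D → ℝ)).toLinearMap, fun c => ?_⟩
  rw [simplexDet, ← Matrix.det_transpose]
  change Matrix.det _ = _
  congr 1
  ext j i
  by_cases hj : j = k
  · subst hj
    rw [Matrix.transpose_apply, Matrix.of_apply, Function.update_self]
    exact congrFun (Function.update_self j _ _) i
  · rw [Matrix.transpose_apply, Matrix.of_apply, Function.update_of_ne hj]
    exact congrFun (Function.update_of_ne hj _ _) i

omit [Fintype V] in
theorem IsPreEmbedding.simplexDet_ne_zero (hv : IsPreEmbedding Δ v) {e : Fin D → V}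
    (he : Function.Injective e) (hf : IsFace Δ (Finset.univ.image e)) : simplexDet v e ≠ 0 := by
  have h1 : LinearIndependent ℝ fun k => v (e k) :=
    (hv _ hf).comp (fun k => ⟨e k, Finset.mem_image_of_mem e (Finset.mem_univ k)⟩)
      fun a b hab => he (congrArg Subtype.val hab)
  have h2 : LinearIndependent ℝ (Matrix.of fun i k => v (e k) i).col :=
    h1.map' (WithLp.linearEquiv 2 ℝ (Fin D → ℝ)).toLinearMap (LinearEquiv.ker _)
  rw [simplexDet]
  exact ((Matrix.isUnit_iff_isUnit_det _).1
    (Matrix.linearIndependent_cols_iff_isUnit.1 h2)).ne_zero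

/-- Crossing a ridge changes the sign of the determinant. -/
theorem sign_simplexDet_update (hpure : IsPure Δ D) (hv : IsPreEmbedding Δ v) {a b : V}
    {e : Fin D → V} {k : Fin D} (hτ : (Finset.univ.erase k).image e = τ)
    (ha : a ∉ τ) (hσa : IsFacet Δ (insert a τ))
    {f : EuclideanSpace ℝ (Fin D) →ₗ[ℝ] ℝ} (hf : ∀ i ∈ τ, f (v i) = 0) (hfa : 0 < f (v a))
    (hfb : f (v b) < 0) :
    (SignType.sign (simplexDet v (Function.update e k b)) : ℤ) =
      -SignType.sign (simplexDet v (Function.update e k a)) := by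
  obtain ⟨g, hg⟩ := exists_linearMap_simplexDet_update v e k
  have hgτ : ∀ i ∈ τ, g (v i) = 0 := by
    intro i hi
    rw [← hτ] at hi
    obtain ⟨j, hj, rfl⟩ := Finset.mem_image.1 hi
    rw [hg, simplexDet]
    refine Matrix.det_zero_of_column_eq (Finset.ne_of_mem_erase hj) fun r => ?_
    simp [Finset.ne_of_mem_erase hj]
  have h1 := hσa.apply_eq hpure hv ha hf (v b)
  have h2 := hσa.apply_eq hpure hv ha hgτ (v b)
  have hc : coords v (insert a τ) (v b) a < 0 := by
    by_contra hc
    push Not at hc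
    have := mul_nonneg hc hfa.le
    linarith
  rw [← hg, ← hg, h2, sign_mul, sign_neg hc]
  simp

/-- Only the two facets at the ridge contribute to the boundary coefficient. -/
theorem sum_update_eq (hpure : IsPure Δ D) {z : (Fin D → V) → ℤ}
    (hz : ∀ e : Fin D → V, ¬ (Function.Injective e ∧ IsFacet Δ (Finset.univ.image e)) → z e = 0)
    {a b : V} (hab : a ≠ b) {e : Fin D → V} {k : Fin D}
    (hτ : (Finset.univ.erase k).image e = τ) (hτr : IsRidge Δ D τ)
    (hfac : ∀ σ, (IsFacet Δ σ ∧ τ ⊆ σ) ↔ (σ = insert a τ ∨ σ = insert b τ)) :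
    ∑ c, z (Function.update e k c) =
      z (Function.update e k a) + z (Function.update e k b) := by
  refine Fintype.sum_eq_add a b hab fun c hc => hz _ fun h => ?_
  have h1 := h.2
  rw [image_update, hτ] at h1
  have hcτ : c ∉ τ := fun hcτ => by
    rw [Finset.insert_eq_of_mem hcτ] at h1
    have := hpure _ h1
    have := hτr.2
    omega
  rcases (hfac _).1 ⟨h1, Finset.subset_insert _ _⟩ with h2 | h2
  · have := h2 ▸ Finset.mem_insert_self c τ
    exact (Finset.mem_insert.1 this).elim hc.1 hcτ
  · have := h2 ▸ Finset.mem_insert_self c τ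
    exact (Finset.mem_insert.1 this).elim hc.2 hcτ

open Classical in
/-- The orientation of the facets by the signs of their determinants. -/
noncomputable def signCycle (Δ : PreAbstractSimplicialComplex V)
    (v : V → EuclideanSpace ℝ (Fin D)) (e : Fin D → V) : ℤ :=
  if Function.Injective e ∧ IsFacet Δ (Finset.univ.image e) then SignType.sign (simplexDet v e)
  else 0

theorem abs_sign_of_ne_zero {r : ℝ} (hr : r ≠ 0) : |(SignType.sign r : ℤ)| = 1 := by
  rcases hr.lt_or_gt with h | h <;> simp [h]

/-- ICoP yields orientability: when the two facets at a ridge are ordered alike, their determinants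
have opposite signs and cancel in the boundary. -/
theorem HasICoP.isFundamentalCycle_signCycle (hpure : IsPure Δ D) (hv : IsPreEmbedding Δ v)
    (hI : HasICoP Δ v) : IsFundamentalCycle Δ D (signCycle Δ v) where
  alternating e π := by
    have h1 : Finset.univ.image (e ∘ π) = Finset.univ.image e := by
      rw [← Finset.image_image, Finset.image_univ_equiv]
    have h2 : (Function.Injective (e ∘ π) ∧ IsFacet Δ (Finset.univ.image (e ∘ π))) ↔
        (Function.Injective e ∧ IsFacet Δ (Finset.univ.image e)) := by
      rw [h1, π.injective_comp]
    by_cases h : Function.Injective e ∧ IsFacet Δ (Finset.univ.image e)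
    · rw [signCycle, signCycle, if_pos h, if_pos (h2.2 h), simplexDet_comp_perm]
      rcases Int.units_eq_one_or (Equiv.Perm.sign π) with h | h <;> simp [h, Left.sign_neg]
    · rw [signCycle, signCycle, if_neg h, if_neg fun h' => h (h2.1 h'), mul_zero]
  facet e he hf := by
    rw [signCycle, if_pos ⟨he, hf⟩, abs_sign_of_ne_zero (hv.simplexDet_ne_zero he hf.isFace)]
  nonfacet e he := if_neg he
  boundary e k := by
    by_cases H : ∃ c, IsFacet Δ (Finset.univ.image (Function.update e k c))
    · obtain ⟨c, hc⟩ := H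
      have hcard := hpure _ hc
      rw [image_update] at hc hcard
      set τ := (Finset.univ.erase k).image e with hτ
      have hτle : τ.card ≤ D - 1 := by
        refine Finset.card_image_le.trans ?_
        rw [Finset.card_erase_of_mem (Finset.mem_univ k), Finset.card_univ, Fintype.card_fin]
      have hD : 0 < D := k.pos
      have hτr : IsRidge Δ D τ := by
        refine ⟨hc.isFace.subset (Finset.subset_insert _ _), ?_⟩
        have := Finset.card_insert_le c τ
        omega
      obtain ⟨a, b, hab, ha, hb, hfac, f, hf, hfa, hfb⟩ := hI τ hτr
      have hσa := ((hfac _).2 (Or.inl rfl)).1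
      have hσb := ((hfac _).2 (Or.inr rfl)).1
      have hval : ∀ c, IsFacet Δ (insert c τ) → signCycle Δ v (Function.update e k c) =
          SignType.sign (simplexDet v (Function.update e k c)) := by
        intro c hc
        rw [hτ, ← image_update] at hc
        exact if_pos ⟨hc.injective_of_image hpure, hc⟩
      rw [sum_update_eq hpure (z := signCycle Δ v) (fun e he => if_neg he) hab hτ.symm hτr hfac, hval a hσa,
        hval b hσb, sign_simplexDet_update hpure hv hτ.symm ha hσa hf hfa hfb]
      ring
    -- No choice of the missing entry gives a facet, so every term is zero.
    · push Not at H
      exact Finset.sum_eq_zero fun c _ => if_neg fun h => H c h.2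

theorem facetSign_eq_simplexDet {z : (Fin D → V) → ℤ} (hz : IsFundamentalCycle Δ D z)
    (e : Fin D → V) (he : Function.Injective e) :
    facetSign z v (Finset.univ.image e) = z e * SignType.sign (simplexDet v e) :=
  facetSign_eq hz v e he

omit [Fintype V] in
theorem exists_injective_image_eq (hσ : σ.card = D) :
    ∃ e : Fin D → V, Function.Injective e ∧ Finset.univ.image e = σ := by
  refine ⟨fun k => ((σ.equivFinOfCardEq hσ).symm k : V),
    Subtype.val_injective.comp (Equiv.injective _), ?_⟩
  ext i
  simp only [Finset.mem_image, Finset.mem_univ, true_and]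
  constructor
  · rintro ⟨k, rfl⟩
    exact Subtype.property _
  · intro hi
    exact ⟨σ.equivFinOfCardEq hσ ⟨i, hi⟩, by simp⟩

/-- Across the ridge both factors change sign: the coefficient by the cycle condition, the
determinant by ICoP. -/
theorem HasICoP.facetSign_eq_of_isRidge (hpure : IsPure Δ D) (hv : IsPreEmbedding Δ v)
    (hI : HasICoP Δ v) {z : (Fin D → V) → ℤ} (hz : IsFundamentalCycle Δ D z)
    (hτr : IsRidge Δ D τ) {σ σ' : Finset V} (hσ : IsFacet Δ σ) (hτσ : τ ⊆ σ)
    (hσ' : IsFacet Δ σ') (hτσ' : τ ⊆ σ') : facetSign z v σ = facetSign z v σ' := by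
  obtain ⟨a, b, hab, ha, hb, hfac, f, hf, hfa, hfb⟩ := hI τ hτr
  have hσa := ((hfac _).2 (Or.inl rfl)).1
  have hσb := ((hfac _).2 (Or.inr rfl)).1
  obtain ⟨e, he, heσ⟩ := exists_injective_image_eq (hpure _ hσa)
  obtain ⟨k, -, hk⟩ := Finset.mem_image.1 (heσ ▸ Finset.mem_insert_self a τ)
  have hτ : (Finset.univ.erase k).image e = τ := by
    rw [Finset.image_erase he, heσ, hk, Finset.erase_insert ha]
  have hsum := hz.boundary e k
  rw [sum_update_eq hpure hz.nonfacet hab hτ hτr hfac] at hsum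
  have hs := sign_simplexDet_update hpure hv hτ ha hσa hf hfa hfb
  have hval : ∀ c, IsFacet Δ (insert c τ) → facetSign z v (insert c τ) =
      z (Function.update e k c) * SignType.sign (simplexDet v (Function.update e k c)) := by
    intro c hc
    rw [← hτ, ← image_update] at hc ⊢
    exact facetSign_eq_simplexDet hz _ (hc.injective_of_image hpure)
  have key : facetSign z v (insert a τ) = facetSign z v (insert b τ) := by
    rw [hval a hσa, hval b hσb, hs, eq_neg_of_add_eq_zero_left hsum]
    ring
  rcases (hfac σ).1 ⟨hσ, hτσ⟩ with rfl | rfl <;> rcases (hfac σ').1 ⟨hσ', hτσ'⟩ with rfl | rfl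
  exacts [rfl, key, key.symm, rfl]

theorem abs_facetSign (hpure : IsPure Δ D) (hv : IsPreEmbedding Δ v) {z : (Fin D → V) → ℤ}
    (hz : IsFundamentalCycle Δ D z) (hσ : IsFacet Δ σ) : |facetSign z v σ| = 1 := by
  obtain ⟨e, he, rfl⟩ := exists_injective_image_eq (hpure _ hσ)
  rw [facetSign_eq_simplexDet hz e he, abs_mul, hz.facet e he hσ,
    abs_sign_of_ne_zero (hv.simplexDet_ne_zero he hσ.isFace), one_mul]

theorem HasICoP.hasDegreeOneOrNegOne_of_unique (hpure : IsPure Δ D) (hv : IsPreEmbedding Δ v)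
    (hI : HasICoP Δ v) (h : ∀ y, IsGeneric Δ v y → InExactlyOneFacetCone Δ v y) :
    HasDegreeOneOrNegOne hv := by
  refine ⟨signCycle Δ v, hI.isFundamentalCycle_signCycle hpure hv, Or.inl fun y hy => ?_⟩
  rw [finsum_facetSign_eq hpure hv _ y hy]
  obtain ⟨σ, hσ, hu⟩ := h y hy
  let : Unique {σ : Finset V // IsFacet Δ σ ∧ (y : EuclideanSpace ℝ (Fin D)) ∈ cone v σ} :=
    ⟨⟨⟨σ, hσ⟩⟩, fun σ' => Subtype.ext (hu σ' σ'.2)⟩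
  rw [finsum_unique]
  change facetSign _ v σ = 1
  obtain ⟨e, he, rfl⟩ := exists_injective_image_eq (hpure _ hσ.1)
  rw [facetSign_eq_simplexDet (hI.isFundamentalCycle_signCycle hpure hv) e he, signCycle,
    if_pos ⟨he, hσ.1⟩]
  rcases (hv.simplexDet_ne_zero he hσ.1.isFace).lt_or_gt with h0 | h0 <;> simp [h0]

/-- By strong connectivity all facets have the same sign, so the signed count over a generic point
is, up to sign, the number of facet cones there. -/
theorem HasICoP.unique_of_hasDegree (hpure : IsPure Δ D) (hv : IsPreEmbedding Δ v)
    (hI : HasICoP Δ v) (hD : 1 ≤ D) (hconn : IsStronglyConnected Δ D)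
    (hdeg : HasDegreeOneOrNegOne hv) : ∃ y, InExactlyOneFacetCone Δ v y := by
  obtain ⟨z, hz, hd⟩ := hdeg
  obtain ⟨σ, hσ, -⟩ := IsFace.exists_isFacet (Δ := Δ) (F := ∅) (Or.inl rfl)
  obtain ⟨y₀, -, hy₀σ, hy₀⟩ := hσ.exists_mem_openCone hpure hv (zero_mem _) univ_mem
    (dense_isGeneric hv)
  have hne : y₀ ≠ 0 := by
    rintro rfl
    have : σ.Nonempty := Finset.card_pos.1 (by rw [hpure σ hσ]; exact hD)
    obtain ⟨i, hi⟩ := this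
    exact hy₀.coords_ne_zero hpure hv hσ hi (by simp)
  have hn : (0 : ℝ) < ‖y₀‖⁻¹ := inv_pos.2 (norm_pos_iff.2 hne)
  let y : Metric.sphere (0 : EuclideanSpace ℝ (Fin D)) 1 :=
    ⟨‖y₀‖⁻¹ • y₀, by rw [mem_sphere_zero_iff_norm, norm_smul, norm_inv, norm_norm,
      inv_mul_cancel₀ (norm_ne_zero_iff.2 hne)]⟩
  have hy : IsGeneric Δ v (y : EuclideanSpace ℝ (Fin D)) := fun τ hτ hmem =>
    hy₀ τ hτ (((lin v τ).smul_mem_iff hn.ne').1 hmem)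
  have hdy : ∃ ε : ℤ, |ε| = 1 ∧ ∑ᶠ x : {x : realization Δ // sphereMap hv x = y},
      facetSign z v (carrier (x : V → ℝ)) = ε := by
    rcases hd with h | h
    exacts [⟨1, by simp, h y hy⟩, ⟨-1, by simp, h y hy⟩]
  obtain ⟨ε, hε, hsum⟩ := hdy
  rw [finsum_facetSign_eq hpure hv z y hy] at hsum
  have hconst : ∀ σ', IsFacet Δ σ' → facetSign z v σ' = facetSign z v σ := fun σ' hσ' =>
    (hconn.mem_of_mem (S := {σ' | IsFacet Δ σ' ∧ facetSign z v σ' = facetSign z v σ})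
      (fun σ₁ h₁ τ hτσ₁ hτ σ₂ h₂ hτσ₂ => ⟨h₂, by
        rw [← h₁.2, hI.facetSign_eq_of_isRidge hpure hv hz hτ h₁.1 hτσ₁ h₂ hτσ₂]⟩)
      hσ ⟨hσ, rfl⟩ hσ').2
  have hcongr : ∀ σ' : {σ : Finset V // IsFacet Δ σ ∧ (y : EuclideanSpace ℝ (Fin D)) ∈ cone v σ},
      facetSign z v σ' = facetSign z v σ := fun σ' => hconst σ'.1 σ'.2.1
  rw [finsum_congr hcongr] at hsum
  have : Fintype {σ : Finset V // IsFacet Δ σ ∧ (y : EuclideanSpace ℝ (Fin D)) ∈ cone v σ} :=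
    Fintype.ofFinite _
  rw [finsum_eq_sum_of_fintype, Finset.sum_const, Finset.card_univ, nsmul_eq_mul] at hsum
  have habs := congrArg abs hsum
  rw [abs_mul, abs_facetSign hpure hv hz hσ, hε, mul_one, Nat.abs_cast] at habs
  obtain ⟨σ', hσ'⟩ := Fintype.card_eq_one_iff.1 (Nat.cast_eq_one.1 habs)
  exact ⟨y, σ', σ'.2, fun σ₂ h₂ => congrArg Subtype.val (hσ' ⟨σ₂, h₂⟩)⟩

end Degree

end SimplicialFan

namespace SimplicialFan

open Filter Topology

/-! ### The covering away from codimension three -/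

section Covering

variable {V : Type*} [Fintype V] {D : ℕ} {v : V → EuclideanSpace ℝ (Fin D)}
  {F G K σ τ : Finset V} {Δ : PreAbstractSimplicialComplex V} {x x' : V → ℝ}
  {p q y : EuclideanSpace ℝ (Fin D)} {i : V}

/-- The linear extension on the cone over the realization. -/
noncomputable def coneMap (Δ : PreAbstractSimplicialComplex V)
    (v : V → EuclideanSpace ℝ (Fin D)) (x : coneComplex Δ) : EuclideanSpace ℝ (Fin D) :=
  comb v x

theorem continuous_coneMap : Continuous (coneMap Δ v) :=
  continuous_comb.comp continuous_subtype_val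

/-- The complement of the spans of the faces of codimension three. -/
def codimThreeCompl (Δ : PreAbstractSimplicialComplex V) (v : V → EuclideanSpace ℝ (Fin D)) :
    Set (EuclideanSpace ℝ (Fin D)) :=
  {y | ∀ η, IsFace Δ η → η.card + 3 = D → y ∉ lin v η}

theorem isOpen_codimThreeCompl : IsOpen (codimThreeCompl Δ v) := by
  have h : codimThreeCompl Δ v =
      {y | ∀ Q ∈ lin v '' {η | IsFace Δ η ∧ η.card + 3 = D}, y ∉ Q} := by
    ext y
    refine ⟨fun h => ?_, fun h η h1 h2 => h _ ⟨η, ⟨h1, h2⟩, rfl⟩⟩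
    rintro _ ⟨η, ⟨h1, h2⟩, rfl⟩
    exact h η h1 h2
  rw [h]
  exact isOpen_compl_iUnion_submodule ((Set.toFinite _).image _)

/-- The subspaces of codimension at least two that have to be avoided in order to stay away from
the spans of the faces of codimension two, and on segments from `y₀` from the spans of the faces of
codimension three. -/
def forbiddenSubspaces (Δ : PreAbstractSimplicialComplex V) (v : V → EuclideanSpace ℝ (Fin D))
    (y₀ : EuclideanSpace ℝ (Fin D)) : Set (Submodule ℝ (EuclideanSpace ℝ (Fin D))) :=
  lin v '' {ρ | IsCodimTwo Δ D ρ} ∪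
    (fun η => lin v η ⊔ Submodule.span ℝ {y₀}) '' {η | IsFace Δ η ∧ η.card + 3 = D}

theorem finite_forbiddenSubspaces (y₀ : EuclideanSpace ℝ (Fin D)) :
    (forbiddenSubspaces Δ v y₀).Finite :=
  ((Set.toFinite _).image _).union ((Set.toFinite _).image _)

omit [Fintype V] in
theorem finrank_of_mem_forbiddenSubspaces (hv : IsPreEmbedding Δ v)
    {y₀ : EuclideanSpace ℝ (Fin D)} {Q : Submodule ℝ (EuclideanSpace ℝ (Fin D))}
    (hQ : Q ∈ forbiddenSubspaces Δ v y₀) :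
    Module.finrank ℝ Q + 2 ≤ Module.finrank ℝ (EuclideanSpace ℝ (Fin D)) := by
  rw [finrank_euclideanSpace_fin]
  rcases hQ with ⟨ρ, hρ, rfl⟩ | ⟨η, ⟨hη, hcard⟩, rfl⟩
  · rw [finrank_lin hv hρ.1]
    exact hρ.2.le
  · have h1 := Submodule.finrank_add_le_finrank_add_finrank (lin v η) (Submodule.span ℝ {y₀})
    have h2 : Module.finrank ℝ (Submodule.span ℝ {y₀}) ≤ 1 := by
      simpa using finrank_span_le_card (R := ℝ) ({y₀} : Set (EuclideanSpace ℝ (Fin D)))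
    rw [finrank_lin hv hη] at h1
    dsimp only
    omega

/-- The points that avoid the forbidden subspaces. -/
def regularSet (Δ : PreAbstractSimplicialComplex V) (v : V → EuclideanSpace ℝ (Fin D))
    (y₀ : EuclideanSpace ℝ (Fin D)) : Set (EuclideanSpace ℝ (Fin D)) :=
  {y | ∀ Q ∈ forbiddenSubspaces Δ v y₀, y ∉ Q}

theorem isOpen_regularSet (y₀ : EuclideanSpace ℝ (Fin D)) : IsOpen (regularSet Δ v y₀) :=
  isOpen_compl_iUnion_submodule (finite_forbiddenSubspaces y₀)

theorem dense_regularSet (hv : IsPreEmbedding Δ v) (y₀ : EuclideanSpace ℝ (Fin D)) :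
    Dense (regularSet Δ v y₀) := by
  refine dense_compl_iUnion_submodule (finite_forbiddenSubspaces y₀) fun Q hQ h => ?_
  have := finrank_of_mem_forbiddenSubspaces hv hQ
  rw [h, finrank_top] at this
  omega

/-- The points that can be joined with `y₀` by a segment avoiding the spans of the faces of
codimension three. -/
def visibleSet (Δ : PreAbstractSimplicialComplex V) (v : V → EuclideanSpace ℝ (Fin D))
    (y₀ : EuclideanSpace ℝ (Fin D)) : Set (EuclideanSpace ℝ (Fin D)) :=
  {y | segment ℝ y₀ y ⊆ codimThreeCompl Δ v}

-- This links the two sets: `visibleSet` is star-shaped and carries a section, while `regularSet`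
-- stays connected inside open convex sets.
omit [Fintype V] in
theorem regularSet_subset_visibleSet {y₀ : EuclideanSpace ℝ (Fin D)}
    (hy₀ : y₀ ∈ codimThreeCompl Δ v) : regularSet Δ v y₀ ⊆ visibleSet Δ v y₀ :=
  fun _ hy _ hq η hη hcard => notMem_of_mem_segment (hy₀ η hη hcard)
    (hy _ (Or.inr ⟨η, ⟨hη, hcard⟩, rfl⟩)) hq

omit [Fintype V] in
theorem visibleSet_subset (y₀ : EuclideanSpace ℝ (Fin D)) :
    visibleSet Δ v y₀ ⊆ codimThreeCompl Δ v :=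
  fun _ hy => hy (right_mem_segment ℝ _ _)

omit [Fintype V] in
theorem starConvex_visibleSet (y₀ : EuclideanSpace ℝ (Fin D)) :
    StarConvex ℝ y₀ (visibleSet Δ v y₀) := by
  intro y hy a b ha hb hab
  exact ((convex_segment y₀ y).segment_subset (left_mem_segment ℝ _ _)
    ⟨a, b, ha, hb, hab, rfl⟩).trans hy

theorem isOpen_visibleSet (y₀ : EuclideanSpace ℝ (Fin D)) : IsOpen (visibleSet Δ v y₀) := by
  have h : visibleSet Δ v y₀ =
      {y | ∀ t ∈ Set.Icc (0 : ℝ) 1, AffineMap.lineMap y₀ y t ∈ codimThreeCompl Δ v} := by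
    ext y
    simp only [visibleSet, segment_eq_image_lineMap, Set.image_subset_iff, Set.mem_ofPred_eq]
    rfl
  rw [h, isOpen_iff_mem_nhds]
  intro y hy
  -- Compactness of the parameter interval makes the open condition uniform along the segment.
  refine isCompact_Icc.eventually_forall_of_forall_eventually fun t ht => ?_
  have hcont : Continuous fun z : EuclideanSpace ℝ (Fin D) × ℝ =>
      (AffineMap.lineMap y₀ z.1 z.2 : EuclideanSpace ℝ (Fin D)) := by
    simp only [AffineMap.lineMap_apply_module]
    fun_prop
  exact hcont.continuousAt.eventually_mem (isOpen_codimThreeCompl.mem_nhds (hy t ht))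

theorem isOpen_setOf_subset_carrier (F : Finset V) : IsOpen {x : V → ℝ | F ⊆ carrier x} := by
  have : {x : V → ℝ | F ⊆ carrier x} = ⋂ i ∈ F, {x | x i ≠ 0} := by
    ext x
    simp [Finset.subset_iff, mem_carrier]
  rw [this]
  exact isOpen_biInter_finset fun i _ => isOpen_ne_fun (continuous_apply i) continuous_const

variable (hpure : IsPure Δ D) (hv : IsPreEmbedding Δ v)
include hpure hv

theorem exists_coords_eq_of_mem_coneComplex (hx : x ∈ coneComplex Δ) :
    ∃ σ, IsFacet Δ σ ∧ coords v σ (comb v x) = x := by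
  obtain ⟨σ, hσ, hxσ⟩ := hx.2.exists_isFacet
  exact ⟨σ, hσ, hσ.coords_comb hpure hv (carrier_subset_iff.1 hxσ)⟩

theorem finite_preimage_coneMap (y : EuclideanSpace ℝ (Fin D)) :
    (coneMap Δ v ⁻¹' {y}).Finite := by
  refine Set.Finite.of_finite_image (f := Subtype.val) ?_ Subtype.val_injective.injOn
  refine (Set.finite_range fun σ => coords v σ y).subset ?_
  rintro _ ⟨x, hx, rfl⟩
  obtain ⟨σ, -, h⟩ := exists_coords_eq_of_mem_coneComplex hpure hv x.2
  exact ⟨σ, by rw [← h]; exact congrArg _ hx.symm⟩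

/-- The map is proper: the preimage of a compact `K` is closed and contained in the finite union of
the compact sets `coords v σ '' K`. -/
theorem isClosedMap_coneMap : IsClosedMap (coneMap Δ v) := by
  refine (isProperMap_iff_isCompact_preimage.2 ⟨continuous_coneMap, fun K hK => ?_⟩).isClosedMap
  rw [Topology.IsEmbedding.subtypeVal.isCompact_iff]
  have hc : IsCompact (⋃ σ : Finset V, coords v σ '' K) :=
    isCompact_iUnion fun σ => hK.image continuous_coords
  refine hc.of_isClosed_subset ?_ ?_
  · have h : Subtype.val '' (coneMap Δ v ⁻¹' K) = coneComplex Δ ∩ comb v ⁻¹' K := by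
      ext x
      constructor
      · rintro ⟨x, hx, rfl⟩
        exact ⟨x.2, hx⟩
      · rintro ⟨h1, h2⟩
        exact ⟨⟨x, h1⟩, h2, rfl⟩
    rw [h]
    exact isClosed_coneComplex.inter (hK.isClosed.preimage continuous_comb)
  · rintro _ ⟨x, hx, rfl⟩
    obtain ⟨σ, -, h⟩ := exists_coords_eq_of_mem_coneComplex hpure hv x.2
    exact Set.mem_iUnion.2 ⟨σ, _, hx, h⟩

/-- The forbidden subspaces have codimension at least two, so they meet the hyperplane of `τ` in
proper subspaces, and density can be applied inside that hyperplane. -/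
theorem exists_mem_openCone_inter_regularSet (hτ : IsRidge Δ D τ)
    (y₀ : EuclideanSpace ℝ (Fin D)) : ∃ p ∈ openCone v τ, p ∈ regularSet Δ v y₀ := by
  obtain ⟨σ, hσ, hτσ⟩ := hτ.1.exists_isFacet
  have hdense : Dense {w : lin v τ | ∀ Q ∈ (fun Q => Q.comap (lin v τ).subtype) ''
      forbiddenSubspaces Δ v y₀, w ∉ Q} := by
    refine dense_compl_iUnion_submodule ((finite_forbiddenSubspaces y₀).image _) ?_
    rintro _ ⟨Q, hQ, rfl⟩ h
    have h1 : lin v τ ≤ Q := Submodule.comap_subtype_eq_top.1 h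
    have h2 := Submodule.finrank_mono h1
    have h3 := finrank_of_mem_forbiddenSubspaces hv hQ
    rw [finrank_lin hv hτ.1] at h2
    rw [finrank_euclideanSpace_fin] at h3
    have := hτ.2
    omega
  have hopen : IsOpen {w : lin v τ | ∀ i ∈ τ, 0 < coords v σ w i} := by
    have : {w : lin v τ | ∀ i ∈ τ, 0 < coords v σ w i} =
        ⋂ i ∈ τ, {w : lin v τ | 0 < coords v σ w i} := by ext; simp
    rw [this]
    exact isOpen_biInter_finset fun i _ => isOpen_lt continuous_const
      ((continuous_coords_apply i).comp continuous_subtype_val)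
  have hs := sum_mem_openCone (v := v) (F := τ)
  have hsl : ∑ i ∈ τ, v i ∈ lin v τ :=
    sum_mem fun i hi => Submodule.subset_span (Set.mem_image_of_mem v hi)
  obtain ⟨w, hw1, hw2⟩ := hdense.inter_open_nonempty _ hopen
    ⟨⟨_, hsl⟩, ((hσ.mem_openCone_iff hpure hv hτσ).1 hs).1⟩
  exact ⟨w, (hσ.mem_openCone_iff hpure hv hτσ).2
    ⟨hw1, (hσ.mem_lin_iff_coords hpure hv hτσ).1 w.2⟩, fun Q hQ => hw2 _ ⟨Q, hQ, rfl⟩⟩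

variable [DecidableEq V] (hI : HasICoP Δ v)
include hI

theorem HasICoP.starInjective_of_isRidge (hτ : IsRidge Δ D τ) : StarInjective Δ v τ := by
  obtain ⟨a, b, hab, ha, hb, hfac, f, hf, hfa, hfb⟩ := hI τ hτ
  have hσa := ((hfac _).2 (Or.inl rfl)).1
  have hσb := ((hfac _).2 (Or.inr rfl)).1
  have key : ∀ y, IsGeneric Δ v y → y ∈ cone v (insert a τ) → y ∈ cone v (insert b τ) → False := by
    intro y hy h1 h2
    have h3 := mul_pos (hy.coords_pos hpure hv hσa h1 (Finset.mem_insert_self _ _)) hfa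
    have h4 := mul_neg_of_pos_of_neg
      (hy.coords_pos hpure hv hσb h2 (Finset.mem_insert_self _ _)) hfb
    rw [← hσa.apply_eq hpure hv ha hf] at h3
    rw [← hσb.apply_eq hpure hv hb hf] at h4
    exact lt_asymm h3 h4
  intro σ σ' hσ hσ' hτσ hτσ' y hy h1 h2
  rcases (hfac σ).1 ⟨hσ, hτσ⟩ with rfl | rfl <;> rcases (hfac σ').1 ⟨hσ', hτσ'⟩ with rfl | rfl
  exacts [rfl, (key y hy h1 h2).elim, (key y hy h2 h1).elim, rfl]

theorem isOpenMap_coneMap : IsOpenMap (coneMap Δ v) := by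
  refine isOpenMap_iff_nhds_le.2 fun x => ?_
  intro N hN
  obtain ⟨M, hM, hMN⟩ := mem_nhds_subtype _ _ _ |>.1 (mem_map.1 hN)
  filter_upwards [hI.eventually_exists_comb_eq hpure hv x.2 hM] with q ⟨x', hx', hx'M, hq⟩
  rw [← hq]
  exact hMN (a := ⟨x', hx'⟩) hx'M

variable (hρ : ∀ ρ, IsCodimTwo Δ D ρ → StarInjective Δ v ρ)
include hρ

/-- Away from the codimension-three spans the carrier is a facet, a ridge or a face of codimension
two: trivial, by ICoP, and by hypothesis, respectively. -/
theorem starInjective_carrier (hx : x ∈ coneComplex Δ) (hy : comb v x ∈ codimThreeCompl Δ v) :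
    StarInjective Δ v (carrier x) := by
  obtain ⟨σ, hσ, hxσ⟩ := hx.2.exists_isFacet
  have hcard : D ≤ (carrier x).card + 2 := by
    by_contra hlt
    obtain ⟨η, h1, h2, h3⟩ := Finset.exists_subsuperset_card_eq hxσ
      (show (carrier x).card ≤ D - 3 by omega) (by rw [hpure σ hσ]; omega)
    exact hy η (hσ.isFace.subset h2) (by omega)
      (mem_lin_iff.2 ⟨x, carrier_subset_iff.1 h1, rfl⟩)
  have hle := hx.2.card_le hpure
  by_cases h2 : (carrier x).card + 2 = D
  · exact hρ _ ⟨hx.2, h2⟩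
  by_cases h1 : (carrier x).card + 1 = D
  · exact hI.starInjective_of_isRidge hpure hv ⟨hx.2, h1⟩
  · have hf := hx.2.isFacet_of_card hpure (by omega)
    intro σ σ' hσ hσ' hxσ hxσ' _ _ _ _
    rw [← hf.eq_of_subset hσ.isFace hxσ, ← hf.eq_of_subset hσ'.isFace hxσ']

/-- A closed map with finite fibres is a covering where it is a local homeomorphism. Around `x` it
is open, and it is injective on the open set of points whose carrier contains that of `x`. -/
theorem isCoveringMapOn_coneMap :
    IsCoveringMapOn (coneMap Δ v) (codimThreeCompl Δ v) := by
  refine (isClosedMap_coneMap hpure hv).isCoveringMapOn_of_isLocalHomeomorphOn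
    (fun y _ => finite_preimage_coneMap hpure hv y) (IsLocalHomeomorphOn.mk _ _ fun x hx => ?_)
  have : Nonempty (coneComplex Δ) := ⟨x⟩
  have hinj : Set.InjOn (coneMap Δ v)
      {x' | carrier (x : V → ℝ) ⊆ carrier (x' : V → ℝ)} := fun x₁ h₁ x₂ h₂ h =>
    Subtype.ext ((starInjective_carrier hpure hv hI hρ x.2 hx).eq_of_comb_eq hpure hv hI
      x₁.2 x₂.2 h₁ h₂ h)
  refine ⟨OpenPartialHomeomorph.ofContinuousOpen (hinj.toPartialEquiv _ _)
    continuous_coneMap.continuousOn (isOpenMap_coneMap hpure hv hI)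
    ((isOpen_setOf_subset_carrier _).preimage continuous_subtype_val), ?_, fun _ _ => rfl⟩
  exact Finset.Subset.refl _

/-- The inclusion of the visible set lifts through the covering, since this set is contractible and
locally path connected. -/
theorem exists_section {y₀ : EuclideanSpace ℝ (Fin D)}
    (hy₀ : y₀ ∈ codimThreeCompl Δ v) {x₀ : V → ℝ} (hx₀ : x₀ ∈ coneComplex Δ)
    (h₀ : comb v x₀ = y₀) :
    ∃ s : EuclideanSpace ℝ (Fin D) → V → ℝ, ContinuousOn s (visibleSet Δ v y₀) ∧
      (∀ y ∈ visibleSet Δ v y₀, s y ∈ coneComplex Δ ∧ comb v (s y) = y) ∧ s y₀ = x₀ := by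
  have hmem : y₀ ∈ visibleSet Δ v y₀ := by simpa [visibleSet] using hy₀
  have : ContractibleSpace (visibleSet Δ v y₀) :=
    (starConvex_visibleSet y₀).contractibleSpace ⟨y₀, hmem⟩
  have : LocallyPathConnectedSpace (visibleSet Δ v y₀) :=
    (isOpen_visibleSet y₀).locallyPathConnectedSpace
  obtain ⟨f, ⟨hf1, hf2⟩, -⟩ :=
    (isCoveringMapOn_coneMap hpure hv hI hρ).existsUnique_continuousMap_lifts
      (⟨Subtype.val, continuous_subtype_val⟩ : C(visibleSet Δ v y₀, EuclideanSpace ℝ (Fin D)))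
      (a₀ := ⟨y₀, hmem⟩) (e₀ := ⟨x₀, hx₀⟩) h₀ (fun a => visibleSet_subset y₀ a.2)
  classical
  refine ⟨fun y => if h : y ∈ visibleSet Δ v y₀ then f ⟨y, h⟩ else 0, ?_, fun y hy => ?_, ?_⟩
  · rw [continuousOn_iff_continuous_domRestrict]
    convert! continuous_subtype_val.comp f.continuous using 1
    ext y
    simp
  · simp only [dif_pos hy]
    exact ⟨Subtype.property _, congrFun hf2 ⟨y, hy⟩⟩
  · simp only [dif_pos hmem, hf1]

/-- If the fan is locally injective around the faces of codimension two and the complex is strongly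
connected, then the cones of the facets cover space only once. -/
theorem exists_inExactlyOneFacetCone_of_starInjective
    (hconn : IsStronglyConnected Δ D) : ∃ y, InExactlyOneFacetCone Δ v y := by
  obtain ⟨σ₀, hσ₀, -⟩ := IsFace.exists_isFacet (Δ := Δ) (F := ∅) (Or.inl rfl)
  obtain ⟨y₀, -, hy₀σ, hy₀⟩ := hσ₀.exists_mem_openCone hpure hv (zero_mem _) univ_mem
    (dense_isGeneric hv)
  have hy₀3 : y₀ ∈ codimThreeCompl Δ v := fun η hη hcard =>
    IsGeneric.notMem_lin hpure hy₀ hη (by omega)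
  obtain ⟨s, hs, hsec, hs₀⟩ := exists_section hpure hv hI hρ hy₀3
    (hσ₀.coords_mem_coneComplex hpure hv (openCone_subset_cone hy₀σ))
    (hσ₀.comb_coords hpure hv y₀)
  have hWA : regularSet Δ v y₀ ⊆ visibleSet Δ v y₀ := regularSet_subset_visibleSet hy₀3
  have hsat : ∀ y ∈ visibleSet Δ v y₀, ContinuousAt s y := fun y hy =>
    hs.continuousAt ((isOpen_visibleSet y₀).mem_nhds hy)
  -- Agreement of the section with the coordinates of `σ` at `p` persists nearby inside the cone:
  -- both points have carriers containing that of `s p`, where local injectivity applies.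
  have hloc : ∀ p ∈ visibleSet Δ v y₀, ∀ σ, IsFacet Δ σ → s p = coords v σ p →
      ∀ᶠ y in 𝓝 p, y ∈ openCone v σ → s y = coords v σ y := by
    intro p hp σ hσ heq
    have hp3 : comb v (s p) ∈ codimThreeCompl Δ v := by
      rw [(hsec p hp).2]
      exact visibleSet_subset y₀ hp
    filter_upwards [(isOpen_visibleSet y₀).mem_nhds hp,
      (hsat p hp).eventually_mem ((isOpen_setOf_subset_carrier (carrier (s p))).mem_nhds
        (Finset.Subset.refl _)),
      continuous_coords.continuousAt.eventually_mem
        ((isOpen_setOf_subset_carrier (carrier (s p))).mem_nhds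
          (show carrier (s p) ⊆ carrier (coords v σ p) by rw [heq]))] with y h1 h2 h3 h4
    exact (starInjective_carrier hpure hv hI hρ (hsec p hp).1 hp3).eq_of_comb_eq hpure hv hI
      (hsec y h1).1 (hσ.coords_mem_coneComplex hpure hv (openCone_subset_cone h4)) h2 h3
      (by rw [(hsec y h1).2, hσ.comb_coords hpure hv])
  -- Within a facet, agreement is open by `hloc` and closed by continuity, and the regular part of
  -- the open cone is connected.
  have hspread : ∀ σ, IsFacet Δ σ → (∃ y ∈ openCone v σ ∩ regularSet Δ v y₀,
      s y = coords v σ y) → ∀ y ∈ openCone v σ ∩ regularSet Δ v y₀, s y = coords v σ y := by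
    rintro σ hσ ⟨y₁, hy₁, h₁⟩
    have hG : IsOpen (openCone v σ ∩ regularSet Δ v y₀) :=
      (hσ.isOpen_openCone hpure hv).inter (isOpen_regularSet y₀)
    have hGc : IsPreconnected (openCone v σ ∩ regularSet Δ v y₀) :=
      isPreconnected_inter_compl_iUnion_submodule (finite_forbiddenSubspaces y₀)
        (fun Q hQ => finrank_of_mem_forbiddenSubspaces hv hQ) (hσ.isOpen_openCone hpure hv)
        (hσ.convex_openCone hpure hv)
    have hsub := isPreconnected_iff_subset_of_disjoint.1 hGc
      {y | y ∈ openCone v σ ∩ regularSet Δ v y₀ ∧ s y = coords v σ y}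
      {y | y ∈ openCone v σ ∩ regularSet Δ v y₀ ∧ s y ≠ coords v σ y} ?_ ?_ ?_ ?_
    · rcases hsub with h | h
      · exact fun y hy => (h hy).2
      · exact absurd h₁ (h hy₁).2
    · rw [isOpen_iff_mem_nhds]
      rintro y ⟨hy, heq⟩
      filter_upwards [hG.mem_nhds hy, hloc y (hWA hy.2) σ hσ heq] with z h1 h2
      exact ⟨h1, h2 h1.1⟩
    · rw [isOpen_iff_mem_nhds]
      rintro y ⟨hy, hne⟩
      filter_upwards [hG.mem_nhds hy,
        ((hsat y (hWA hy.2)).prodMk continuous_coords.continuousAt).eventually_mem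
          (isClosed_diagonal.isOpen_compl.mem_nhds hne)] with z h1 h2
      exact ⟨h1, h2⟩
    · intro y hy
      by_cases h : s y = coords v σ y
      · exact Or.inl ⟨hy, h⟩
      · exact Or.inr ⟨hy, h⟩
    · exact Set.eq_empty_of_forall_notMem fun y hy => hy.2.2.2 hy.2.1.2
  -- Agreement crosses each ridge at a regular point `p`: it reaches `p` by continuity, the two
  -- facets have the same coordinates there, and `hloc` carries it into the second facet.
  have hall : ∀ σ, IsFacet Δ σ → ∃ y ∈ openCone v σ ∩ regularSet Δ v y₀,
      s y = coords v σ y := by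
    intro σ hσ
    refine (hconn.mem_of_mem (S := {σ | IsFacet Δ σ ∧ ∃ y ∈ openCone v σ ∩ regularSet Δ v y₀,
      s y = coords v σ y}) ?_ hσ₀ ⟨hσ₀, ?_⟩ hσ).2
    · rintro σ₁ ⟨hσ₁, h₁⟩ τ hτσ₁ hτ σ₂ hσ₂ hτσ₂
      refine ⟨hσ₂, ?_⟩
      obtain ⟨p, hpτ, hpW⟩ := exists_mem_openCone_inter_regularSet hpure hv hτ y₀
      have hcl : p ∈ closure (openCone v σ₁ ∩ regularSet Δ v y₀) := by
        refine mem_closure_iff_nhds.2 fun U hU => ?_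
        obtain ⟨y, h1, h2, h3⟩ := hσ₁.exists_mem_openCone hpure hv
          (cone_mono hτσ₁ (openCone_subset_cone hpτ)) hU (dense_regularSet hv y₀)
        exact ⟨y, h1, h2, h3⟩
      have : (𝓝[openCone v σ₁ ∩ regularSet Δ v y₀] p).NeBot :=
        mem_closure_iff_nhdsWithin_neBot.1 hcl
      have h3 : s p = coords v σ₁ p := by
        refine tendsto_nhds_unique (l := 𝓝[openCone v σ₁ ∩ regularSet Δ v y₀] p)
          ((hsat p (hWA hpW)).mono_left nhdsWithin_le_nhds) ?_
        refine ((continuous_coords.tendsto p).mono_left nhdsWithin_le_nhds).congr' ?_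
        filter_upwards [self_mem_nhdsWithin] with y hy using (hspread σ₁ hσ₁ h₁ y hy).symm
      have h4 : coords v σ₁ p = coords v σ₂ p := by
        refine hv.eq_of_comb_eq hτ.1 ((hσ₁.mem_openCone_iff hpure hv hτσ₁).1 hpτ).2
          ((hσ₂.mem_openCone_iff hpure hv hτσ₂).1 hpτ).2 ?_
        rw [hσ₁.comb_coords hpure hv, hσ₂.comb_coords hpure hv]
      obtain ⟨y, h5, h6, h7⟩ := hσ₂.exists_mem_openCone hpure hv
          (cone_mono hτσ₂ (openCone_subset_cone hpτ))
          (hloc p (hWA hpW) σ₂ hσ₂ (h3.trans h4)) (dense_regularSet hv y₀)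
      exact ⟨y, ⟨h6, h7⟩, h5 h6⟩
    · have h1 : y₀ ∈ visibleSet Δ v y₀ := by simpa [visibleSet] using hy₀3
      obtain ⟨y, h5, h6, h7⟩ := hσ₀.exists_mem_openCone hpure hv (openCone_subset_cone hy₀σ)
        (hloc y₀ h1 σ₀ hσ₀ hs₀) (dense_regularSet hv y₀)
      exact ⟨y, ⟨h6, h7⟩, h5 h6⟩
  -- At a generic regular point the single value `s y` is the coordinate vector in every facet over
  -- `y`, and its carrier is that facet.
  obtain ⟨y, -, h2, h1, h3⟩ := hσ₀.exists_mem_openCone hpure hv (zero_mem _) univ_mem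
    ((dense_regularSet hv y₀).inter_of_isOpen_left (dense_isGeneric hv) (isOpen_regularSet y₀))
  refine ⟨y, σ₀, ⟨hσ₀, openCone_subset_cone h2⟩, fun σ hσ => ?_⟩
  have h4 : y ∈ openCone v σ := IsGeneric.mem_openCone hpure hv h3 hσ.1 hσ.2
  rw [← hσ₀.carrier_coords_eq hpure hv subset_rfl h2,
    ← hσ.1.carrier_coords_eq hpure hv subset_rfl h4,
    ← hspread σ₀ hσ₀ (hall σ₀ hσ₀) y ⟨h2, h1⟩, ← hspread σ hσ.1 (hall σ hσ.1) y ⟨h4, h1⟩]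

end Covering

end SimplicialFan

namespace SimplicialFan

open Filter Topology

/-! ### Winding numbers of plane polygons -/

section Planar

/-- The half-open sectors between consecutive points of a closed polygon are disjoint. -/
def SectorsDisjoint {n : ℕ} (w : ZMod n → ℂ) : Prop :=
  ∀ (i j : ZMod n) (x y x' y' : ℝ), 0 < x → 0 ≤ y → 0 < x' → 0 ≤ y' →
    (x : ℂ) * w i + y * w (i + 1) = x' * w j + y' * w (j + 1) → i = j

theorem exists_int_of_mul_exp_eq {s t a b : ℝ} (hs : 0 < s) (ht : 0 < t)
    (h : (s : ℂ) * Complex.exp (a * Complex.I) = t * Complex.exp (b * Complex.I)) :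
    ∃ m : ℤ, a = b + 2 * Real.pi * m := by
  have h1 := congrArg norm h
  rw [norm_mul, norm_mul, Complex.norm_exp_ofReal_mul_I, Complex.norm_exp_ofReal_mul_I,
    Complex.norm_of_nonneg hs.le, Complex.norm_of_nonneg ht.le, mul_one, mul_one] at h1
  subst h1
  have h2 := mul_left_cancel₀ (Complex.ofReal_ne_zero.2 hs.ne') h
  obtain ⟨m, hm⟩ := Complex.exp_eq_exp_iff_exists_int.1 h2
  refine ⟨m, ?_⟩
  have h3 := congrArg Complex.im hm
  simp at h3
  linarith

theorem eq_of_mul_exp_eq {s t a b : ℝ} (hs : 0 < s) (ht : 0 < t)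
    (h : (s : ℂ) * Complex.exp (a * Complex.I) = t * Complex.exp (b * Complex.I))
    (hab : |a - b| < 2 * Real.pi) : a = b := by
  obtain ⟨m, hm⟩ := exists_int_of_mul_exp_eq hs ht h
  have hpi := Real.pi_pos
  rw [hm, add_sub_cancel_left, abs_mul, abs_of_pos (by positivity)] at hab
  have h1 : |(m : ℝ)| < 1 := by
    by_contra h1
    push Not at h1
    nlinarith
  have h2 : m = 0 := by
    have : |m| < 1 := by exact_mod_cast h1
    exact Int.abs_lt_one_iff.1 this
  rw [hm, h2]
  simp

theorem arg_pos_of_im_pos {z : ℂ} (hz : 0 < z.im) : 0 < Complex.arg z := by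
  refine lt_of_le_of_ne (Complex.arg_nonneg_iff.2 hz.le) fun h => ?_
  exact hz.ne' (Complex.arg_eq_zero_iff.1 h.symm).2

theorem arg_lt_pi_of_im_pos {z : ℂ} (hz : 0 < z.im) : Complex.arg z < Real.pi :=
  lt_of_le_of_ne (Complex.arg_le_pi z) fun h => hz.ne' (Complex.arg_eq_pi_iff.1 h).2

/-- A vector in the half-open sector between `1` and `r` has an argument less than that of `r`. -/
theorem arg_add_mul_mem {r : ℂ} (hr : 0 < r.im) {x y : ℝ} (hx : 0 < x) (hy : 0 ≤ y) :
    (x + y * r : ℂ) ≠ 0 ∧ 0 ≤ Complex.arg (x + y * r) ∧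
      Complex.arg (x + y * r) < Complex.arg r := by
  set z : ℂ := x + y * r with hz
  have him : z.im = y * r.im := by simp [hz]
  have hz0 : z ≠ 0 := by
    intro h0
    have h1 : y * r.im = 0 := by rw [← him, h0, Complex.zero_im]
    have h2 : y = 0 := (mul_eq_zero.1 h1).resolve_right hr.ne'
    rw [hz, h2] at h0
    simp [hx.ne'] at h0
  have hnn : 0 ≤ Complex.arg z := Complex.arg_nonneg_iff.2 (him ▸ mul_nonneg hy hr.le)
  refine ⟨hz0, hnn, ?_⟩
  have hq : 0 < (r / z).im := by
    rw [Complex.div_im, him]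
    have hzre : z.re = x + y * r.re := by simp [hz]
    have : 0 < Complex.normSq z := Complex.normSq_pos.2 hz0
    rw [hzre, ← sub_div]
    refine div_pos ?_ this
    nlinarith [mul_pos hx hr]
  have h1 := arg_pos_of_im_pos hq
  have h2 := arg_lt_pi_of_im_pos hq
  have h3 := arg_pos_of_im_pos hr
  have h4 := arg_lt_pi_of_im_pos hr
  have h5 := Complex.arg_le_pi z
  have hr0 : r ≠ 0 := fun h => by simp [h] at hr
  -- The two sides agree modulo `2π`; the bounds on the three arguments leave no room for a nonzero
  -- multiple.
  have key : Complex.arg z + Complex.arg (r / z) = Complex.arg r := by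
    refine eq_of_mul_exp_eq (s := ‖z‖ * ‖r / z‖) (t := ‖r‖)
      (mul_pos (norm_pos_iff.2 hz0) (norm_pos_iff.2 (div_ne_zero hr0 hz0)))
      (norm_pos_iff.2 hr0) ?_ (abs_lt.2 ⟨by linarith, by linarith⟩)
    rw [Complex.norm_mul_exp_arg_mul_I]
    push_cast
    rw [add_mul, Complex.exp_add, mul_mul_mul_comm, Complex.norm_mul_exp_arg_mul_I,
      Complex.norm_mul_exp_arg_mul_I, mul_div_cancel₀ _ hz0]
  linarith

/-- A direction whose angle is less than the argument of `r` lies in the half-open sector between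
`1` and `r`. -/
theorem exists_exp_eq_add_mul {r : ℂ} (hr : 0 < r.im) {δ : ℝ} (h0 : 0 ≤ δ)
    (h1 : δ < Complex.arg r) :
    ∃ x y : ℝ, 0 < x ∧ 0 ≤ y ∧ Complex.exp (δ * Complex.I) = x + y * r := by
  have hα := arg_pos_of_im_pos hr
  have hπ := arg_lt_pi_of_im_pos hr
  have hr0 : r ≠ 0 := fun h => by simp [h] at hr
  set α := Complex.arg r with hαdef
  have hs : 0 < Real.sin α := Real.sin_pos_of_pos_of_lt_pi hα hπ
  have hn : 0 < ‖r‖ := norm_pos_iff.2 hr0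
  -- The coefficients come from the law of sines for the directions `0`, `δ` and `α`.
  refine ⟨Real.sin (α - δ) / Real.sin α, Real.sin δ / (‖r‖ * Real.sin α),
    div_pos (Real.sin_pos_of_pos_of_lt_pi (by linarith) (by linarith)) hs,
    div_nonneg (Real.sin_nonneg_of_nonneg_of_le_pi h0 (by linarith)) (by positivity), ?_⟩
  have hre : r.re = ‖r‖ * Real.cos α := (Complex.norm_mul_cos_arg r).symm
  have him : r.im = ‖r‖ * Real.sin α := (Complex.norm_mul_sin_arg r).symm
  apply Complex.ext
  · rw [Complex.exp_ofReal_mul_I_re]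
    simp only [Complex.add_re, Complex.re_ofReal_mul, Complex.ofReal_re, hre]
    rw [Real.sin_sub]
    field_simp
    ring
  · rw [Complex.exp_ofReal_mul_I_im]
    simp only [Complex.add_im, Complex.im_ofReal_mul, Complex.ofReal_im, him]
    field_simp
    ring

variable {n : ℕ} {w : ZMod n → ℂ}

/-- The angle between the first point and the point number `k` of a polygon. -/
noncomputable def angleSum (w : ZMod n → ℂ) (k : ℕ) : ℝ :=
  ∑ j ∈ Finset.range k, Complex.arg (w ((j : ZMod n) + 1) / w (j : ZMod n))

theorem angleSum_succ (k : ℕ) : angleSum w (k + 1) =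
    angleSum w k + Complex.arg (w ((k : ZMod n) + 1) / w (k : ZMod n)) :=
  Finset.sum_range_succ _ _

variable (hw : ∀ i, 0 < (w (i + 1) / w i).im)
include hw

theorem ne_zero_of_im_div_pos (i : ZMod n) : w i ≠ 0 := fun h => by
  have := hw i
  simp [h] at this

theorem angleSum_lt_succ (k : ℕ) : angleSum w k < angleSum w (k + 1) := by
  rw [angleSum_succ]
  linarith [arg_pos_of_im_pos (hw k)]

theorem strictMono_angleSum : StrictMono (angleSum w) :=
  strictMono_nat_of_lt_succ (angleSum_lt_succ hw)

theorem eq_mul_exp_angleSum (k : ℕ) : w (k : ZMod n) =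
    (‖w (k : ZMod n)‖ / ‖w 0‖ : ℝ) * w 0 * Complex.exp (angleSum w k * Complex.I) := by
  have h0 := norm_ne_zero_iff.2 (ne_zero_of_im_div_pos hw 0)
  induction k with
  | zero => simp [angleSum, h0]
  | succ k ih =>
    have hk := ne_zero_of_im_div_pos hw (k : ZMod n)
    have h1 := Complex.norm_mul_exp_arg_mul_I (w ((k : ZMod n) + 1) / w (k : ZMod n))
    rw [angleSum_succ, Nat.cast_succ]
    push_cast
    rw [add_mul, Complex.exp_add]
    have hk' : ((‖w (k : ZMod n)‖ : ℝ) : ℂ) ≠ 0 := Complex.ofReal_ne_zero.2 (norm_ne_zero_iff.2 hk)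
    calc w ((k : ZMod n) + 1)
        = w (k : ZMod n) * (w ((k : ZMod n) + 1) / w (k : ZMod n)) := (mul_div_cancel₀ _ hk).symm
      _ = ((‖w (k : ZMod n)‖ / ‖w 0‖ : ℝ) * w 0 * Complex.exp (angleSum w k * Complex.I)) *
          (‖w ((k : ZMod n) + 1) / w (k : ZMod n)‖ * Complex.exp
            (Complex.arg (w ((k : ZMod n) + 1) / w (k : ZMod n)) * Complex.I)) := by
        rw [h1, ← ih]
      _ = _ := by
        rw [norm_div]
        push_cast
        field_simp

/-- A vector in a half-open sector, in terms of its angle. -/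
theorem add_mul_eq_mul_exp (k : ℕ) {x y : ℝ} (hx : 0 < x) (hy : 0 ≤ y) :
    ∃ s δ : ℝ, 0 < s ∧ angleSum w k ≤ δ ∧ δ < angleSum w (k + 1) ∧
      (x : ℂ) * w (k : ZMod n) + y * w ((k : ZMod n) + 1) =
        s * w 0 * Complex.exp (δ * Complex.I) := by
  have hk := ne_zero_of_im_div_pos hw (k : ZMod n)
  have h0 := ne_zero_of_im_div_pos hw 0
  obtain ⟨hz, h1, h2⟩ := arg_add_mul_mem (hw k) hx hy
  set z : ℂ := x + y * (w ((k : ZMod n) + 1) / w (k : ZMod n)) with hzdef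
  refine ⟨‖w (k : ZMod n)‖ / ‖w 0‖ * ‖z‖, angleSum w k + Complex.arg z,
    mul_pos (div_pos (norm_pos_iff.2 hk) (norm_pos_iff.2 h0)) (norm_pos_iff.2 hz),
    by linarith, by rw [angleSum_succ]; linarith, ?_⟩
  calc (x : ℂ) * w (k : ZMod n) + y * w ((k : ZMod n) + 1) = w (k : ZMod n) * z := by
        rw [hzdef]
        field_simp
    _ = ((‖w (k : ZMod n)‖ / ‖w 0‖ : ℝ) * w 0 * Complex.exp (angleSum w k * Complex.I)) *
          (‖z‖ * Complex.exp (Complex.arg z * Complex.I)) := by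
        rw [← eq_mul_exp_angleSum hw, Complex.norm_mul_exp_arg_mul_I]
    _ = _ := by
        push_cast
        rw [add_mul, Complex.exp_add]
        ring

theorem exists_angleSum_eq : ∃ m : ℤ, angleSum w n = 2 * Real.pi * m := by
  have h0 := ne_zero_of_im_div_pos hw 0
  have h := eq_mul_exp_angleSum hw n
  rw [ZMod.natCast_self, div_self (norm_ne_zero_iff.2 h0)] at h
  obtain ⟨m, hm⟩ := exists_int_of_mul_exp_eq (a := angleSum w n) (b := 0) one_pos one_pos (by
    refine mul_left_cancel₀ h0 ?_
    rw [mul_left_comm, ← mul_assoc, ← h]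
    simp)
  exact ⟨m, by linarith⟩

/-- The sectors occupy the half-open intervals between consecutive values of `angleSum`, which are
disjoint and lie within one full turn. -/
theorem sectorsDisjoint_of_angleSum_eq [NeZero n] (h : angleSum w n = 2 * Real.pi) :
    SectorsDisjoint w := by
  have key : ∀ (a b : ℕ) (x y x' y' : ℝ), a < b → b < n → 0 < x → 0 ≤ y → 0 < x' → 0 ≤ y' →
      (x : ℂ) * w a + y * w (a + 1) ≠ x' * w b + y' * w (b + 1) := by
    intro a b x y x' y' hab hbn hx hy hx' hy' heq
    obtain ⟨s, δ, hs, h1, h2, h3⟩ := add_mul_eq_mul_exp hw a hx hy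
    obtain ⟨s', δ', hs', h1', h2', h3'⟩ := add_mul_eq_mul_exp hw b hx' hy'
    have h4 : angleSum w (a + 1) ≤ angleSum w b := (strictMono_angleSum hw).monotone hab
    have h5 : angleSum w (b + 1) ≤ angleSum w n := (strictMono_angleSum hw).monotone hbn
    have h6 : angleSum w 0 ≤ angleSum w a := (strictMono_angleSum hw).monotone (Nat.zero_le a)
    have h7 : angleSum w 0 = 0 := by simp [angleSum]
    have h8 : δ = δ' := by
      refine eq_of_mul_exp_eq hs hs' ?_ (abs_lt.2 ⟨by linarith, by linarith⟩)
      refine mul_left_cancel₀ (ne_zero_of_im_div_pos hw 0) ?_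
      rw [h3, h3'] at heq
      linear_combination heq
    linarith
  intro i j x y x' y' hx hy hx' hy' heq
  rw [← ZMod.natCast_zmod_val i, ← ZMod.natCast_zmod_val j] at heq ⊢
  rcases lt_trichotomy i.val j.val with hlt | hlt | hlt
  · exact absurd heq (key _ _ x y x' y' hlt (ZMod.val_lt j) hx hy hx' hy')
  · rw [hlt]
  · exact absurd heq.symm (key _ _ x' y' x y hlt (ZMod.val_lt i) hx' hy' hx hy)

/-- The total is a positive multiple of `2π`. If it exceeded one turn, the ray of `w 0` would be met
again in the first sector whose end passes `2π`. Disjointness makes this the sector number `0`,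
whose angle is less than `π`. -/
theorem angleSum_eq_of_sectorsDisjoint [NeZero n] (h : SectorsDisjoint w) :
    angleSum w n = 2 * Real.pi := by
  obtain ⟨m, hm⟩ := exists_angleSum_eq hw
  have hpi := Real.pi_pos
  have hmono := strictMono_angleSum hw
  have h0 : angleSum w 0 = 0 := by simp [angleSum]
  have hm0 : (0 : ℝ) < m := by
    have := hmono (NeZero.pos n)
    rw [h0, hm] at this
    exact pos_of_mul_pos_right this (by positivity)
  have hm1 : (1 : ℝ) ≤ m := by
    have : 0 < m := by exact_mod_cast hm0
    exact_mod_cast this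
  by_contra hne
  have hlt : 2 * Real.pi < angleSum w n := by
    refine lt_of_le_of_ne ?_ (Ne.symm hne)
    rw [hm]
    nlinarith
  have hex : ∃ k, 2 * Real.pi < angleSum w k := ⟨n, hlt⟩
  classical
  obtain ⟨j, hj⟩ : ∃ j, Nat.find hex = j + 1 := Nat.exists_eq_succ_of_ne_zero fun h' => by
    have := Nat.find_spec hex
    rw [h', h0] at this
    linarith
  have h1 : 2 * Real.pi < angleSum w (j + 1) := hj ▸ Nat.find_spec hex
  have h2 : angleSum w j ≤ 2 * Real.pi := not_lt.1 (Nat.find_min hex (by omega))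
  have hjn : j < n := by
    have := Nat.find_min' hex hlt
    omega
  rw [angleSum_succ] at h1
  obtain ⟨x, y, hx, hy, hxy⟩ := exists_exp_eq_add_mul (hw j)
    (δ := 2 * Real.pi - angleSum w j) (by linarith) (by linarith)
  have hwj := ne_zero_of_im_div_pos hw (j : ZMod n)
  have hw0 := ne_zero_of_im_div_pos hw 0
  have hc : 0 < ‖w (j : ZMod n)‖ / ‖w 0‖ := div_pos (norm_pos_iff.2 hwj) (norm_pos_iff.2 hw0)
  have heq : ((‖w (j : ZMod n)‖ / ‖w 0‖ : ℝ) : ℂ) * w 0 + (0 : ℝ) * w (0 + 1) =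
      x * w (j : ZMod n) + y * w ((j : ZMod n) + 1) := by
    have h3 : w (j : ZMod n) * Complex.exp ((2 * Real.pi - angleSum w j : ℝ) * Complex.I) =
        (‖w (j : ZMod n)‖ / ‖w 0‖ : ℝ) * w 0 := by
      conv_lhs => rw [eq_mul_exp_angleSum hw j]
      rw [mul_assoc, ← Complex.exp_add, ← add_mul, ← Complex.ofReal_add,
        add_sub_cancel, Complex.ofReal_mul, Complex.ofReal_ofNat, Complex.exp_two_pi_mul_I,
        mul_one]
    rw [← h3, hxy]
    field_simp
    simp
  have h4 := h 0 j _ 0 x y hc le_rfl hx hy heq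
  have h5 : j = 0 := by
    have h6 := congrArg ZMod.val h4
    rw [ZMod.val_zero, ZMod.val_natCast_of_lt hjn] at h6
    exact h6.symm
  subst h5
  have h7 := arg_lt_pi_of_im_pos (hw ((0 : ℕ) : ZMod n))
  rw [h0] at h1
  linarith

omit hw in
theorem eq_norm_mul_exp {z : ℂ} {s θ : ℝ} (hs : 0 < s)
    (h : z = s * Complex.exp (θ * Complex.I)) :
    z ≠ 0 ∧ z = (‖z‖ : ℂ) * Complex.exp (θ * Complex.I) := by
  have h1 : ‖z‖ = s := by
    rw [h, norm_mul, Complex.norm_exp_ofReal_mul_I, Complex.norm_of_nonneg hs.le, mul_one]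
  exact ⟨norm_pos_iff.1 (h1 ▸ hs), by rw [h1]; exact h⟩

/-- The argument along a polygon. -/
noncomputable def polygonArg (w : ZMod n → ℂ) (t : ℝ) : ℝ :=
  Complex.arg (w 0) + ∑ j ∈ Finset.range n,
    Complex.arg ((1 - (max 0 (min 1 (t - j)) : ℝ)) +
      (max 0 (min 1 (t - j)) : ℝ) * (w ((j : ZMod n) + 1) / w (j : ZMod n)))

/-- The clamped parameter lets the summand number `j` grow from `0` to its full angle on `[j, j +
1]` and stay constant elsewhere. It never reaches the cut of `arg`: its argument is `1` or has
positive imaginary part. -/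
theorem continuous_polygonArg : Continuous (polygonArg w) := by
  refine continuous_const.add (continuous_finsetSum _ fun j _ => ?_)
  have hc : Continuous fun t : ℝ => ((1 - (max 0 (min 1 (t - j)) : ℝ)) +
      (max 0 (min 1 (t - j)) : ℝ) * (w ((j : ZMod n) + 1) / w (j : ZMod n)) : ℂ) := by
    fun_prop
  refine continuous_iff_continuousAt.2 fun t => ?_
  refine (Complex.continuousAt_arg ?_).comp hc.continuousAt
  rcases (le_max_left 0 (min 1 (t - j))).eq_or_lt with h | h
  · rw [← h]
    simp
  · refine Complex.mem_slitPlane_iff.2 (Or.inr ?_)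
    have : 0 < max 0 (min 1 (t - j)) * (w ((j : ZMod n) + 1) / w (j : ZMod n)).im :=
      mul_pos h (hw j)
    simp only [Complex.add_im, Complex.sub_im, Complex.one_im, Complex.ofReal_im,
      Complex.im_ofReal_mul]
    linarith

omit hw in
theorem polygonArg_eq {t : ℝ} {k : ℕ} (h1 : (k : ℝ) ≤ t) (h2 : t < k + 1) (hk : k < n) :
    polygonArg w t = Complex.arg (w 0) + angleSum w k +
      Complex.arg ((1 - (t - k : ℝ)) + (t - k : ℝ) *
        (w ((k : ZMod n) + 1) / w (k : ZMod n))) := by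
  have hsum : ∀ f : ℕ → ℝ, (∀ j, k < j → f j = 0) →
      ∑ j ∈ Finset.range n, f j = ∑ j ∈ Finset.range k, f j + f k := by
    intro f hf
    rw [← Finset.sum_range_succ]
    refine (Finset.sum_subset (Finset.range_subset_range.2 hk) fun j _ hj => hf j ?_).symm
    simpa using hj
  rw [polygonArg, hsum, ← add_assoc, angleSum]
  · rw [min_eq_right (show t - k ≤ 1 by linarith), max_eq_right (show 0 ≤ t - k by linarith)]
    congr 2
    refine Finset.sum_congr rfl fun j hj => ?_
    have : ((j : ℝ) + 1) ≤ k := by exact_mod_cast Finset.mem_range.1 hj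
    rw [min_eq_left (by linarith), max_eq_right zero_le_one]
    simp
  · intro j hj
    have : (k : ℝ) + 1 ≤ j := by exact_mod_cast hj
    rw [min_eq_right (by linarith), max_eq_left (by linarith)]
    simp

omit hw in
theorem polygonArg_natCast : polygonArg w n = Complex.arg (w 0) + angleSum w n := by
  rw [polygonArg, angleSum]
  congr 1
  refine Finset.sum_congr rfl fun j hj => ?_
  have : ((j : ℝ) + 1) ≤ n := by exact_mod_cast Finset.mem_range.1 hj
  rw [min_eq_left (by linarith), max_eq_right zero_le_one]
  simp

omit hw in
theorem polygon_natCast_add (k : ℕ) {t : ℝ} (h1 : (k : ℝ) ≤ t) (h2 : t < k + 1) :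
    polygon w t = (1 - (t - k) : ℝ) * w (k : ZMod n) + (t - k : ℝ) * w ((k : ZMod n) + 1) := by
  have hfl : ⌊t⌋ = (k : ℤ) := Int.floor_eq_iff.2 ⟨by simpa using h1, by simpa using h2⟩
  rw [polygon, Int.fract, hfl]
  simp

theorem polygon_eq {t : ℝ} (ht : t ∈ Set.Icc (0 : ℝ) n) : polygon w t ≠ 0 ∧
    polygon w t = (‖polygon w t‖ : ℂ) * Complex.exp (polygonArg w t * Complex.I) := by
  have h0 := ne_zero_of_im_div_pos hw 0
  -- At `t = n` the floor has moved on to the index `n`, which is `0` in `ZMod n`, so the formula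
  -- for sectors `k < n` does not apply.
  rcases ht.2.eq_or_lt with rfl | htn
  · refine eq_norm_mul_exp (norm_pos_iff.2 h0) ?_
    rw [polygon_natCast_add n le_rfl (by linarith), polygonArg_natCast]
    have h := eq_mul_exp_angleSum hw n
    rw [ZMod.natCast_self, div_self (norm_ne_zero_iff.2 h0)] at h
    push_cast
    rw [add_mul, Complex.exp_add, ← mul_assoc, Complex.norm_mul_exp_arg_mul_I]
    simpa using h
  · obtain ⟨k, hk⟩ : ∃ k : ℕ, k = ⌊t⌋₊ := ⟨_, rfl⟩
    have h1 : (k : ℝ) ≤ t := hk ▸ Nat.floor_le ht.1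
    have h2 : t < k + 1 := hk ▸ Nat.lt_floor_add_one t
    have hkn : k < n := by exact_mod_cast h1.trans_lt htn
    have hwk := ne_zero_of_im_div_pos hw (k : ZMod n)
    rw [polygonArg_eq h1 h2 hkn]
    obtain ⟨hz, -, -⟩ := arg_add_mul_mem (hw k) (x := 1 - (t - k)) (y := t - k)
      (by linarith) (by linarith)
    have hcast : ((1 - (t - k) : ℝ) : ℂ) = 1 - (t - k : ℝ) := by push_cast; ring
    rw [hcast] at hz
    set z : ℂ := (1 - (t - k : ℝ)) + (t - k : ℝ) *
        (w ((k : ZMod n) + 1) / w (k : ZMod n)) with hzdef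
    refine eq_norm_mul_exp (s := ‖w (k : ZMod n)‖ * ‖z‖)
      (mul_pos (norm_pos_iff.2 hwk) (norm_pos_iff.2 hz)) ?_
    calc polygon w t = w (k : ZMod n) * z := by
          rw [polygon_natCast_add k h1 h2, hzdef, hcast]
          field_simp
      _ = ((‖w (k : ZMod n)‖ / ‖w 0‖ : ℝ) * (‖w 0‖ * Complex.exp
            (Complex.arg (w 0) * Complex.I)) * Complex.exp (angleSum w k * Complex.I)) *
          (‖z‖ * Complex.exp (Complex.arg z * Complex.I)) := by
          rw [Complex.norm_mul_exp_arg_mul_I, Complex.norm_mul_exp_arg_mul_I,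
            ← eq_mul_exp_angleSum hw]
      _ = _ := by
          have : ((‖w 0‖ : ℝ) : ℂ) ≠ 0 := Complex.ofReal_ne_zero.2 (norm_ne_zero_iff.2 h0)
          push_cast
          rw [add_mul, add_mul, Complex.exp_add, Complex.exp_add]
          field_simp

omit hw in
theorem polygonArg_zero : polygonArg w 0 = Complex.arg (w 0) := by
  rw [polygonArg, add_eq_left]
  refine Finset.sum_eq_zero fun j _ => ?_
  have : (0 : ℝ) ≤ j := Nat.cast_nonneg j
  rw [min_eq_right (by linarith), max_eq_left (by linarith)]
  simp

theorem hasWindingNumber_of_angleSum_eq {m : ℤ} (h : angleSum w n = 2 * Real.pi * m) :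
    HasWindingNumber w m :=
  ⟨polygonArg w, continuous_polygonArg hw, fun _ ht => polygon_eq hw ht, by
    rw [polygonArg_natCast, polygonArg_zero, h]
    ring⟩

/-- Two continuous arguments along the same loop differ by a continuous function with values in the
multiples of `2π`, which is constant on the interval. -/
theorem angleSum_eq_of_hasWindingNumber {m : ℤ} (h : HasWindingNumber w m) :
    angleSum w n = 2 * Real.pi * m := by
  obtain ⟨θ, hθ, hpol, hm⟩ := h
  have hpi := Real.pi_pos
  have hn : (0 : ℝ) ≤ n := Nat.cast_nonneg n
  have hdisc : DiscreteTopology (Set.range ((↑) : ℤ → ℝ)) :=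
    Int.isClosedEmbedding_coe_real.isEmbedding.toHomeomorph.symm.isEmbedding.discreteTopology
  have hconst := (isPreconnected_Icc (a := (0 : ℝ)) (b := n)).constant_of_mapsTo
    (T := Set.range ((↑) : ℤ → ℝ)) (f := fun t => (θ t - polygonArg w t) / (2 * Real.pi)) ?_ ?_ ?_
    (Set.left_mem_Icc.2 hn) (Set.right_mem_Icc.2 hn)
  · rw [polygonArg_natCast, polygonArg_zero] at hconst
    field_simp at hconst
    linarith
  · exact isDiscrete_iff_discreteTopology.2 hdisc
  · exact ((hθ.sub (continuous_polygonArg hw)).div_const _).continuousOn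
  · intro t ht
    obtain ⟨h1, h2⟩ := polygon_eq hw ht
    obtain ⟨k, hk⟩ := exists_int_of_mul_exp_eq (norm_pos_iff.2 h1) (norm_pos_iff.2 h1)
      ((hpol t ht).2.symm.trans h2)
    refine ⟨k, ?_⟩
    beta_reduce
    rw [hk]
    field_simp
    ring

theorem hasWindingNumber_one_of_sectorsDisjoint [NeZero n] (h : SectorsDisjoint w) :
    HasWindingNumber w 1 :=
  hasWindingNumber_of_angleSum_eq hw (by simp [angleSum_eq_of_sectorsDisjoint hw h])

/-- Since all turning angles are positive here, winding number `-1` is impossible. -/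
theorem sectorsDisjoint_of_hasWindingNumber [NeZero n]
    (h : HasWindingNumber w 1 ∨ HasWindingNumber w (-1)) : SectorsDisjoint w := by
  rcases h with h | h
  · exact sectorsDisjoint_of_angleSum_eq hw (by simpa using angleSum_eq_of_hasWindingNumber hw h)
  · have h1 := angleSum_eq_of_hasWindingNumber hw h
    have h2 := strictMono_angleSum hw (NeZero.pos n)
    have h3 : angleSum w 0 = 0 := by simp [angleSum]
    have hpi := Real.pi_pos
    rw [h1, h3] at h2
    push_cast at h2
    linarith

omit hw in
theorem HasWindingNumber.conj {m : ℤ} (h : HasWindingNumber w m) :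
    HasWindingNumber (fun i => starRingEnd ℂ (w i)) (-m) := by
  obtain ⟨θ, hθ, hpol, hm⟩ := h
  have hconj : ∀ t, polygon (fun i => starRingEnd ℂ (w i)) t = starRingEnd ℂ (polygon w t) := by
    intro t
    simp only [polygon, map_add, map_mul, Complex.conj_ofReal]
  refine ⟨fun t => -θ t, hθ.neg, fun t ht => ?_, by push_cast; linarith⟩
  obtain ⟨h1, h2⟩ := hpol t ht
  rw [hconj]
  refine ⟨(map_ne_zero _).2 h1, ?_⟩
  conv_lhs => rw [h2]
  rw [map_mul, Complex.conj_ofReal, ← Complex.exp_conj, RCLike.norm_conj, map_mul,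
    Complex.conj_ofReal, Complex.conj_I]
  push_cast
  ring_nf

end Planar

end SimplicialFan

namespace SimplicialFan

open Filter Topology

/-! ### Simple elementary cycles and injectivity around codimension two -/

section ElementaryCycles

theorem im_div_neg_iff {z w : ℂ} : (z / w).im < 0 ↔ 0 < (w / z).im := by
  rw [← inv_div w z, Complex.inv_im, neg_div, neg_lt_zero]
  constructor
  · intro h
    by_contra hle
    exact absurd h (not_lt.2 (div_nonpos_of_nonpos_of_nonneg (not_lt.1 hle)
      (Complex.normSq_nonneg _)))
  · intro h
    refine div_pos h (Complex.normSq_pos.2 fun h0 => ?_)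
    rw [h0] at h
    simp at h

theorem forall_zmod_of_succ {n : ℕ} [NeZero n] {p : ZMod n → Prop} (h0 : p 0)
    (hs : ∀ i, p i → p (i + 1)) (i : ZMod n) : p i := by
  rw [← ZMod.natCast_zmod_val i]
  induction i.val with
  | zero => simpa using h0
  | succ k ih => simpa using hs _ ih

variable {V : Type*} [DecidableEq V] {D n : ℕ} {v : V → EuclideanSpace ℝ (Fin D)}
  {F G K σ τ ρ : Finset V} {Δ : PreAbstractSimplicialComplex V} {x x' : V → ℝ}
  {p q y : EuclideanSpace ℝ (Fin D)} {a b d : V} {c : ZMod n → V}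

theorem eq_of_insert_eq_insert (ha : a ∉ τ) (h : insert a τ = insert b τ) : a = b :=
  (Finset.mem_insert.1 (h ▸ Finset.mem_insert_self a τ)).resolve_right ha

namespace IsElementaryCycle

variable (hc : IsElementaryCycle Δ ρ n c)
include hc

theorem natCast_ne_zero {k : ℕ} (h0 : 0 < k) (h : k < 3) : (k : ZMod n) ≠ 0 := by
  rw [Ne, ZMod.natCast_eq_zero_iff]
  intro hdvd
  have := Nat.le_of_dvd h0 hdvd
  have := hc.1
  omega

theorem succ_ne (i : ZMod n) : c (i + 1) ≠ c i := fun h => by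
  have := hc.natCast_ne_zero (k := 1) (by norm_num) (by norm_num)
  have h2 := hc.2.1 h
  rw [add_eq_left] at h2
  exact this (by rw [Nat.cast_one]; exact h2)

theorem succ_succ_ne (i : ZMod n) : c (i + 1 + 1) ≠ c i := fun h => by
  have h1 := hc.natCast_ne_zero (k := 2) (by norm_num) (by norm_num)
  have h2 := hc.2.1 h
  rw [add_assoc, add_eq_left] at h2
  apply h1
  rw [← h2]
  norm_num

theorem notMem (i : ZMod n) : c i ∉ ρ :=
  Finset.disjoint_singleton_left.1 ((hc.2.2 {c i}).2 (Or.inr (Or.inl ⟨i, rfl⟩))).2.1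

theorem isFace_insert (i : ZMod n) : IsFace Δ (insert (c i) ρ) :=
  ((hc.2.2 {c i}).2 (Or.inr (Or.inl ⟨i, rfl⟩))).2.2

theorem isRidge_insert (hρ : IsCodimTwo Δ D ρ) (i : ZMod n) : IsRidge Δ D (insert (c i) ρ) :=
  ⟨hc.isFace_insert i, by rw [Finset.card_insert_of_notMem (hc.notMem i)]; exact hρ.2⟩

theorem succ_notMem (i : ZMod n) : c (i + 1) ∉ insert (c i) ρ := fun h =>
  (Finset.mem_insert.1 h).elim (hc.succ_ne i) (hc.notMem _)

theorem notMem_succ (i : ZMod n) : c i ∉ insert (c (i + 1)) ρ := fun h =>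
  (Finset.mem_insert.1 h).elim (hc.succ_ne i).symm (hc.notMem _)

theorem isFacet [Finite V] (hpure : IsPure Δ D) (hρ : IsCodimTwo Δ D ρ) (i : ZMod n) :
    IsFacet Δ (insert (c (i + 1)) (insert (c i) ρ)) := by
  have h := ((hc.2.2 {c i, c (i + 1)}).2 (Or.inr (Or.inr ⟨i, rfl⟩))).2.2
  have h2 : ({c i, c (i + 1)} : Finset V) ∪ ρ = insert (c (i + 1)) (insert (c i) ρ) := by
    ext
    simp only [Finset.mem_union, Finset.mem_insert, Finset.mem_singleton]
    tauto
  rw [h2] at h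
  refine h.isFacet_of_card hpure ?_
  rw [Finset.card_insert_of_notMem (hc.succ_notMem i),
    Finset.card_insert_of_notMem (hc.notMem i)]
  exact hρ.2

theorem exists_eq (hpure : IsPure Δ D) (hρ : IsCodimTwo Δ D ρ) (hσ : IsFacet Δ σ)
    (hρσ : ρ ⊆ σ) : ∃ i, σ = insert (c (i + 1)) (insert (c i) ρ) := by
  have hcard : (σ \ ρ).card = 2 := by
    rw [Finset.card_sdiff_of_subset hρσ, hpure σ hσ]
    have := hρ.2
    omega
  have hmem : σ \ ρ ∈ link Δ ρ := ⟨hσ.isFace.subset Finset.sdiff_subset,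
    Finset.sdiff_disjoint, by rw [Finset.sdiff_union_of_subset hρσ]; exact hσ.isFace⟩
  rcases (hc.2.2 _).1 hmem with h | ⟨i, h⟩ | ⟨i, h⟩
  · simp [h] at hcard
  · simp [h] at hcard
  · refine ⟨i, ?_⟩
    rw [← Finset.sdiff_union_of_subset hρσ, h]
    ext
    simp only [Finset.mem_union, Finset.mem_insert, Finset.mem_singleton]
    tauto

end IsElementaryCycle

/-- A linear functional that measures on which side of the line through `z` the image under `P`
lies. -/
noncomputable def sideMap (P : EuclideanSpace ℝ (Fin D) →ₗ[ℝ] ℂ) (z : ℂ) :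
    EuclideanSpace ℝ (Fin D) →ₗ[ℝ] ℝ :=
  Complex.imLm ∘ₗ LinearMap.mulLeft ℝ z⁻¹ ∘ₗ P

omit [DecidableEq V] in
theorem sideMap_apply (P : EuclideanSpace ℝ (Fin D) →ₗ[ℝ] ℂ) (z : ℂ)
    (u : EuclideanSpace ℝ (Fin D)) : sideMap P z u = (P u / z).im := by
  simp [sideMap, div_eq_inv_mul]

variable {P : EuclideanSpace ℝ (Fin D) →ₗ[ℝ] ℂ}

theorem sideMap_eq_zero (hP : LinearMap.ker P = lin v ρ) :
    ∀ i ∈ insert d ρ, sideMap P (P (v d)) (v i) = 0 := by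
  intro i hi
  rw [sideMap_apply]
  rcases Finset.mem_insert.1 hi with rfl | hi
  · rcases eq_or_ne (P (v i)) 0 with h | h <;> simp [h]
  · have : v i ∈ LinearMap.ker P := hP ▸ Submodule.subset_span (Set.mem_image_of_mem v hi)
    rw [LinearMap.mem_ker.1 this]
    simp

variable [Fintype V] (hpure : IsPure Δ D) (hv : IsPreEmbedding Δ v)
include hpure hv

/-- The vectors at `a` and `d` are independent modulo the span of `ρ`, so their images in the plane
cannot have a real ratio. -/
theorem im_div_ne_zero (hP : LinearMap.ker P = lin v ρ) (hσ : IsFacet Δ (insert a (insert d ρ)))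
    (hd : d ∉ ρ) (ha : a ∉ insert d ρ) : (P (v a) / P (v d)).im ≠ 0 := by
  have had : a ≠ d := fun h => ha (h ▸ Finset.mem_insert_self _ _)
  have haρ : a ∉ ρ := fun h => ha (Finset.mem_insert_of_mem h)
  have hind : ∀ s t : ℝ, s • P (v d) + t • P (v a) = 0 → s = 0 ∧ t = 0 := by
    intro s t h
    have hmem : s • v d + t • v a ∈ lin v ρ := by
      rw [← hP, LinearMap.mem_ker, map_add, map_smul, map_smul, h]
    have hx : comb v (Pi.single d s + Pi.single a t) = s • v d + t • v a := by
      rw [map_add, comb_single, comb_single]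
    have hsupp : ∀ i ∉ insert a (insert d ρ), (Pi.single d s + Pi.single a t : V → ℝ) i = 0 := by
      intro i hi
      simp only [Finset.mem_insert, not_or] at hi
      simp [hi.1, hi.2.1]
    rw [hσ.mem_lin_iff_coords hpure hv ((Finset.subset_insert _ _).trans
      (Finset.subset_insert _ _)), ← hx, hσ.coords_comb hpure hv hsupp] at hmem
    exact ⟨by simpa [had.symm] using hmem d hd, by simpa [had] using hmem a haρ⟩
  have hd0 : P (v d) ≠ 0 := fun h => one_ne_zero (hind 1 0 (by simp [h])).1
  intro him
  have hre : P (v a) / P (v d) = ((P (v a) / P (v d)).re : ℂ) :=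
    Complex.ext (by simp) (by simp [him])
  refine one_ne_zero (hind (-(P (v a) / P (v d)).re) 1 ?_).2
  rw [neg_smul, one_smul, Complex.real_smul, ← hre, div_mul_cancel₀ _ hd0, neg_add_cancel]

variable (hI : HasICoP Δ v)
include hI

/-- On different sides of a ridge, linear functionals vanishing on the ridge have different
signs. -/
theorem HasICoP.exists_neg_mul (hτ : IsRidge Δ D τ) (hab : a ≠ b) (ha : a ∉ τ) (hb : b ∉ τ)
    (hσa : IsFacet Δ (insert a τ)) (hσb : IsFacet Δ (insert b τ)) :
    (∃ t < 0, ∀ g : EuclideanSpace ℝ (Fin D) →ₗ[ℝ] ℝ, (∀ i ∈ τ, g (v i) = 0) →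
      g (v b) = t * g (v a)) ∧
    ∀ d, d ∉ τ → IsFacet Δ (insert d τ) → d = a ∨ d = b := by
  obtain ⟨a', b', hab', ha', hb', hfac, f, hf, hfa, hfb⟩ := hI τ hτ
  have hcl : ∀ d, d ∉ τ → IsFacet Δ (insert d τ) → d = a' ∨ d = b' := fun d hd hσ =>
    ((hfac _).1 ⟨hσ, Finset.subset_insert _ _⟩).imp (eq_of_insert_eq_insert hd)
      (eq_of_insert_eq_insert hd)
  constructor
  · refine ⟨coords v (insert a τ) (v b) a, ?_, fun g hg => hσa.apply_eq hpure hv ha hg (v b)⟩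
    have h := hσa.apply_eq hpure hv ha hf (v b)
    rcases hcl a ha hσa with rfl | rfl <;> rcases hcl b hb hσb with rfl | rfl
    · exact absurd rfl hab
    · by_contra hle
      push Not at hle
      have := mul_nonneg hle hfa.le
      linarith
    · by_contra hle
      push Not at hle
      have := mul_nonpos_of_nonneg_of_nonpos hle hfb.le
      linarith
    · exact absurd rfl hab
  · intro d hd hσ
    rcases hcl a ha hσa with rfl | rfl <;> rcases hcl b hb hσb with rfl | rfl <;>
      rcases hcl d hd hσ with rfl | rfl <;> simp_all

/-- ICoP at the ridge through `c (i + 1)` puts `c i` and `c (i + 1 + 1)` on opposite sides, so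
successive turns have the same sense. -/
theorem IsElementaryCycle.im_div_pos_iff (hc : IsElementaryCycle Δ ρ n c)
    (hρ : IsCodimTwo Δ D ρ) (hP : LinearMap.ker P = lin v ρ) (i : ZMod n) :
    0 < (P (v (c (i + 1 + 1))) / P (v (c (i + 1)))).im ↔
      0 < (P (v (c (i + 1))) / P (v (c i))).im := by
  have h2 := hc.isFacet hpure hρ i
  rw [Finset.insert_comm] at h2
  obtain ⟨⟨t, ht, hg⟩, -⟩ := hI.exists_neg_mul hpure hv (hc.isRidge_insert hρ (i + 1))
    (hc.succ_succ_ne i) (hc.succ_notMem (i + 1)) (hc.notMem_succ i) (hc.isFacet hpure hρ (i + 1)) h2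
  have h3 := hg _ (sideMap_eq_zero hP)
  rw [sideMap_apply, sideMap_apply] at h3
  rw [← im_div_neg_iff (z := P (v (c i))), h3]
  constructor
  · exact fun h => mul_neg_of_neg_of_pos ht h
  · exact fun h => pos_of_mul_neg_right h ht.le

/-- The contraction of an elementary cycle winds consistently. -/
theorem IsElementaryCycle.im_div_pos_or_neg (hc : IsElementaryCycle Δ ρ n c)
    (hρ : IsCodimTwo Δ D ρ) (hP : LinearMap.ker P = lin v ρ) :
    (∀ i, 0 < (P (v (c (i + 1))) / P (v (c i))).im) ∨
      ∀ i, (P (v (c (i + 1))) / P (v (c i))).im < 0 := by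
  have : NeZero n := ⟨by have := hc.1; omega⟩
  by_cases h : 0 < (P (v (c (0 + 1))) / P (v (c 0))).im
  · exact Or.inl (forall_zmod_of_succ h fun i hi =>
      (hc.im_div_pos_iff hpure hv hI hρ hP i).2 hi)
  · refine Or.inr fun i => lt_of_le_of_ne (not_lt.1 (forall_zmod_of_succ
      (p := fun i => ¬ 0 < (P (v (c (i + 1))) / P (v (c i))).im) h (fun i hi h' => hi
        ((hc.im_div_pos_iff hpure hv hI hρ hP i).1 h')) i)) ?_
    exact im_div_ne_zero hpure hv hP (hc.isFacet hpure hρ i) (hc.notMem i) (hc.succ_notMem i)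

omit hpure hv hI [DecidableEq V] [Fintype V] in
theorem sectorsDisjoint_conj {w : ZMod n → ℂ}
    (h : SectorsDisjoint fun i => starRingEnd ℂ (w i)) : SectorsDisjoint w := by
  intro i j x y x' y' hx hy hx' hy' heq
  refine h i j x y x' y' hx hy hx' hy' ?_
  have := congrArg (starRingEnd ℂ) heq
  simpa only [map_add, map_mul, Complex.conj_ofReal] using this

omit hpure hv hI [DecidableEq V] [Fintype V] in
theorem im_conj_div_conj (z w : ℂ) :
    (starRingEnd ℂ z / starRingEnd ℂ w).im = -(z / w).im := by
  rw [← map_div₀, Complex.conj_im]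

-- The image in the plane of a generic point of a facet cone around `ρ` lies in the sector of that
-- facet, so disjoint sectors separate the facets.
omit hv hI in
theorem starInjective_of_sectorsDisjoint (hv : IsPreEmbedding Δ v)
    (hc : IsElementaryCycle Δ ρ n c) (hρ : IsCodimTwo Δ D ρ) (hP : LinearMap.ker P = lin v ρ)
    (hs : SectorsDisjoint fun i => P (v (c i))) : StarInjective Δ v ρ := by
  have key : ∀ i y, IsGeneric Δ v y → y ∈ cone v (insert (c (i + 1)) (insert (c i) ρ)) →
      ∃ x x' : ℝ, 0 < x ∧ 0 < x' ∧ P y = x * P (v (c i)) + x' * P (v (c (i + 1))) := by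
    intro i y hy hyσ
    have hσ := hc.isFacet hpure hρ i
    refine ⟨coords v _ y (c i), coords v _ y (c (i + 1)), hy.coords_pos hpure hv hσ hyσ
      (by simp), hy.coords_pos hpure hv hσ hyσ (by simp), ?_⟩
    have h0 : P (∑ j ∈ ρ, coords v (insert (c (i + 1)) (insert (c i) ρ)) y j • v j) = 0 := by
      rw [← LinearMap.mem_ker, hP]
      exact sum_mem fun j hj =>
        Submodule.smul_mem _ _ (Submodule.subset_span (Set.mem_image_of_mem v hj))
    conv_lhs => rw [← hσ.comb_coords hpure hv y,
      comb_eq_sum fun i hi => hσ.coords_eq_zero hpure hv y hi]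
    rw [Finset.sum_insert (hc.succ_notMem i), Finset.sum_insert (hc.notMem i), map_add, map_add,
      map_smul, map_smul, h0, add_zero, Complex.real_smul, Complex.real_smul, add_comm]
  intro σ σ' hσ hσ' hρσ hρσ' y hy h1 h2
  obtain ⟨i, rfl⟩ := hc.exists_eq hpure hρ hσ hρσ
  obtain ⟨j, rfl⟩ := hc.exists_eq hpure hρ hσ' hρσ'
  obtain ⟨x, x', hx, hx', hi⟩ := key i y hy h1
  obtain ⟨z, z', hz, hz', hj⟩ := key j y hy h2
  rw [hs i j x x' z z' hx hx'.le hz hz'.le (hi.symm.trans hj)]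

/-- The plane results assume positive turns; a polygon turning the other way is reflected by
conjugation, which also negates its winding number. -/
theorem IsSimpleCycle.starInjective (hc : IsElementaryCycle Δ ρ n c) (hρ : IsCodimTwo Δ D ρ)
    (hs : IsSimpleCycle v ρ c) : StarInjective Δ v ρ := by
  have : NeZero n := ⟨by have := hc.1; omega⟩
  obtain ⟨L, hL⟩ := hs
  let P : EuclideanSpace ℝ (Fin D) →ₗ[ℝ] ℂ := L.toLinearMap ∘ₗ (lin v ρ).mkQ
  have hP : LinearMap.ker P = lin v ρ := by
    rw [LinearEquiv.ker_comp, Submodule.ker_mkQ]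
  refine starInjective_of_sectorsDisjoint hpure hv hc hρ hP ?_
  rcases hc.im_div_pos_or_neg hpure hv hI hρ hP with h | h
  · exact sectorsDisjoint_of_hasWindingNumber h hL
  · refine sectorsDisjoint_conj (sectorsDisjoint_of_hasWindingNumber (fun i => ?_) ?_)
    · rw [im_conj_div_conj]
      exact neg_pos.2 (h i)
    · rcases hL with hL | hL
      · exact Or.inr hL.conj
      · have h1 := hL.conj
        rw [neg_neg] at h1
        exact Or.inl h1

omit hI hpure [DecidableEq V] [Fintype V] in
theorem IsCodimTwo.exists_linearEquiv [Finite V] (hρ : IsCodimTwo Δ D ρ) :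
    Nonempty ((EuclideanSpace ℝ (Fin D) ⧸ lin v ρ) ≃ₗ[ℝ] ℂ) := by
  refine ⟨LinearEquiv.ofFinrankEq _ _ ?_⟩
  have h1 := (lin v ρ).finrank_quotient_add_finrank
  rw [finrank_lin hv hρ.1, finrank_euclideanSpace_fin] at h1
  rw [Complex.finrank_real_complex]
  have := hρ.2
  omega

theorem IsElementaryCycle.sectorsDisjoint (hc : IsElementaryCycle Δ ρ n c)
    (hρ : IsCodimTwo Δ D ρ) (hP : LinearMap.ker P = lin v ρ) (hinj : StarInjective Δ v ∅) :
    SectorsDisjoint fun i => P (v (c i)) := by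
  intro i j x y x' y' hx hy hx' hy' heq
  have hmem : (x • v (c i) + y • v (c (i + 1))) - (x' • v (c j) + y' • v (c (j + 1))) ∈
      lin v ρ := by
    rw [← hP, LinearMap.mem_ker, map_sub, sub_eq_zero]
    simpa only [map_add, map_smul, Complex.real_smul] using heq
  obtain ⟨r, hr, hr'⟩ := mem_lin_iff.1 hmem
  have hface : ∀ (k : ZMod n) (s t : ℝ) (e : V → ℝ), 0 ≤ s → 0 ≤ t → (∀ m, 0 ≤ e m) →
      (∀ m ∉ ρ, e m = 0) →
      Pi.single (c k) s + Pi.single (c (k + 1)) t + e ∈ coneComplex Δ := by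
    intro k s t e hs ht he he'
    refine mem_coneComplex_of_subset (hc.isFacet hpure hρ k).isFace (fun m => ?_) fun m hm => ?_
    · have h1 : (0 : V → ℝ) ≤ Pi.single (c k) s := Pi.single_nonneg.2 hs
      have h2 : (0 : V → ℝ) ≤ Pi.single (c (k + 1)) t := Pi.single_nonneg.2 ht
      exact add_nonneg (add_nonneg (h1 m) (h2 m)) (he m)
    · simp only [Finset.mem_insert, not_or] at hm
      simp [hm.1, hm.2.1, he' m hm.2.2]
  -- Equality in the plane is equality up to a combination `r` of the vectors of `ρ` with arbitrary
  -- signs. Adding `|r|` on one side and `|r| + r` on the other turns it into an equality of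
  -- nonnegative combinations.
  have heqx := hinj.eq_of_comb_eq hpure hv hI
    (hface i x y (fun m => |r m|) hx.le hy (fun m => abs_nonneg _) fun m hm => by simp [hr m hm])
    (hface j x' y' (fun m => |r m| + r m) hx'.le hy'
      (fun m => by linarith [neg_abs_le (r m)]) fun m hm => by simp [hr m hm])
    (Finset.empty_subset _) (Finset.empty_subset _) (by
      have : (fun m => |r m| + r m) = (fun m => |r m|) + r := rfl
      rw [this, map_add, map_add, map_add, map_add, map_add, hr', comb_single, comb_single,
        comb_single, comb_single]
      abel)
  by_contra hij
  have hcij : c i ≠ c j := fun h => hij (hc.2.1 h)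
  have hi := congrFun heqx (c i)
  have hj := congrFun heqx (c j)
  simp only [Pi.add_apply, hr _ (hc.notMem _), Pi.single_eq_same, abs_zero, add_zero,
    Pi.single_eq_of_ne (hc.succ_ne _).symm, Pi.single_eq_of_ne hcij,
    Pi.single_eq_of_ne hcij.symm, zero_add] at hi hj
  -- The positive coefficients at `c i` and `c j` must occur on both sides; for `i ≠ j` each index
  -- would be the successor of the other, impossible in a cycle of length at least three.
  have h1 : c i = c (j + 1) := by
    by_contra h
    rw [Pi.single_eq_of_ne h] at hi
    exact hx.ne' hi
  have h2 : c j = c (i + 1) := by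
    by_contra h
    rw [Pi.single_eq_of_ne h] at hj
    exact hx'.ne hj
  have h3 := hc.2.1 h2
  rw [h3] at h1
  exact hc.succ_succ_ne i h1.symm

theorem IsElementaryCycle.isSimpleCycle (hc : IsElementaryCycle Δ ρ n c)
    (hρ : IsCodimTwo Δ D ρ) (hinj : StarInjective Δ v ∅) : IsSimpleCycle v ρ c := by
  have : NeZero n := ⟨by have := hc.1; omega⟩
  obtain ⟨L⟩ := hρ.exists_linearEquiv hv
  have hP : ∀ L : (EuclideanSpace ℝ (Fin D) ⧸ lin v ρ) ≃ₗ[ℝ] ℂ,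
      LinearMap.ker (L.toLinearMap ∘ₗ (lin v ρ).mkQ) = lin v ρ := fun L => by
    rw [LinearEquiv.ker_comp, Submodule.ker_mkQ]
  rcases hc.im_div_pos_or_neg hpure hv hI hρ (hP L) with h | h
  · exact ⟨L, Or.inl (hasWindingNumber_one_of_sectorsDisjoint h
      (hc.sectorsDisjoint hpure hv hI hρ (hP L) hinj))⟩
  -- The identification with the plane may be chosen freely, so a clockwise cycle is made
  -- counterclockwise.
  · refine ⟨L.trans Complex.conjLIE.toLinearEquiv,
      Or.inl (hasWindingNumber_one_of_sectorsDisjoint (fun i => ?_)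
        (hc.sectorsDisjoint hpure hv hI hρ (hP (L.trans Complex.conjLIE.toLinearEquiv)) hinj))⟩
    change 0 < (starRingEnd ℂ (L _) / starRingEnd ℂ (L _)).im
    rw [im_conj_div_conj]
    exact neg_pos.2 (h i)

end ElementaryCycles

end SimplicialFan

/-! ### Links of codimension-two faces under unique covering -/

namespace SimplicialFan

open Filter Topology

theorem exists_zmod_orbit {X : Type*} [Finite X] {f : X → X} (hf : Function.Injective f) (x : X) :
    ∃ (n : ℕ) (_ : NeZero n) (c : ZMod n → X), Function.Injective c ∧ c 0 = x ∧
      ∀ i, c (i + 1) = f (c i) := by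
  have hn : 0 < Function.minimalPeriod f x :=
    Function.minimalPeriod_pos_of_mem_periodicPts (hf.mem_periodicPts x)
  have : NeZero (Function.minimalPeriod f x) := ⟨hn.ne'⟩
  refine ⟨Function.minimalPeriod f x, this, fun i => f^[i.val] x, fun i j h => ?_, by simp,
    fun i => ?_⟩
  · exact ZMod.val_injective _ (Function.iterate_injOn_Iio_minimalPeriod
      (ZMod.val_lt i) (ZMod.val_lt j) h)
  · change f^[(i + 1).val] x = f (f^[i.val] x)
    rw [← Function.iterate_succ_apply' f, ← Function.iterate_mod_minimalPeriod_eq (n := i.val + 1)]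
    congr 2
    rw [ZMod.val_add, ZMod.val_one_eq_one_mod, Nat.add_mod_mod]

section Links

variable {V : Type*} [DecidableEq V] {D n : ℕ} {v : V → EuclideanSpace ℝ (Fin D)}
  {F G K σ τ ρ : Finset V} {Δ : PreAbstractSimplicialComplex V}
  {p q y : EuclideanSpace ℝ (Fin D)} {a b d : V} {c : ZMod n → V}
  {P : EuclideanSpace ℝ (Fin D) →ₗ[ℝ] ℂ} [Fintype V] (hpure : IsPure Δ D)
  (hv : IsPreEmbedding Δ v) (hI : HasICoP Δ v)
include hpure hv hI

/-- Around a face of codimension two, every ridge has one neighbour in each direction. -/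
theorem HasICoP.exists_im_pos_im_neg (hP : LinearMap.ker P = lin v ρ) (hd : d ∉ ρ)
    (hτ : IsRidge Δ D (insert d ρ)) :
    ∃ a b, a ∉ insert d ρ ∧ b ∉ insert d ρ ∧ IsFacet Δ (insert a (insert d ρ)) ∧
      IsFacet Δ (insert b (insert d ρ)) ∧ 0 < (P (v a) / P (v d)).im ∧
      (P (v b) / P (v d)).im < 0 ∧
      ∀ e, e ∉ insert d ρ → IsFacet Δ (insert e (insert d ρ)) → e = a ∨ e = b := by
  obtain ⟨a, b, hab, ha, hb, hfac, -⟩ := hI _ hτ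
  have hσa := ((hfac _).2 (Or.inl rfl)).1
  have hσb := ((hfac _).2 (Or.inr rfl)).1
  obtain ⟨⟨t, ht, hg⟩, hall⟩ := hI.exists_neg_mul hpure hv hτ hab ha hb hσa hσb
  have h := hg _ (sideMap_eq_zero hP)
  rw [sideMap_apply, sideMap_apply] at h
  rcases lt_or_gt_of_ne (im_div_ne_zero hpure hv hP hσa hd ha) with h1 | h1
  · exact ⟨b, a, hb, ha, hσb, hσa, h ▸ mul_pos_of_neg_of_neg ht h1, h1,
      fun e he hσ => (hall e he hσ).symm⟩
  · exact ⟨a, b, ha, hb, hσa, hσb, h1, h ▸ mul_neg_of_neg_of_pos ht h1, hall⟩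

/-- Each vertex of the link has one neighbour counterclockwise and one clockwise, so passing to the
counterclockwise one is injective and its orbits are cycles. One orbit exhausts the link, because
its facets already cover a neighbourhood of an interior point of the cone of `ρ`, generically
without overlap with other facets. -/
theorem exists_isElementaryCycle (hu : ∀ y, IsGeneric Δ v y → InExactlyOneFacetCone Δ v y)
    (hρ : IsCodimTwo Δ D ρ) : ∃ (n : ℕ) (c : ZMod n → V), IsElementaryCycle Δ ρ n c := by
  obtain ⟨L⟩ := hρ.exists_linearEquiv hv
  obtain ⟨P, hP⟩ : ∃ P : EuclideanSpace ℝ (Fin D) →ₗ[ℝ] ℂ, LinearMap.ker P = lin v ρ :=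
    ⟨L.toLinearMap ∘ₗ (lin v ρ).mkQ, by rw [LinearEquiv.ker_comp, Submodule.ker_mkQ]⟩
  have hridge : ∀ d, d ∉ ρ → IsFace Δ (insert d ρ) → IsRidge Δ D (insert d ρ) := fun d hd hF =>
    ⟨hF, by rw [Finset.card_insert_of_notMem hd]; exact hρ.2⟩
  have hex := fun d : {d // d ∉ ρ ∧ IsFace Δ (insert d ρ)} =>
    hI.exists_im_pos_im_neg hpure hv hP d.2.1 (hridge d d.2.1 d.2.2)
  choose s s' hs hs' hσs hσs' hpos hneg hall using hex
  let f : {d // d ∉ ρ ∧ IsFace Δ (insert d ρ)} → {d // d ∉ ρ ∧ IsFace Δ (insert d ρ)} := fun d =>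
    ⟨s d, fun h => hs d (Finset.mem_insert_of_mem h),
      (hσs d).isFace.subset (Finset.insert_subset_insert _ (Finset.subset_insert _ _))⟩
  have hsd : ∀ d, s d ≠ d := fun d h => hs d (h ▸ Finset.mem_insert_self _ _)
  -- The clockwise step undoes the counterclockwise one: `d` is a neighbour of `s d`, and it cannot
  -- also be the counterclockwise one.
  have hsf : ∀ d, s' (f d) = d := by
    intro d
    have h1 : (d : V) ∉ insert (s d) ρ := fun h =>
      (Finset.mem_insert.1 h).elim (hsd d).symm d.2.1
    have h2 : IsFacet Δ (insert (d : V) (insert (s d) ρ)) := by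
      rw [Finset.insert_comm]
      exact hσs d
    rcases hall (f d) d h1 h2 with h | h
    · have h3 := hpos (f d)
      rw [← h] at h3
      exact absurd (im_div_neg_iff.2 (hpos d)) (not_lt.2 h3.le)
    · exact h.symm
  have hf : Function.Injective f := fun d d' h => Subtype.ext (by rw [← hsf d, h, hsf d'])
  obtain ⟨σ₀, hσ₀, hρσ₀⟩ := hρ.1.exists_isFacet
  obtain ⟨d₀, hd₀, hd₀ρ⟩ : ∃ d ∈ σ₀, d ∉ ρ := by
    by_contra! h
    have := Finset.card_le_card (show σ₀ ⊆ ρ from h)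
    have := hpure σ₀ hσ₀
    have := hρ.2
    omega
  obtain ⟨n, hn, c, hcinj, -, hc⟩ := exists_zmod_orbit hf
    ⟨d₀, hd₀ρ, hσ₀.isFace.subset (Finset.insert_subset hd₀ hρσ₀)⟩
  have hcs : ∀ i, (c (i + 1) : V) = s (c i) := fun i => by rw [hc]
  have hcs' : ∀ i, (c i : V) = s' (c (i + 1)) := fun i => by rw [hc, hsf]
  have hfac : ∀ i, IsFacet Δ (insert (c (i + 1) : V) (insert (c i : V) ρ)) := fun i => by
    rw [hcs]
    exact hσs _
  -- Length one would make a vertex its own neighbour; length two would put each of two vertices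
  -- counterclockwise from the other.
  have h3 : 3 ≤ n := by
    by_contra! h
    interval_cases n
    · exact absurd rfl hn.1
    · exact hsd (c 0) (by rw [← hcs]; congr 2)
    · have h1 := hpos (c 0)
      have h2 := hneg (c (0 + 1))
      have h2' := hpos (c (0 + 1))
      rw [← hcs] at h1 h2'
      have h4 : (0 + 1 + 1 : ZMod 2) = 0 := by decide
      rw [h4] at h2'
      exact absurd (im_div_neg_iff.2 h1) (not_lt.2 h2'.le)
  have hsurj : ∀ σ, IsFacet Δ σ → ρ ⊆ σ →
      ∃ i, σ = insert (c (i + 1) : V) (insert (c i : V) ρ) := by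
    intro σ hσ hρσ
    set S : Set (Finset V) := {σ | ∃ i, σ = insert (c (i + 1) : V) (insert (c i : V) ρ)} with hS
    have hSσ : ∀ σ ∈ S, IsFacet Δ σ ∧ ρ ⊆ σ := by
      rintro _ ⟨i, rfl⟩
      exact ⟨hfac i, (Finset.subset_insert _ _).trans (Finset.subset_insert _ _)⟩
    obtain ⟨ε, hε, hball⟩ := exists_ball_notMem_cone hpure hv (sum_mem_openCone (v := v) (F := ρ))
    set p := ∑ i ∈ ρ, v i
    have hpcone : ∀ σ, ρ ⊆ σ → p ∈ cone v σ := fun σ h =>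
      cone_mono h (openCone_subset_cone sum_mem_openCone)
    -- Near `p` only ridges containing `ρ` are met. Such a ridge of an orbit facet is `insert (c j)
    -- ρ`, and its two facets lead to the successor and the predecessor of `c j`.
    have hcl : ∀ σ ∈ S, ∀ τ ⊆ σ, IsRidge Δ D τ → (∃ q ∈ Metric.ball p ε, q ∈ openCone v τ) →
        ∀ σ', IsFacet Δ σ' → τ ⊆ σ' → σ' ∈ S := by
      rintro σ hσS τ hτσ hτ ⟨q, hq, hqτ⟩ σ' hσ' hτσ'
      have hρτ : ρ ⊆ τ := by
        by_contra h
        exact hball q hq τ ⟨σ, (hSσ σ hσS).1, (hSσ σ hσS).2, hτσ, h⟩ (openCone_subset_cone hqτ)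
      have hτ2 : ∃ j, τ = insert (c j : V) ρ := by
        obtain ⟨i, rfl⟩ := hσS
        obtain ⟨e, he, hτe⟩ : ∃ e, e ∉ ρ ∧ insert e ρ = τ := by
          have : (τ \ ρ).card = 1 := by
            rw [Finset.card_sdiff_of_subset hρτ]
            have := hτ.2
            have := hρ.2
            omega
          obtain ⟨e, he⟩ := Finset.card_eq_one.1 this
          refine ⟨e, (Finset.mem_sdiff.1 (he ▸ Finset.mem_singleton_self e)).2, ?_⟩
          rw [← Finset.sdiff_union_of_subset hρτ, he, Finset.insert_eq]
        have h1 := hτσ (hτe ▸ Finset.mem_insert_self e ρ)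
        simp only [Finset.mem_insert, he, or_false] at h1
        rcases h1 with rfl | rfl
        · exact ⟨_, hτe.symm⟩
        · exact ⟨_, hτe.symm⟩
      obtain ⟨j, rfl⟩ := hτ2
      obtain ⟨e, he, rfl⟩ : ∃ e, e ∉ insert (c j : V) ρ ∧ insert e (insert (c j : V) ρ) = σ' := by
        have : (σ' \ insert (c j : V) ρ).card = 1 := by
          rw [Finset.card_sdiff_of_subset hτσ', hpure σ' hσ']
          have := hτ.2
          omega
        obtain ⟨e, he⟩ := Finset.card_eq_one.1 this
        refine ⟨e, (Finset.mem_sdiff.1 (he ▸ Finset.mem_singleton_self e)).2, ?_⟩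
        rw [← Finset.sdiff_union_of_subset hτσ', he, Finset.insert_eq]
      rcases hall (c j) e he hσ' with rfl | rfl
      · exact ⟨j, by rw [hcs]⟩
      · refine ⟨j - 1, ?_⟩
        rw [hcs' (j - 1), sub_add_cancel, Finset.insert_comm]
    obtain ⟨y, hyU, hyσ, hy⟩ := hσ.exists_mem_openCone hpure hv (hpcone σ hρσ)
      (Metric.ball_mem_nhds p hε) (dense_isGeneric hv)
    obtain ⟨z, hzU, hzσ, hz⟩ := (hfac 0).exists_mem_openCone hpure hv
      (hpcone _ (hSσ _ ⟨0, rfl⟩).2) (Metric.ball_mem_nhds p hε) (dense_isGeneric hv)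
    -- The orbit covers a generic point inside the cone of `σ`; as only `σ` contains that point, `σ`
    -- is in the orbit.
    have hcount : 0 < coverCount v S y := by
      rw [hI.coverCount_eq hpure hv (fun σ hσ => (hSσ σ hσ).1) Metric.isOpen_ball
        (convex_ball p ε) hcl hyU hy hzU hz]
      exact coverCount_pos ⟨0, rfl⟩ (openCone_subset_cone hzσ)
    obtain ⟨σ', hσ', hyσ'⟩ := exists_of_coverCount_pos hcount
    rw [(hu y hy).unique ⟨hσ, openCone_subset_cone hyσ⟩ ⟨(hSσ σ' hσ').1, hyσ'⟩]
    exact hσ'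
  refine ⟨n, fun i => c i, h3, Subtype.val_injective.comp hcinj, fun G => ⟨?_, ?_⟩⟩
  · rintro ⟨-, hdisj, hG⟩
    obtain ⟨σ, hσ, hGσ⟩ := hG.exists_isFacet
    obtain ⟨i, rfl⟩ := hsurj σ hσ (Finset.subset_union_right.trans hGσ)
    have hsub : G ⊆ {(c i : V), (c (i + 1) : V)} := by
      intro m hm
      have h1 := hGσ (Finset.mem_union_left _ hm)
      have h2 := Finset.disjoint_left.1 hdisj hm
      simp only [Finset.mem_insert, h2, or_false, Finset.mem_singleton] at h1 ⊢
      exact h1.symm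
    have hsub' : (G : Set V) ⊆ {(c i : V), (c (i + 1) : V)} := by
      simpa using Finset.coe_subset.2 hsub
    rcases Set.subset_pair_iff_eq.1 hsub' with h | h | h | h
    · exact Or.inl (by exact_mod_cast h)
    · exact Or.inr (Or.inl ⟨i, by exact_mod_cast h⟩)
    · exact Or.inr (Or.inl ⟨i + 1, by exact_mod_cast h⟩)
    · exact Or.inr (Or.inr ⟨i, by exact_mod_cast h⟩)
  · have hlink : ∀ i, ∀ G ⊆ {(c i : V), (c (i + 1) : V)}, G ∈ link Δ ρ := by
      intro i G hG
      have h1 : G ∪ ρ ⊆ insert (c (i + 1) : V) (insert (c i : V) ρ) := by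
        intro m hm
        rcases Finset.mem_union.1 hm with hm | hm
        · have := hG hm
          simp only [Finset.mem_insert, Finset.mem_singleton] at this ⊢
          tauto
        · simp [hm]
      refine ⟨(hfac i).isFace.subset (Finset.subset_union_left.trans h1),
        Finset.disjoint_left.2 fun m hm => ?_, (hfac i).isFace.subset h1⟩
      have := hG hm
      simp only [Finset.mem_insert, Finset.mem_singleton] at this
      rcases this with rfl | rfl
      · exact (c i).2.1
      · exact (c (i + 1)).2.1
    rintro (rfl | ⟨i, rfl⟩ | ⟨i, rfl⟩)
    · exact hlink 0 _ (Finset.empty_subset _)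
    · exact hlink i _ (by simp)
    · exact hlink i _ (Finset.Subset.refl _)

end Links

end SimplicialFan

/-! ### The equivalences -/

open SimplicialFan in
theorem theorem2p8 {V : Type*} [Fintype V] [DecidableEq V] {D : ℕ} (hD : 1 ≤ D)
    (Δ : PreAbstractSimplicialComplex V) (hpure : IsPure Δ D)
    (v : V → EuclideanSpace ℝ (Fin D)) (hv : IsPreEmbedding Δ v) (hICoP : HasICoP Δ v) :
    List.TFAE
      [IsHomeomorph (sphereMap hv),
       IsCompleteFan Δ v,
       ∀ y, IsGeneric Δ v y → InExactlyOneFacetCone Δ v y,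
       ∃ y, InExactlyOneFacetCone Δ v y,
       IsStronglyConnected Δ D ∧ NoCodimTwoSingularities Δ D ∧ AllElementaryCyclesSimple Δ v,
       IsStronglyConnected Δ D ∧ HasDegreeOneOrNegOne hv] := by
  tfae_have 1 → 4 := fun h => exists_inExactlyOneFacetCone_of_injective hpure hv h.injective
  tfae_have 4 → 3 := fun h _ hy => hICoP.inExactlyOneFacetCone_of_exists hpure hv h hy
  tfae_have 3 → 2 := fun h => hICoP.isCompleteFan_of_unique hpure hv h
  tfae_have 2 → 1 := fun h => h.isHomeomorph_sphereMap hv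
  tfae_have 3 → 5 := fun h => ⟨hICoP.isStronglyConnected_of_unique hpure hv h,
    fun _ hρ => exists_isElementaryCycle hpure hv hICoP h hρ,
    fun _ hρ _ _ hc => hc.isSimpleCycle hpure hv hICoP hρ (starInjective_of_unique h ∅)⟩
  tfae_have 5 → 4 := fun ⟨hconn, hsing, hsimple⟩ =>
    exists_inExactlyOneFacetCone_of_starInjective hpure hv hICoP (fun ρ hρ => by
      obtain ⟨n, c, hc⟩ := hsing ρ hρ
      exact IsSimpleCycle.starInjective hpure hv hICoP hc hρ (hsimple ρ hρ n c hc)) hconn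
  tfae_have 3 → 6 := fun h => ⟨hICoP.isStronglyConnected_of_unique hpure hv h,
    hICoP.hasDegreeOneOrNegOne_of_unique hpure hv h⟩
  tfae_have 6 → 4 := fun ⟨hconn, hdeg⟩ => hICoP.unique_of_hasDegree hpure hv hD hconn hdeg
  tfae_finish
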